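/- Let $G$ be a finite group of order $g=|G|$. A $G$-scheme is a scheme with an action of $G$; over a base $S$ with trivial action this is the same as an $S$-scheme with an action of the constant finite group scheme $G_S\to S$. The equivariant Nisnevich topology on $G$-schemes is generated by the empty cover of $\emptyset$ and the families $\{A\xrightarrow{i} X,\ Y\xrightarrow{p} X\}$ of equivariant morphisms, separated and of finite type, with $i$ an open immersion, $p$ \'etale, and such that, with $B=A\times_XY$, $p$ induces an isomorphism $(Y-B)_{\mathrm{red}}\cong (X-A)_{\mathrm{red}}$; a Nisnevich cover of a $G$-scheme is a family of equivariant \'etale morphisms, separated and of finite type, that is covering for this topology. A $G$-vector bundle $E\to U$ over a $G$-scheme $U$ is a (geometric) vector bundle of finite rank with an action of $G$ on $E$ that is linear over the action on $U$. An $N$-affine bundle over a $G$-scheme $X$ is an equivariant morphism of $G$-schemes $Y\to X$ for which there is a Nisnevich cover $\{U_i\to X\}_{i\in I}$ such that every $Y\times_XU_i\to U_i$ is a $G$-vector bundle. A scheme $X$ has an ample family of line bundles if it is quasi-compact and covered by affine open subsets of the form $X_s=\{s\neq 0\}$, where $s$ is a global section of a line bundle on $X$. (1) Let $X$ be a $G$-scheme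 that has an ample family of line bundles, with $g^{-1}\in\Gamma(X,\mathcal O_X)$. Then there exists an $N$-affine bundle $W\to X$ where $W$ is an affine scheme. (2) Let $S$ be a regular separated Noetherian scheme with $g^{-1}\in\Gamma(S,\mathcal O_S)$, and let $X$ be a smooth separated $S$-scheme of finite type with an action of $G$ by $S$-automorphisms. Then there exists an $N$-affine bundle $W\to X$ where $W$ is an affine scheme. -/

import Mathlib

open CategoryTheory CategoryTheory.Limits AlgebraicGeometry

universe v u

namespace EquivariantJouanolou

noncomputable section

/-! ### Line bundles and ample families -/

section Ample

variable {X : Scheme.{u}}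

/-- Restriction of a section of a sheaf of modules to a smaller open subset. -/
def res {L : X.Modules} {U V : X.Opens} (h : V ≤ U) (e : Γ(L, U)) : Γ(L, V) :=
  L.presheaf.map (homOfLE h).op e

/-- The section `e` of `L` over `U` is a free generator of `L` over `U`: the map
`𝒪_U ⟶ L|_U`, `a ↦ a • e`, is an isomorphism of sheaves. -/
def IsFreeGenerator {L : X.Modules} {U : X.Opens} (e : Γ(L, U)) : Prop :=
  ∀ (V : X.Opens) (h : V ≤ U), Function.Bijective fun a : Γ(X, V) => a • res h e

/-- A line bundle: a sheaf of modules which is locally free of rank one. -/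
def IsLineBundle (L : X.Modules) : Prop :=
  ∀ x : X, ∃ U : X.Opens, x ∈ U ∧ ∃ e : Γ(L, U), IsFreeGenerator e

/-- The open set `X_s` where the global section `s` of a line bundle `L` does not vanish,
i.e. the largest open set over which `s : 𝒪_X ⟶ L` is an isomorphism. -/
def nonvanishingLocus {L : X.Modules} (s : Γ(L, ⊤)) : X.Opens :=
  sSup {U : X.Opens | IsFreeGenerator (res (le_top : U ≤ ⊤) s)}

variable (X) in
/-- `X` has an ample family of line bundles: `X` is quasi-compact, and it has a family of line
bundles such that the affine open sets among the `X_s`, `s` a global section of a member of the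
family, cover `X`. (Usually `s` may be a section of a positive tensor power of a member. As such
powers are line bundles and can be added to the family, existence is the same. Such an `X` is
automatically quasi-separated, and the affine `X_s` form a basis of the topology if one allows all
tensor powers.) -/
def HasAmpleFamily : Prop :=
  CompactSpace X ∧
    ∃ (ι : Type u) (L : ι → X.Modules), (∀ i, IsLineBundle (L i)) ∧
      ∀ x : X, ∃ (i : ι) (s : Γ(L i, ⊤)),
        x ∈ nonvanishingLocus s ∧ IsAffineOpen (nonvanishingLocus s)

end Ample

/-! ### Regular schemes -/

/-- A locally Noetherian scheme is regular if all its local rings are regular. -/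
class IsRegular (S : Scheme.{u}) : Prop extends IsLocallyNoetherian S where
  stalk : ∀ s : S, IsRegularLocalRing (S.presheaf.stalk s)

/-! ### Vector bundles -/

/-- The `T`-points of the `U`-scheme `π : E ⟶ U`, where `T` is a `U`-scheme via `t`. -/
def Points {E U T : Scheme.{u}} (π : E ⟶ U) (t : T ⟶ U) : Type u :=
  {s : T ⟶ E // s ≫ π = t}

/-- Pullback of points along a morphism `h : T' ⟶ T`. -/
def Points.pull {E U T T' : Scheme.{u}} {π : E ⟶ U} {t : T ⟶ U} (h : T' ⟶ T)
    (s : Points π t) : Points π (h ≫ t) :=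
  ⟨h ≫ s.1, by rw [Category.assoc, s.2]⟩

/-- The structure of a (geometric) vector bundle on a `U`-scheme `π : E ⟶ U`: the structure of
an `𝒪`-module on the functor of points `T ↦ E(T)` of `E` over `U` which is, Zariski locally on `U`,
isomorphic to the one of some affine space `𝔸ⁿ`, i.e. locally on `U` there are sections
`e₁, …, eₙ` of `E` such that `E(T)` is a free `Γ(T, 𝒪_T)`-module on the pullbacks of the `eⱼ`,
for all `T`. -/
structure VectorBundleStructure {E U : Scheme.{u}} (π : E ⟶ U) where
  addCommGroup : ∀ {T : Scheme.{u}} (t : T ⟶ U), AddCommGroup (Points π t)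
  module : ∀ {T : Scheme.{u}} (t : T ⟶ U), Module Γ(T, ⊤) (Points π t)
  pull_add : ∀ {T T' : Scheme.{u}} (h : T' ⟶ T) (t : T ⟶ U) (s s' : Points π t),
    (s + s').pull h = s.pull h + s'.pull h
  pull_smul : ∀ {T T' : Scheme.{u}} (h : T' ⟶ T) (t : T ⟶ U) (a : Γ(T, ⊤)) (s : Points π t),
    (a • s).pull h = (h.appTop a) • s.pull h
  locally_trivial : ∀ x : U, ∃ V : U.Opens, x ∈ V ∧ ∃ (n : ℕ) (e : Fin n → Points π V.ι),
    ∀ {T : Scheme.{u}} (t : T ⟶ V),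
      Function.Bijective fun c : Fin n → Γ(T, ⊤) => ∑ j, c j • (e j).pull t

end

/-! ### `G`-schemes

For a (finite) group `G`, a `G`-scheme is an object of `Action Scheme G`, a scheme with an action
of `G` by automorphisms; morphisms are the equivariant morphisms. If the action is one by
`S`-automorphisms, this is the same as an action of the constant `S`-group scheme with group `G`. -/

variable {G : Type v} [Group G]

/-- The action of `g` on points: it takes `T`-points of `E` over `t` to `T`-points over `g ∘ t`. -/
def Points.act {E U : Action Scheme.{u} G} {π : E ⟶ U} {T : Scheme.{u}} {t : T ⟶ U.V} (g : G)
    (s : Points π.hom t) : Points π.hom (t ≫ U.ρ g) :=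
  ⟨s.1 ≫ E.ρ g, by rw [Category.assoc, π.comm, ← Category.assoc, s.2]⟩

/-- The structure of a `G`-vector bundle on an equivariant morphism of `G`-schemes `π : E ⟶ U`:
the structure of a vector bundle on `E` over `U` such that each `g` acts linearly on `E`
(over its action on `U`). -/
structure GVectorBundleStructure {E U : Action Scheme.{u} G} (π : E ⟶ U) extends
    VectorBundleStructure π.hom where
  act_add : ∀ (g : G) {T : Scheme.{u}} (t : T ⟶ U.V) (s s' : Points π.hom t),
    (s + s').act g = s.act g + s'.act g
  act_smul : ∀ (g : G) {T : Scheme.{u}} (t : T ⟶ U.V) (a : Γ(T, ⊤)) (s : Points π.hom t),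
    (a • s).act g = a • s.act g

/-- The equivariant morphism `π : E ⟶ U` is a `G`-vector bundle. -/
def IsGVectorBundle {E U : Action Scheme.{u} G} (π : E ⟶ U) : Prop :=
  Nonempty (GVectorBundleStructure π)

/-! ### The equivariant Nisnevich topology -/

/-- The cartesian square of `G`-schemes on `i : A ⟶ X` and `p : Y ⟶ X`, with fourth vertex
`B = A ×_X Y`, is a distinguished Nisnevich square: `i` is an open immersion, `p` is étale, and
`p` induces an isomorphism `(Y - B)_red ≅ (X - A)_red`. Both `i` and `p` are to be separated and
of finite type; besides étaleness this says that `i` and `p` are quasi-compact and that `p` is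
separated. -/
structure IsDistinguished {X A Y : Action Scheme.{u} G} (i : A ⟶ X) (p : Y ⟶ X) : Prop where
  isOpenImmersion : IsOpenImmersion i.hom
  quasiCompact_left : QuasiCompact i.hom
  etale : Etale p.hom
  isSeparated : IsSeparated p.hom
  quasiCompact_right : QuasiCompact p.hom
  complement : ∃ (Z' Z : Scheme.{u}) (z' : Z' ⟶ Y.V) (z : Z ⟶ X.V) (e : Z' ≅ Z),
    IsReduced Z' ∧ IsReduced Z ∧ IsClosedImmersion z' ∧ IsClosedImmersion z ∧
    Set.range z = (Set.range i.hom)ᶜ ∧ Set.range z' = (p.hom ⁻¹' Set.range i.hom)ᶜ ∧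
    e.hom ≫ z = z' ≫ p.hom

variable (G) in
/-- The equivariant Nisnevich topology on `G`-schemes: the topology generated by the
distinguished Nisnevich squares, i.e. the coarsest one in which `{A ⟶ X, Y ⟶ X}` covers `X` for
every distinguished square and the empty family covers the empty scheme. -/
def nisnevichTopology : GrothendieckTopology (Action Scheme.{u} G) :=
  sInf {J | (∀ {X A Y : Action Scheme.{u} G} (i : A ⟶ X) (p : Y ⟶ X), IsDistinguished i p →
      Sieve.generate (Presieve.singleton i ⊔ Presieve.singleton p) ∈ J X) ∧
    ∀ X : Action Scheme.{u} G, IsEmpty X.V → (⊥ : Sieve X) ∈ J X}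

/-- A Nisnevich cover of the `G`-scheme `X`: a family of equivariant étale morphisms, separated and
of finite type, which is a covering family for the equivariant Nisnevich topology. -/
structure IsNisnevichCover {X : Action Scheme.{u} G} {ι : Type u} (U : ι → Action Scheme.{u} G)
    (f : ∀ i, U i ⟶ X) : Prop where
  etale : ∀ i, Etale (f i).hom
  isSeparated : ∀ i, IsSeparated (f i).hom
  quasiCompact : ∀ i, QuasiCompact (f i).hom
  mem : Sieve.ofArrows U f ∈ nisnevichTopology G X

/-- An equivariant morphism `π : Y ⟶ X` is an `N`-affine bundle if for some Nisnevich cover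
`{U i ⟶ X}` all base changes `Y ×_X U i ⟶ U i` are `G`-vector bundles. -/
def IsNAffineBundle {Y X : Action Scheme.{u} G} (π : Y ⟶ X) : Prop :=
  ∃ (ι : Type u) (U : ι → Action Scheme.{u} G) (f : ∀ i, U i ⟶ X), IsNisnevichCover U f ∧
    ∀ i, IsGVectorBundle (pullback.snd π (f i))

end EquivariantJouanolou

/-! This is Jouanolou's trick, made equivariant by coinduction. Finitely many sections s_i of line
bundles L_i without common zero give a surjective evaluation map from the sum of the duals of the
L_i to 𝒪_X. Its splittings, the tuples φ_i of dual sections with ∑ s_i φ_i = 1, form a torsor W₀ → X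
under the kernel, which is a vector bundle. The morphism W₀ → X is affine. The scheme W₀ is affine
too: the functions s_i φ_i sum to 1, and each of their nonvanishing loci is a principal open subset
of the preimage of the affine locus of s_i (`isAffine_of_splitting`). Over an affine Y → X the
torsor has a section, so Y ×_X W₀ becomes a vector bundle (`nonempty_vectorBundleStructure`).

The group need not act on W₀, since the line bundles are not equivariant. So W₀ is replaced by the
fibre product W over X of its pullbacks along all the `X.ρ h`, whose factors `G` permutes
(`exists_coinduction`). For an equivariant Y → X with Y affine, a section of W₀ over Y, taken in
every factor, is an invariant section of W over Y, because the group only permutes the factors.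
Hence Y ×_X W is a `G`-vector bundle (`isGVectorBundle_of_coinduction`).

It remains to cover X by affine `G`-schemes. Let V_k be a finite family of affine opens that covers
X and is permuted by `G`. The coproduct Y_n of the n-fold intersections is an affine `G`-scheme, as
X has affine diagonal. Over the points in exactly n members, Y_n → X is bijective, so counting
members filters X by distinguished squares (`isDistinguished_stratum`,
`isNisnevichCover_stratumCover`).

For smooth X over a regular base the sections have to be constructed. The local rings of X are
regular, hence factorial (Auslander–Buchsbaum, by Nagata's argument with finite free resolutions).
The complement of a dense affine open in a separated Noetherian scheme with factorial local rings is
locally cut out by one equation (`exists_complIdeal_eq_span`), so dense affine opens are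
nonvanishing loci of sections of line bundles. -/

namespace EquivariantJouanolou

/-! ### Gluing representable pieces of a Zariski sheaf over a scheme -/

/-- A presheaf on the category of schemes over `X`, in unbundled form. -/
structure RelPresheaf (X : Scheme.{u}) where
  obj : ∀ {T : Scheme.{u}} (_ : T ⟶ X), Type u
  pull : ∀ {T T' : Scheme.{u}} (h : T' ⟶ T) {t : T ⟶ X} {t' : T' ⟶ X} (_ : h ≫ t = t'),
    obj t → obj t'
  pull_id : ∀ {T : Scheme.{u}} {t : T ⟶ X} (e : 𝟙 T ≫ t = t) (p : obj t), pull (𝟙 T) e p = p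
  pull_pull : ∀ {T T' T'' : Scheme.{u}} (h' : T'' ⟶ T') (h : T' ⟶ T) {t : T ⟶ X} {t' : T' ⟶ X}
    {t'' : T'' ⟶ X} (e : h ≫ t = t') (e' : h' ≫ t' = t'') (e'' : (h' ≫ h) ≫ t = t'') (p : obj t),
    pull h' e' (pull h e p) = pull (h' ≫ h) e'' p

namespace RelPresheaf

variable {X : Scheme.{u}} (P : RelPresheaf X)

/-- The Zariski sheaf condition. -/
def IsSheaf : Prop :=
  ∀ {T : Scheme.{u}} (t : T ⟶ X) (𝒰 : Scheme.OpenCover.{u} T) (p : ∀ i, P.obj (𝒰.f i ≫ t)),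
    (∀ i j, P.pull (pullback.fst (𝒰.f i) (𝒰.f j)) rfl (p i) =
      P.pull (pullback.snd (𝒰.f i) (𝒰.f j)) (by rw [← pullback.condition_assoc]) (p j)) →
    ∃! q : P.obj t, ∀ i, P.pull (𝒰.f i) rfl q = p i

/-- The proof argument of `pull` carries the transport along `h ≫ t = t'`, so equality of dependent
pairs needs no casts. -/
lemma sigma_pull_eq_iff {T T' : Scheme.{u}} {h : T' ⟶ T} {t : T ⟶ X} {t' : T' ⟶ X} {p : P.obj t}
    {p' : P.obj t'} :
    (⟨h ≫ t, P.pull h rfl p⟩ : Σ t : T' ⟶ X, P.obj t) = ⟨t', p'⟩ ↔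
      ∃ e : h ≫ t = t', P.pull h e p = p' := by
  constructor
  · rintro ⟨⟩
    exact ⟨rfl, rfl⟩
  · rintro ⟨rfl, rfl⟩
    rfl

/-- The presheaf on schemes with sections over `T` the pairs of a morphism `t : T ⟶ X` and a
section of `P` over `t`. -/
def total : Scheme.{u}ᵒᵖ ⥤ Type u where
  obj T := Σ t : T.unop ⟶ X, P.obj t
  map f := ↾fun x => ⟨f.unop ≫ x.1, P.pull f.unop rfl x.2⟩
  map_id T := by
    apply ConcreteCategory.hom_ext
    rintro ⟨t, p⟩
    exact P.sigma_pull_eq_iff.mpr ⟨Category.id_comp t, P.pull_id _ _⟩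
  map_comp f g := by
    apply ConcreteCategory.hom_ext
    rintro ⟨t, p⟩
    exact P.sigma_pull_eq_iff.mpr ⟨Category.assoc _ _ _, (P.pull_pull _ _ _ _ _ _).symm⟩

/-- The morphisms to `X` glue first, and the sections then glue over the resulting morphism by `hP`.
-/
lemma isSheaf_total (hP : P.IsSheaf) : Presieve.IsSheaf Scheme.zariskiTopology P.total := by
  rw [Precoverage.isSheaf_toGrothendieck_iff_of_isStableUnderBaseChange_of_small.{u}]
  intro T 𝒰
  rw [Presieve.isSheafFor_arrows_iff]
  intro x hx
  let τ (i : 𝒰.I₀) : 𝒰.X i ⟶ X := (x i).1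
  let π (i : 𝒰.I₀) : P.obj (τ i) := (x i).2
  have hc (i j : 𝒰.I₀) : ∃ e : pullback.snd (𝒰.f i) (𝒰.f j) ≫ τ j = pullback.fst _ _ ≫ τ i,
      P.pull _ e (π j) = P.pull _ rfl (π i) :=
    P.sigma_pull_eq_iff.mp (hx i j _ (pullback.fst (𝒰.f i) (𝒰.f j))
      (pullback.snd _ _) pullback.condition).symm
  let t : T ⟶ X := Scheme.Cover.glueMorphisms 𝒰 τ (fun i j => (hc i j).1.symm)
  have ht (i) : 𝒰.f i ≫ t = τ i := Scheme.Cover.ι_glueMorphisms 𝒰 _ _ i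
  have key : ∃! q : P.obj t, ∀ i, P.pull (𝒰.f i) (ht i) q = π i := by
    -- The sections live over `τ i`, the sheaf condition wants them over `𝒰.f i ≫ t`; with `τ`
    -- opaque the two can be identified by substitution.
    clear_value τ π t
    obtain rfl : (fun i => 𝒰.f i ≫ t) = τ := funext ht
    exact hP t 𝒰 π fun i j => (hc i j).2.symm
  obtain ⟨q, hq, hq'⟩ := key
  refine ⟨⟨t, q⟩, fun i => P.sigma_pull_eq_iff.mpr ⟨ht i, hq i⟩, ?_⟩
  rintro ⟨t', q'⟩ h
  have h' (i) : ∃ e : 𝒰.f i ≫ t' = τ i, P.pull (𝒰.f i) e q' = π i :=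
    P.sigma_pull_eq_iff.mp (h i)
  obtain rfl : t' = t := Scheme.Cover.hom_ext 𝒰 _ _ fun i => (h' i).1.trans (ht i).symm
  rw [hq' q' fun i => (h' i).2]

/-- The section `univ` of `P` over `w : W ⟶ X` makes `W` represent the restriction of `P` to the
schemes over `U`. -/
structure IsUniversal (U : X.Opens) {W : Scheme.{u}} (w : W ⟶ X) (univ : P.obj w) : Prop where
  preimage_eq : w ⁻¹ᵁ U = ⊤
  existsUnique : ∀ {T : Scheme.{u}} (t : T ⟶ X), t ⁻¹ᵁ U = ⊤ → ∀ p : P.obj t,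
    ∃! h : T ⟶ W, ∃ e : h ≫ w = t, P.pull h e univ = p

/-- The morphism of presheaves given by a section. -/
def toTotal {W : Scheme.{u}} (w : W ⟶ X) (p : P.obj w) : yoneda.obj W ⟶ P.total :=
  yonedaEquiv.symm ⟨w, p⟩

variable {P} in
-- A section of `P.total` over `T` is a pair `(t, p)`, and the fibre product of `W` with `T` along
-- it is the open subscheme `t ⁻¹ᵁ U`: a morphism to `T` lifts to `W` exactly when its composite
-- with `t` lands in `U`, and then uniquely.
lemma IsUniversal.isOpenImmersion_toTotal {U : X.Opens} {W : Scheme.{u}} {w : W ⟶ X}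
    {univ : P.obj w} (H : P.IsUniversal U w univ) :
    IsOpenImmersion.presheaf (P.toTotal w univ) := by
  apply MorphismProperty.relative.of_exists
  intro T g
  obtain ⟨⟨t, p⟩, rfl⟩ := yonedaEquiv.symm.surjective g
  obtain ⟨h, ⟨e, he⟩, -⟩ := H.existsUnique ((t ⁻¹ᵁ U).ι ≫ t) (by simp)
    (P.pull (t ⁻¹ᵁ U).ι rfl p)
  have key {T' : Scheme.{u}} (k : T' ⟶ (t ⁻¹ᵁ U).toScheme) :
      ∃ e' : (k ≫ h) ≫ w = (k ≫ (t ⁻¹ᵁ U).ι) ≫ t, P.pull (k ≫ h) e' univ = P.pull _ rfl p :=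
    ⟨by simp [e], by rw [← P.pull_pull k h e (by simp), he, P.pull_pull _ _ _ _ rfl]⟩
  refine ⟨(t ⁻¹ᵁ U).toScheme, yoneda.map h, (t ⁻¹ᵁ U).ι, ?_, inferInstance⟩
  apply IsPullback.of_forall_isPullback_app
  rintro ⟨T'⟩
  rw [Types.isPullback_iff]
  refine ⟨?_, ?_, ?_⟩
  · ext (k : T' ⟶ _)
    exact P.sigma_pull_eq_iff.mpr (key k)
  · rintro (k : T' ⟶ _) (k' : T' ⟶ _) ⟨-, h2 : k ≫ (t ⁻¹ᵁ U).ι = k' ≫ (t ⁻¹ᵁ U).ι⟩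
    rwa [cancel_mono] at h2
  · rintro (a : T' ⟶ _) (b : T' ⟶ _) h2
    obtain ⟨e1, e2⟩ : ∃ e : a ≫ w = b ≫ t, P.pull a e univ = P.pull b rfl p :=
      P.sigma_pull_eq_iff.mp h2
    have hb : Set.range b ⊆ Set.range (t ⁻¹ᵁ U).ι := by
      rintro _ ⟨y, rfl⟩
      have hy : w (a y) ∈ U := by
        have : a y ∈ w ⁻¹ᵁ U := H.preimage_eq ▸ trivial
        exact this
      rw [← Scheme.Hom.comp_apply, e1] at hy
      simpa using hy
    refine ⟨IsOpenImmersion.lift (t ⁻¹ᵁ U).ι b hb, ?_, IsOpenImmersion.lift_fac _ _ _⟩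
    have hfac := IsOpenImmersion.lift_fac (t ⁻¹ᵁ U).ι b hb
    generalize IsOpenImmersion.lift (t ⁻¹ᵁ U).ι b hb = k at hfac
    subst hfac
    refine (H.existsUnique ((k ≫ (t ⁻¹ᵁ U).ι) ≫ t) ?_ (P.pull _ rfl p)).unique ?_ ⟨e1, e2⟩
    · rw [Category.assoc, Scheme.Hom.comp_preimage, Scheme.Hom.comp_preimage]
      simp
    · exact key k

/-- The `W i` are open subfunctors that cover the Zariski sheaf `P.total`, which is therefore
representable; the identity of the representing scheme gives `w` and `univ`. -/
theorem exists_isUniversal (hP : P.IsSheaf) {ι : Type u} (U : ι → X.Opens) (hU : ⨆ i, U i = ⊤)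
    (W : ι → Scheme.{u}) (w : ∀ i, W i ⟶ X) (univ : ∀ i, P.obj (w i))
    (H : ∀ i, P.IsUniversal (U i) (w i) (univ i)) :
    ∃ (W : Scheme.{u}) (w : W ⟶ X) (univ : P.obj w), P.IsUniversal ⊤ w univ := by
  let F : Sheaf Scheme.zariskiTopology.{u} (Type u) :=
    ⟨P.total, (isSheaf_iff_isSheaf_of_type _ _).mpr (P.isSheaf_total hP)⟩
  let f (i : ι) : yoneda.obj (W i) ⟶ F.1 := P.toTotal (w i) (univ i)
  have hf (i : ι) : IsOpenImmersion.presheaf (f i) := (H i).isOpenImmersion_toTotal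
  have : Presheaf.IsLocallySurjective Scheme.zariskiTopology (Sigma.desc f) := by
    refine ⟨fun {T} x => ?_⟩
    obtain ⟨t, p⟩ : Σ t : T ⟶ X, P.obj t := x
    let 𝒰 : T.OpenCover := T.openCoverOfIsOpenCover (fun i => t ⁻¹ᵁ U i) (by
      rw [TopologicalSpace.IsOpenCover, ← Scheme.Hom.preimage_iSup, hU, Scheme.Hom.preimage_top])
    refine Scheme.zariskiTopology.superset_covering ?_ 𝒰.mem_grothendieckTopology
    rw [Sieve.ofArrows, Sieve.generate_le_iff]
    rintro _ _ ⟨i : ι⟩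
    obtain ⟨h, ⟨e, he⟩, -⟩ := (H i).existsUnique ((t ⁻¹ᵁ U i).ι ≫ t) (by simp)
      (P.pull (t ⁻¹ᵁ U i).ι rfl p)
    refine ⟨(Sigma.ι (fun i => yoneda.obj (W i)) i).app _ h, ?_⟩
    have h1 : Sigma.ι (fun i => yoneda.obj (W i)) i ≫ Sigma.desc f = f i := Sigma.ι_desc _ _
    have h2 : (⟨h ≫ w i, P.pull h rfl (univ i)⟩ : Σ t : (t ⁻¹ᵁ U i).toScheme ⟶ X, P.obj t) =
        ⟨(t ⁻¹ᵁ U i).ι ≫ t, P.pull (t ⁻¹ᵁ U i).ι rfl p⟩ := P.sigma_pull_eq_iff.mpr ⟨e, he⟩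
    exact (ConcreteCategory.congr_hom (NatTrans.congr_app h1 _) h).trans h2
  have hr := Scheme.LocalRepresentability.representableBy hf
  generalize (Scheme.LocalRepresentability.glueData hf).glued = V at hr
  let x : Σ t : V ⟶ X, P.obj t := hr.homEquiv (𝟙 V)
  refine ⟨V, x.1, x.2, by simp, fun {T} t _ p => ?_⟩
  have (h : T ⟶ V) : hr.homEquiv h = (⟨h ≫ x.1, P.pull h rfl x.2⟩ : Σ t : T ⟶ X, P.obj t) := by
    have := hr.homEquiv_comp h (𝟙 V)
    rw [Category.comp_id] at this
    exact this
  refine ⟨hr.homEquiv.symm ⟨t, p⟩, ?_, ?_⟩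
  · apply P.sigma_pull_eq_iff.mp
    rw [← this]
    exact hr.homEquiv.apply_symm_apply _
  · intro h he
    apply hr.homEquiv.injective
    rw [this]
    exact (P.sigma_pull_eq_iff.mpr he).trans (hr.homEquiv.apply_symm_apply _).symm

end RelPresheaf
end EquivariantJouanolou

namespace EquivariantJouanolou

noncomputable section

/-! ### Restriction and pullback of functions -/

section Functions

variable {X T T' : Scheme.{u}}

/-- Restriction of functions to a smaller open subset. -/
def rs {U V : X.Opens} (h : V ≤ U) : Γ(X, U) →+* Γ(X, V) := (X.presheaf.map (homOfLE h).op).hom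

/-- Pullback of functions along `t`. -/
def pb (t : T ⟶ X) {U : X.Opens} {V : T.Opens} (h : V ≤ t ⁻¹ᵁ U) : Γ(X, U) →+* Γ(T, V) :=
  (t.appLE U V h).hom

@[simp]
lemma rs_rs {U V W : X.Opens} (h : V ≤ U) (h' : W ≤ V) (x : Γ(X, U)) :
    rs h' (rs h x) = rs (h'.trans h) x := by
  simp only [rs, ← CommRingCat.comp_apply, ← Functor.map_comp]
  rfl

@[simp]
lemma rs_self {U : X.Opens} (h : U ≤ U) (x : Γ(X, U)) : rs h x = x := by
  simp only [rs]
  exact congr($(X.presheaf.map_id _) x)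

@[simp]
lemma rs_pb (t : T ⟶ X) {U : X.Opens} {V W : T.Opens} (h : V ≤ t ⁻¹ᵁ U) (h' : W ≤ V)
    (x : Γ(X, U)) : rs h' (pb t h x) = pb t (h'.trans h) x :=
  congr($(t.appLE_map h (homOfLE h').op) x)

@[simp]
lemma pb_rs (t : T ⟶ X) {U U' : X.Opens} {V : T.Opens} (h : V ≤ t ⁻¹ᵁ U) (h' : U ≤ U')
    (x : Γ(X, U')) : pb t h (rs h' x) = pb t (h.trans (t.preimage_mono h')) x :=
  congr($(t.map_appLE h (homOfLE h').op) x)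

lemma pb_pb (h : T' ⟶ T) (t : T ⟶ X) {t' : T' ⟶ X} (e : h ≫ t = t') {U : X.Opens} {V : T.Opens}
    {V' : T'.Opens} (hV : V ≤ t ⁻¹ᵁ U) (hV' : V' ≤ h ⁻¹ᵁ V) (x : Γ(X, U)) :
    pb h hV' (pb t hV x) = pb t' (by subst e; exact hV'.trans (h.preimage_mono hV)) x := by
  subst e
  exact congr($(Scheme.Hom.appLE_comp_appLE h t U V V' hV hV') x)

@[simp]
lemma pb_id {U V : X.Opens} (h : V ≤ 𝟙 X ⁻¹ᵁ U) (x : Γ(X, U)) : pb (𝟙 X) h x = rs (by simpa using h : V ≤ U) x := by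
  have : (𝟙 X : X ⟶ X).appLE U V h = X.presheaf.map (homOfLE h).op := by
    rw [Scheme.Hom.appLE, Scheme.Hom.id_app]
    exact Category.id_comp _
  rw [pb, this]
  rfl

lemma pb_bijective (f : T ⟶ X) [IsOpenImmersion f] {U : X.Opens} (hU : U ≤ f.opensRange)
    {V : T.Opens} (h : V ≤ f ⁻¹ᵁ U) (h' : f ⁻¹ᵁ U ≤ V) : Function.Bijective (pb f h) := by
  obtain rfl := le_antisymm h h'
  have := f.isIso_app U hU
  have : pb f h = (f.app U).hom := by rw [pb, Scheme.Hom.appLE_eq_app]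
  rw [this]
  exact ConcreteCategory.bijective_of_isIso (f.app U)

lemma rs_ext {ι : Type*} {V : X.Opens} (U : ι → X.Opens) (hU : ∀ i, U i ≤ V) (hV : V ≤ ⨆ i, U i)
    {x y : Γ(X, V)} (h : ∀ i, rs (hU i) x = rs (hU i) y) : x = y :=
  TopCat.Sheaf.eq_of_locally_eq' X.sheaf U V (fun i => homOfLE (hU i)) hV x y h

lemma exists_rs_eq {ι : Type*} {V : X.Opens} (U : ι → X.Opens) (hU : ∀ i, U i ≤ V)
    (hV : V ≤ ⨆ i, U i) (x : ∀ i, Γ(X, U i))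
    (h : ∀ i j, rs (inf_le_left : U i ⊓ U j ≤ _) (x i) = rs inf_le_right (x j)) :
    ∃ y : Γ(X, V), ∀ i, rs (hU i) y = x i :=
  (TopCat.Sheaf.existsUnique_gluing' X.sheaf U V (fun i => homOfLE (hU i)) hV x h).exists

/-- Functions on the members of the cover are moved to the ranges in `T`, where this is the sheaf
axiom. Agreement on an intersection of ranges is tested on the fibre product, which maps
isomorphically onto it. -/
lemma existsUnique_pb_eq (𝒰 : Scheme.OpenCover.{u} T) (V : T.Opens)
    (x : ∀ i, Γ(𝒰.X i, 𝒰.f i ⁻¹ᵁ V))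
    (hx : ∀ i j, pb (pullback.fst (𝒰.f i) (𝒰.f j)) le_rfl (x i) =
      pb (pullback.snd (𝒰.f i) (𝒰.f j)) (by
        rw [← Scheme.Hom.comp_preimage, ← Scheme.Hom.comp_preimage, pullback.condition]) (x j)) :
    ∃! y : Γ(T, V), ∀ i, pb (𝒰.f i) le_rfl y = x i := by
  have hle (i) : 𝒰.f i ⁻¹ᵁ V ≤ 𝒰.f i ⁻¹ᵁ (V ⊓ (𝒰.f i).opensRange) := fun y hy => ⟨hy, ⟨y, rfl⟩⟩
  have hb (i) : Function.Bijective (pb (𝒰.f i) (hle i)) :=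
    pb_bijective _ inf_le_right _ ((𝒰.f i).preimage_mono inf_le_left)
  have hcov : V ≤ ⨆ i, V ⊓ (𝒰.f i).opensRange := by
    rw [← inf_iSup_eq, 𝒰.iSup_opensRange, inf_top_eq]
  choose x' hx' using fun i => (hb i).2 (x i)
  obtain ⟨y, hy⟩ := exists_rs_eq (fun i => V ⊓ (𝒰.f i).opensRange) (fun i => inf_le_left) hcov x' (by
    intro i j
    apply (pb_bijective (pullback.fst (𝒰.f i) (𝒰.f j) ≫ 𝒰.f i)
      (U := V ⊓ (𝒰.f i).opensRange ⊓ (V ⊓ (𝒰.f j).opensRange)) ?_ le_rfl le_rfl).1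
    · have hle' : (pullback.fst (𝒰.f i) (𝒰.f j) ≫ 𝒰.f i) ⁻¹ᵁ
          (V ⊓ (𝒰.f i).opensRange ⊓ (V ⊓ (𝒰.f j).opensRange)) ≤
          pullback.fst (𝒰.f i) (𝒰.f j) ⁻¹ᵁ 𝒰.f i ⁻¹ᵁ V :=
        Scheme.Hom.preimage_mono _ (inf_le_left.trans inf_le_left)
      have := congrArg (rs hle') (hx i j)
      rw [← hx', ← hx', pb_pb _ _ rfl, pb_pb _ _ pullback.condition.symm] at this
      simp only [rs_pb, pb_rs] at this ⊢
      exact this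
    · rintro z ⟨⟨-, hi⟩, -, hj⟩
      refine (Set.ext_iff.mp (IsOpenImmersion.range_pullback_to_base_of_left _ _) z).mpr ?_
      exact ⟨hi, hj⟩)
  refine ⟨y, fun i => ?_, fun z hz => ?_⟩
  · rw [← hx' i, ← hy i]
    simp
  · apply rs_ext _ (fun i => inf_le_left) hcov
    intro i
    apply (hb i).1
    rw [hy, hx', ← hz]
    simp

end Functions
end
end EquivariantJouanolou

/-! ### Cocycles for line bundles with sections, and local representability of the splittings -/

namespace EquivariantJouanolou

noncomputable section

/-- Morphisms to an affine open subset are homomorphisms of rings of functions. -/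
lemma existsUnique_pb {X T : Scheme.{u}} {U : X.Opens} (hU : IsAffineOpen U)
    (f : Γ(X, U) →+* Γ(T, ⊤)) : ∃! t : T ⟶ X, ∃ h : ⊤ ≤ t ⁻¹ᵁ U, pb t h = f := by
  have key (t : T ⟶ X) (h : ⊤ ≤ t ⁻¹ᵁ U) :
      T.toSpecΓ ≫ Spec.map (t.appLE U ⊤ h) ≫ hU.fromSpec = t := by
    have : IsIso (⊤ : T.Opens).ι := by
      rw [← Scheme.topIso_hom]; infer_instance
    rw [← cancel_epi (⊤ : T.Opens).ι, ← Category.assoc, ← Scheme.Opens.toSpecΓ_top,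
      Scheme.Opens.toSpecΓ_SpecMap_appLE_assoc, hU.toSpecΓ_fromSpec, Scheme.Hom.resLE_comp_ι]
  refine ⟨T.toSpecΓ ≫ Spec.map (CommRingCat.ofHom f) ≫ hU.fromSpec, ?_, ?_⟩
  · have h : ⊤ ≤ (T.toSpecΓ ≫ Spec.map (CommRingCat.ofHom f) ≫ hU.fromSpec) ⁻¹ᵁ U := by
      rw [Scheme.Hom.comp_preimage, Scheme.Hom.comp_preimage, hU.fromSpec_preimage_self]
      simp
    refine ⟨h, ?_⟩
    have h2 := key _ h
    simp only [← Category.assoc] at h2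
    rw [cancel_mono] at h2
    have h3 := congr(Scheme.Hom.appTop $h2)
    simp only [Scheme.Hom.comp_appTop, Scheme.toSpecΓ_appTop] at h3
    rw [Scheme.ΓSpecIso_naturality, Scheme.ΓSpecIso_naturality] at h3
    exact congr(CommRingCat.Hom.hom $((cancel_epi (Scheme.ΓSpecIso Γ(X, U)).hom).mp h3))
  · rintro t ⟨h, rfl⟩
    exact (key t h).symm

lemma preimage_le_preimage_inf {X T : Scheme.{u}} {t : T ⟶ X} {U : X.Opens} (h : ⊤ ≤ t ⁻¹ᵁ U)
    (V : X.Opens) : t ⁻¹ᵁ V ≤ t ⁻¹ᵁ (U ⊓ V) :=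
  fun y hy => ⟨h (TopologicalSpace.Opens.mem_top y), hy⟩

lemma appTop_apply {T T' : Scheme.{u}} (h : T' ⟶ T) (r : Γ(T, ⊤)) :
    h.appTop r = pb h (V := ⊤) h.preimage_top.ge r := congr($((h.appLE_eq_app (U := ⊤)).symm) r)

variable (X : Scheme.{u}) (A I : Type u)

/-- A finite family, indexed by `I`, of line bundles on `X` with sections, trivialized over an affine
open cover `U a`, `a : A`, and given by transition functions `g i a b` and coordinates `s i a` of the
sections. The loci `D i` where the sections do not vanish are affine and cover `X`. -/
structure AmpleCocycle where
  U : A → X.Opens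
  isAffineOpen_U : ∀ a, IsAffineOpen (U a)
  iSup_U : ⨆ a, U a = ⊤
  s : ∀ (_ : I) (a : A), Γ(X, U a)
  g : ∀ (_ : I) (a b : A), Γ(X, U a ⊓ U b)
  g_self : ∀ i a, g i a a = 1
  g_mul : ∀ i a b c, rs (inf_le_left : U a ⊓ U b ⊓ U c ≤ U a ⊓ U b) (g i a b) *
    rs (le_inf (inf_le_left.trans inf_le_right) inf_le_right) (g i b c) =
      rs (le_inf (inf_le_left.trans inf_le_left) inf_le_right) (g i a c)
  s_eq : ∀ i a b, rs inf_le_left (s i a) = g i a b * rs inf_le_right (s i b)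
  D : I → X.Opens
  isAffineOpen_D : ∀ i, IsAffineOpen (D i)
  iSup_D : ⨆ i, D i = ⊤
  D_inf : ∀ i a, D i ⊓ U a = X.basicOpen (s i a)

namespace AmpleCocycle

variable {X A I} (d : AmpleCocycle X A I)

section

variable {T T' : Scheme.{u}}

/-- Families of functions on the preimages of the `U a`. -/
abbrev Coord (t : T ⟶ X) : Type u := ∀ (_ : I) (a : A), Γ(T, t ⁻¹ᵁ d.U a)

instance (t : T ⟶ X) : Module Γ(T, ⊤) (d.Coord t) where
  smul r φ i a := rs le_top r * φ i a
  one_smul φ := by funext i a; change rs _ 1 * _ = _; simp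
  mul_smul r r' φ := by funext i a; change rs _ _ * _ = _ * (_ * _); simp [mul_assoc]
  smul_zero r := by funext i a; exact mul_zero _
  smul_add r φ ψ := by funext i a; exact mul_add _ _ _
  add_smul r r' φ := by
    funext i a; change rs _ _ * φ i a = _ * φ i a + _ * φ i a; rw [map_add, add_mul]
  zero_smul φ := by funext i a; change rs _ 0 * _ = 0; simp

variable {d} in
@[simp]
lemma Coord.smul_apply {t : T ⟶ X} (r : Γ(T, ⊤)) (φ : d.Coord t) (i : I) (a : A) :
    (r • φ) i a = rs le_top r * φ i a := rfl

/-- The sections over `T` of the pullback of the direct sum of the duals of the line bundles. -/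
def dual (t : T ⟶ X) : Submodule Γ(T, ⊤) (d.Coord t) where
  -- The generators are related by e_b = g_ab e_a, and `φ i a` is the value of the dual section on
  -- e_a. So `φ` is multiplied by `g` from a to b, while the coordinates `s` satisfy s_a = g_ab s_b;
  -- this makes `s i a * φ i a` independent of a.
  carrier := {φ | ∀ i a b, rs (t.preimage_mono (inf_le_right : d.U a ⊓ d.U b ≤ _)) (φ i b) =
    pb t le_rfl (d.g i a b) * rs (t.preimage_mono (inf_le_left : d.U a ⊓ d.U b ≤ _)) (φ i a)}
  zero_mem' i a b := by simp
  add_mem' {φ ψ} hφ hψ i a b := by simp [hφ i a b, hψ i a b, mul_add]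
  smul_mem' r φ hφ i a b := by
    simp only [Coord.smul_apply, map_mul, rs_rs, hφ i a b]
    ring

/-- Pullback of families of functions. -/
def pullCoord (h : T' ⟶ T) {t : T ⟶ X} {t' : T' ⟶ X} (e : h ≫ t = t') : d.Coord t →+ d.Coord t' where
  toFun φ i a := pb h (by rw [← e, Scheme.Hom.comp_preimage]) (φ i a)
  map_zero' := by funext i a; exact map_zero _
  map_add' φ ψ := by funext i a; exact map_add _ _ _

lemma pullCoord_apply (h : T' ⟶ T) {t : T ⟶ X} {t' : T' ⟶ X} (e : h ≫ t = t') (φ : d.Coord t)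
    (i : I) (a : A) : d.pullCoord h e φ i a =
      pb h (by rw [← e, Scheme.Hom.comp_preimage]) (φ i a) := rfl

lemma pullCoord_smul (h : T' ⟶ T) {t : T ⟶ X} {t' : T' ⟶ X} (e : h ≫ t = t') (r : Γ(T, ⊤))
    (φ : d.Coord t) : d.pullCoord h e (r • φ) = h.appTop r • d.pullCoord h e φ := by
  funext i a
  rw [pullCoord_apply, Coord.smul_apply, Coord.smul_apply, map_mul, pb_rs, appTop_apply, rs_pb,
    pullCoord_apply]

lemma pullCoord_id {t : T ⟶ X} (e : 𝟙 T ≫ t = t) (φ : d.Coord t) : d.pullCoord (𝟙 T) e φ = φ := by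
  funext i a
  simp [pullCoord_apply]

lemma pullCoord_pullCoord {T'' : Scheme.{u}} (h' : T'' ⟶ T') (h : T' ⟶ T) {t : T ⟶ X} {t' : T' ⟶ X}
    {t'' : T'' ⟶ X} (e : h ≫ t = t') (e' : h' ≫ t' = t'') (e'' : (h' ≫ h) ≫ t = t'')
    (φ : d.Coord t) :
    d.pullCoord h' e' (d.pullCoord h e φ) = d.pullCoord (h' ≫ h) e'' φ := by
  funext i a
  simp [pullCoord_apply, pb_pb h' h rfl]

lemma pullCoord_mem_dual (h : T' ⟶ T) {t : T ⟶ X} {t' : T' ⟶ X} (e : h ≫ t = t') {φ : d.Coord t}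
    (hφ : φ ∈ d.dual t) : d.pullCoord h e φ ∈ d.dual t' := by
  subst e
  intro i a b
  have := congr(pb h le_rfl $(hφ i a b))
  rw [map_mul, pb_pb h t rfl, pb_rs, pb_rs] at this
  rw [pullCoord_apply, pullCoord_apply, rs_pb, rs_pb]
  exact this

/-- The dual section with prescribed coordinates over `U a`, where `t` factors through `U a`. -/
def ofTriv (t : T ⟶ X) (a : A) (h : ⊤ ≤ t ⁻¹ᵁ d.U a) (x : I → Γ(T, ⊤)) : d.Coord t :=
  fun i b => pb t (preimage_le_preimage_inf h _) (d.g i a b) * rs le_top (x i)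

lemma ofTriv_mem_dual (t : T ⟶ X) (a : A) (h : ⊤ ≤ t ⁻¹ᵁ d.U a) (x : I → Γ(T, ⊤)) :
    d.ofTriv t a h x ∈ d.dual t := by
  intro i b c
  have hle : t ⁻¹ᵁ (d.U b ⊓ d.U c) ≤ t ⁻¹ᵁ (d.U a ⊓ d.U b ⊓ d.U c) := by
    rw [inf_assoc]
    exact preimage_le_preimage_inf h _
  have := congr(pb t hle $(d.g_mul i a b c))
  rw [map_mul, pb_rs, pb_rs, pb_rs] at this
  simp only [ofTriv, map_mul, rs_pb, rs_rs]
  rw [← this]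
  ring

lemma rs_ofTriv (t : T ⟶ X) (a : A) (h : ⊤ ≤ t ⁻¹ᵁ d.U a) (x : I → Γ(T, ⊤)) (i : I) :
    rs h (d.ofTriv t a h x i a) = x i := by
  have hle : (⊤ : T.Opens) ≤ t ⁻¹ᵁ (d.U a ⊓ d.U a) := by rwa [inf_idem]
  have : pb t hle (d.g i a a) = 1 := by rw [d.g_self, map_one]
  rw [ofTriv, map_mul, rs_pb, rs_rs, rs_self, this, one_mul]

/-- Together with `rs_ofTriv`: when `t` factors through `U a`, a dual section amounts to an
arbitrary vector of functions indexed by `I`, its coordinates at a. -/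
lemma ofTriv_rs (t : T ⟶ X) (a : A) (h : ⊤ ≤ t ⁻¹ᵁ d.U a) {φ : d.Coord t} (hφ : φ ∈ d.dual t) :
    d.ofTriv t a h (fun i => rs h (φ i a)) = φ := by
  funext i b
  have hle := preimage_le_preimage_inf h (d.U b)
  have := congr(rs hle $(hφ i a b))
  rw [map_mul, rs_rs, rs_self, rs_rs, rs_pb] at this
  rw [this, ofTriv, rs_rs]

variable [Fintype I]

/-- Evaluation of a dual section on the given sections. -/
def ev (t : T ⟶ X) (φ : d.Coord t) (a : A) : Γ(T, t ⁻¹ᵁ d.U a) :=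
  ∑ i, pb t le_rfl (d.s i a) * φ i a

lemma ev_add (t : T ⟶ X) (φ ψ : d.Coord t) (a : A) : d.ev t (φ + ψ) a = d.ev t φ a + d.ev t ψ a := by
  simp [ev, mul_add, Finset.sum_add_distrib]

lemma ev_smul (t : T ⟶ X) (r : Γ(T, ⊤)) (φ : d.Coord t) (a : A) :
    d.ev t (r • φ) a = rs le_top r * d.ev t φ a := by
  rw [ev, ev, Finset.mul_sum]
  refine Finset.sum_congr rfl fun i _ => ?_
  rw [Coord.smul_apply]
  ring

lemma ev_pullCoord (h : T' ⟶ T) {t : T ⟶ X} {t' : T' ⟶ X} (e : h ≫ t = t') (φ : d.Coord t) (a : A) :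
    d.ev t' (d.pullCoord h e φ) a = pb h (by rw [← e, Scheme.Hom.comp_preimage]) (d.ev t φ a) := by
  subst e
  simp only [ev, map_sum, map_mul, pb_pb h t rfl, pullCoord_apply]

/-- The dual sections with value `1` on the given sections, as a presheaf. -/
def splittings : RelPresheaf X where
  obj {T} t := {φ : d.Coord t // φ ∈ d.dual t ∧ ∀ a, d.ev t φ a = 1}
  pull h _ _ e φ := ⟨d.pullCoord h e φ.1, d.pullCoord_mem_dual h e φ.2.1, fun a => by
    rw [ev_pullCoord, φ.2.2, map_one]⟩
  pull_id e p := Subtype.ext (d.pullCoord_id e _)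
  pull_pull h' h t t' t'' e e' e'' p := Subtype.ext (d.pullCoord_pullCoord h' h e e' e'' _)

lemma pb_ext (𝒰 : Scheme.OpenCover.{u} T) {V : T.Opens} {x y : Γ(T, V)}
    (h : ∀ i, pb (𝒰.f i) le_rfl x = pb (𝒰.f i) le_rfl y) : x = y :=
  (existsUnique_pb_eq 𝒰 V (fun i => pb (𝒰.f i) le_rfl y) fun i j => by
    rw [pb_pb _ _ rfl, pb_pb _ _ pullback.condition.symm]).unique h fun _ => rfl

lemma isSheaf_splittings : d.splittings.IsSheaf := by
  intro T t 𝒰 p hp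
  have key : ∃! q : d.Coord t, ∀ j, d.pullCoord (𝒰.f j) rfl q = (p j).1 := by
    have (i : I) (a : A) := existsUnique_pb_eq 𝒰 (t ⁻¹ᵁ d.U a) (fun j => (p j).1 i a) fun j k =>
      congrFun (congrFun (congrArg Subtype.val (hp j k)) i) a
    choose q hq hq' using this
    refine ⟨q, fun j => ?_, fun q' h => ?_⟩
    · funext i a
      exact hq i a j
    · funext i a
      exact hq' i a _ fun j => congrFun (congrFun (h j) i) a
  obtain ⟨q, hq2, hq'⟩ := key
  refine ⟨⟨q, ?_, ?_⟩, ?_, ?_⟩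
  · intro i a b
    apply pb_ext 𝒰
    intro j
    have := (p j).2.1 i a b
    rw [← hq2, pullCoord_apply, pullCoord_apply, rs_pb, rs_pb] at this
    rw [map_mul, pb_rs, pb_rs, pb_pb _ _ rfl]
    exact this
  · intro a
    apply pb_ext 𝒰
    intro j
    have := (p j).2.2 a
    rw [← hq2, ev_pullCoord] at this
    rw [map_one]
    exact this
  · intro j
    exact Subtype.ext (hq2 j)
  · intro q' h
    exact Subtype.ext (hq' _ fun j => congrArg Subtype.val (h j))

lemma ev_ofTriv (t : T ⟶ X) (a : A) (h : ⊤ ≤ t ⁻¹ᵁ d.U a) (x : I → Γ(T, ⊤)) (b : A) :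
    d.ev t (d.ofTriv t a h x) b = rs le_top (∑ i, pb t h (d.s i a) * x i) := by
  rw [ev, map_sum]
  refine Finset.sum_congr rfl fun i _ => ?_
  have hle := preimage_le_preimage_inf h (d.U b)
  have := congr(pb t hle $(d.s_eq i a b))
  rw [map_mul, pb_rs, pb_rs] at this
  rw [map_mul, rs_pb, this, ofTriv]
  ring

end

section

variable [Fintype I] (a : A)

/-- The ring of the affine scheme of dual sections with value `1` over `U a`. -/
abbrev ring : Type u :=
  MvPolynomial I Γ(X, d.U a) ⧸ Ideal.span
    {∑ i, MvPolynomial.C (d.s i a) * MvPolynomial.X i - (1 : MvPolynomial I Γ(X, d.U a))}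

/-- Dual sections with value `1` over `U a` are represented by an affine scheme. -/
lemma exists_isUniversal_splittings : ∃ (W : Scheme.{u}) (w : W ⟶ X) (univ : d.splittings.obj w),
    IsAffine W ∧ d.splittings.IsUniversal (d.U a) w univ := by
  let ε : d.ring a ≃+* Γ(Spec (.of (d.ring a)), ⊤) :=
    (Scheme.ΓSpecIso (.of (d.ring a))).symm.commRingCatIsoToRingEquiv
  -- Only the affineness of `W` and its ring of functions matter from here on.
  obtain ⟨W, hW, ⟨ε⟩⟩ : ∃ W : Scheme.{u}, IsAffine W ∧ Nonempty (d.ring a ≃+* Γ(W, ⊤)) :=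
    ⟨_, inferInstance, ⟨ε⟩⟩
  obtain ⟨w, ⟨hw, hw'⟩, -⟩ := existsUnique_pb (d.isAffineOpen_U a)
    (ε.toRingHom.comp ((Ideal.Quotient.mk _).comp MvPolynomial.C))
  let x (i : I) : Γ(W, ⊤) := ε (Ideal.Quotient.mk _ (MvPolynomial.X i))
  have hx : ∑ i, pb w hw (d.s i a) * x i = 1 := by
    have h1 : (Ideal.Quotient.mk _ : _ →+* d.ring a)
        (∑ i, MvPolynomial.C (d.s i a) * MvPolynomial.X i) = 1 :=
      Ideal.Quotient.eq.mpr (Ideal.subset_span rfl)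
    have h2 := congrArg ε h1
    simpa only [hw', x, map_one, map_sum, map_mul] using! h2
  refine ⟨W, w, ⟨d.ofTriv w a hw x, d.ofTriv_mem_dual _ _ _ _, fun b => ?_⟩, hW,
    top_le_iff.mp hw, ?_⟩
  · rw [ev_ofTriv, hx, map_one]
  · rintro T t ht ⟨φ, hφ, hφ'⟩
    have ht' : ⊤ ≤ t ⁻¹ᵁ d.U a := ht.ge
    have hcoord (h : T ⟶ W) (e : h ≫ w = t) (i : I) :
        rs ht' (d.pullCoord h e (d.ofTriv w a hw x) i a) = pb h h.preimage_top.ge (x i) := by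
      rw [← d.rs_ofTriv w a hw x i, pb_rs, pullCoord_apply, rs_pb]
    -- The variables go to the coordinates of `φ` at a; the defining relation goes to 0 because the
    -- evaluation of `φ` is 1.
    let F : d.ring a →+* Γ(T, ⊤) := Ideal.Quotient.lift _
      (MvPolynomial.eval₂Hom (pb t ht') fun i => rs ht' (φ i a)) (by
        suffices h : Ideal.span _ ≤ RingHom.ker (MvPolynomial.eval₂Hom (pb t ht')
          fun i => rs ht' (φ i a)) from fun r hr => h hr
        rw [Ideal.span_le, Set.singleton_subset_iff]
        have := congr(rs ht' $(hφ' a))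
        simp only [ev, map_sum, map_mul, rs_pb, map_one] at this
        simp [RingHom.mem_ker, this])
    have hFC (r) : F (Ideal.Quotient.mk _ (MvPolynomial.C r)) = pb t ht' r :=
      MvPolynomial.eval₂_C _ _ _
    have hFX (i) : F (Ideal.Quotient.mk _ (MvPolynomial.X i)) = rs ht' (φ i a) :=
      MvPolynomial.eval₂_X _ _ _
    have hFu (f : d.ring a →+* Γ(T, ⊤)) (hC : ∀ r, f (Ideal.Quotient.mk _ (MvPolynomial.C r)) =
        pb t ht' r) (hX : ∀ i, f (Ideal.Quotient.mk _ (MvPolynomial.X i)) = rs ht' (φ i a)) :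
        f = F :=
      Ideal.Quotient.ringHom_ext (MvPolynomial.ringHom_ext
        (fun r => (hC r).trans (hFC r).symm) fun i => (hX i).trans (hFX i).symm)
    clear_value F
    obtain ⟨h, ⟨h1, h2⟩, h3⟩ := existsUnique_pb (isAffineOpen_top W)
      (F.comp ε.symm.toRingHom)
    have e : h ≫ w = t := by
      have hle : ⊤ ≤ (h ≫ w) ⁻¹ᵁ d.U a := by
        rw [Scheme.Hom.comp_preimage, top_le_iff.mp hw, Scheme.Hom.preimage_top]
      refine (existsUnique_pb (d.isAffineOpen_U a) (pb t ht')).unique ⟨hle, ?_⟩ ⟨ht', rfl⟩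
      ext r
      rw [← pb_pb h w rfl hw h.preimage_top.ge, hw', h2, ← hFC]
      exact congrArg F (ε.symm_apply_apply _)
    refine ⟨h, ⟨e, Subtype.ext ?_⟩, ?_⟩
    · refine (d.ofTriv_rs t a ht' (d.pullCoord_mem_dual h e (d.ofTriv_mem_dual w a hw x))).symm.trans
        (Eq.trans ?_ (d.ofTriv_rs t a ht' hφ))
      congr 1
      funext i
      rw [hcoord, h2, ← hFX]
      exact congrArg F (ε.symm_apply_apply _)
    · rintro h' ⟨e', he'⟩
      apply h3
      refine ⟨h'.preimage_top.ge, ?_⟩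
      have : (pb h' h'.preimage_top.ge).comp ε.toRingHom = F := by
        apply hFu
        · intro r
          rw [← pb_pb h' w e' hw h'.preimage_top.ge, hw']
          rfl
        · intro i
          have he2 : d.pullCoord h' e' (d.ofTriv w a hw x) = φ := congrArg Subtype.val he'
          rw [← he2]
          exact (hcoord h' e' i).symm
      rw [← this]
      ext r
      exact congrArg (pb h' _) (ε.apply_symm_apply r).symm

end

end AmpleCocycle
end
end EquivariantJouanolou

/-! ### The torsor of splittings: affine total space, triviality over affine schemes -/

namespace EquivariantJouanolou
noncomputable section

lemma isAffineOpen_preimage_of_isAffineHom_ι {X Y : Scheme.{u}} [IsAffine Y] (y : Y ⟶ X)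
    (U : X.Opens) [IsAffineHom U.ι] : IsAffineOpen (y ⁻¹ᵁ U) := by
  have h : (pullback.fst y U.ι).opensRange = y ⁻¹ᵁ U := by
    ext1
    simpa using IsOpenImmersion.range_pullbackFst U.ι y
  rw [← h]
  exact isAffineOpen_opensRange _

lemma basicOpen_rs {X : Scheme.{u}} {U V : X.Opens} (h : V ≤ U) (x : Γ(X, U)) :
    X.basicOpen (rs h x) = V ⊓ X.basicOpen x := X.basicOpen_res _ _

lemma basicOpen_pb {X T : Scheme.{u}} (t : T ⟶ X) {U : X.Opens} {V : T.Opens} (h : V ≤ t ⁻¹ᵁ U)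
    (x : Γ(X, U)) : T.basicOpen (pb t h x) = V ⊓ t ⁻¹ᵁ X.basicOpen x :=
  Scheme.basicOpen_appLE t V U h x

lemma isUnit_of_le_basicOpen {X : Scheme.{u}} {U : X.Opens} {f : Γ(X, U)}
    (h : U ≤ X.basicOpen f) : IsUnit f := by
  have h1 : IsUnit (rs (X.basicOpen_le f) f) := RingedSpace.isUnit_res_basicOpen _ f
  have h2 := h1.map (rs h)
  rwa [rs_rs, rs_self] at h2

lemma exists_mul_eq_pow {X : Scheme.{u}} {U : X.Opens} (hU : IsAffineOpen U) {f s : Γ(X, U)}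
    (h : X.basicOpen f ≤ X.basicOpen s) : ∃ (N : ℕ) (c : Γ(X, U)), c * s = f ^ N := by
  have := hU.fromSpec.preimage_mono h
  rw [hU.fromSpec_preimage_basicOpen, hU.fromSpec_preimage_basicOpen] at this
  obtain ⟨N, hN⟩ := (PrimeSpectrum.basicOpen_le_basicOpen_iff f s).mp this
  obtain ⟨c, hc⟩ := Ideal.mem_span_singleton'.mp hN
  exact ⟨N, c, hc⟩

namespace AmpleCocycle

variable {X : Scheme.{u}} {A I : Type u}

/-- Over the affine `U a` the inclusion is that of the principal open subset defined by `s i a`. -/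
lemma isAffineHom_ι (d : AmpleCocycle X A I) (i : I) : IsAffineHom (d.D i).ι := by
  apply isAffineHom_of_forall_exists_isAffineOpen
  intro x
  obtain ⟨a, ha⟩ := TopologicalSpace.Opens.mem_iSup.mp (d.iSup_U ▸ TopologicalSpace.Opens.mem_top x)
  refine ⟨d.U a, ha, d.isAffineOpen_U a, ?_⟩
  rw [← (d.D i).ι.isAffineOpen_iff_of_isOpenImmersion, Scheme.Hom.image_preimage_eq_opensRange_inf,
    Scheme.Opens.opensRange_ι, d.D_inf]
  exact (d.isAffineOpen_U a).basicOpen _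

lemma isAffineHom_of_isAffine (d : AmpleCocycle X A I) {Y : Scheme.{u}} [IsAffine Y] (y : Y ⟶ X) : IsAffineHom y := by
  apply isAffineHom_of_forall_exists_isAffineOpen
  intro x
  obtain ⟨i, hi⟩ := TopologicalSpace.Opens.mem_iSup.mp (d.iSup_D ▸ TopologicalSpace.Opens.mem_top x)
  have := d.isAffineHom_ι i
  exact ⟨d.D i, hi, d.isAffineOpen_D i, isAffineOpen_preimage_of_isAffineHom_ι y _⟩

/-- The inclusion of an affine open is an affine morphism, as can be checked over the affine cover
`D`. Hence intersections of two affine opens are affine. -/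
lemma isAffineHom_diagonal (d : AmpleCocycle X A I) : IsAffineHom (pullback.diagonal (terminal.from X)) := by
  rw [isAffineHom_diagonal_iff]
  intro _ _ V _ V' _ hV hV'
  have : IsAffine V.toScheme := hV
  have := d.isAffineHom_of_isAffine V.ι
  have := hV'.preimage V.ι
  rwa [← V.ι.isAffineOpen_iff_of_isOpenImmersion, Scheme.Hom.image_preimage_eq_opensRange_inf,
    Scheme.Opens.opensRange_ι] at this

variable (d : AmpleCocycle X A I) [Fintype I]

/-- Splittings of the evaluation map are represented by an affine morphism. -/
lemma exists_isUniversal_top : ∃ (W : Scheme.{u}) (w : W ⟶ X) (univ : d.splittings.obj w),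
    IsAffineHom w ∧ d.splittings.IsUniversal ⊤ w univ := by
  choose W₀ w₀ univ₀ haff H₀ using d.exists_isUniversal_splittings
  obtain ⟨W, w, univ, H⟩ := d.splittings.exists_isUniversal d.isSheaf_splittings d.U d.iSup_U
    W₀ w₀ univ₀ H₀
  refine ⟨W, w, univ, ?_, H⟩
  apply isAffineHom_of_forall_exists_isAffineOpen
  intro x
  obtain ⟨a, ha⟩ := TopologicalSpace.Opens.mem_iSup.mp (d.iSup_U ▸ TopologicalSpace.Opens.mem_top x)
  refine ⟨d.U a, ha, d.isAffineOpen_U a, ?_⟩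
  -- Both `W₀ a` and the part of `W` over `U a` represent the splittings over `U a`, so they are
  -- isomorphic and the latter is affine.
  obtain ⟨h, ⟨e, he⟩, -⟩ := H.existsUnique (w₀ a) (by simp) (univ₀ a)
  obtain ⟨k, ⟨f, hf⟩, -⟩ := (H₀ a).existsUnique ((w ⁻¹ᵁ d.U a).ι ≫ w) (by simp)
    (d.splittings.pull (w ⁻¹ᵁ d.U a).ι rfl univ)
  have hkh : k ≫ h = (w ⁻¹ᵁ d.U a).ι := by
    refine (H.existsUnique ((w ⁻¹ᵁ d.U a).ι ≫ w) (by simp)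
      (d.splittings.pull (w ⁻¹ᵁ d.U a).ι rfl univ)).unique ⟨by simp [e, f], ?_⟩ ⟨rfl, rfl⟩
    rw [← d.splittings.pull_pull k h e f, he, hf]
  have hr : Set.range h ⊆ Set.range (w ⁻¹ᵁ d.U a).ι := by
    rintro _ ⟨y, rfl⟩
    have : w₀ a y ∈ d.U a := by
      have : y ∈ w₀ a ⁻¹ᵁ d.U a := (H₀ a).preimage_eq ▸ trivial
      exact this
    rw [← e] at this
    simpa using this
  obtain ⟨l, hl⟩ : ∃ l, l ≫ (w ⁻¹ᵁ d.U a).ι = h :=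
    ⟨IsOpenImmersion.lift _ h hr, IsOpenImmersion.lift_fac _ _ _⟩
  have hkl : k ≫ l = 𝟙 _ := by
    rw [← cancel_mono (w ⁻¹ᵁ d.U a).ι, Category.assoc, hl, hkh, Category.id_comp]
  have hlk : l ≫ k = 𝟙 _ := by
    refine ((H₀ a).existsUnique (w₀ a) (H₀ a).preimage_eq (univ₀ a)).unique ⟨?_, ?_⟩ 
      ⟨Category.id_comp _, d.splittings.pull_id _ _⟩
    · rw [Category.assoc, f, ← Category.assoc, hl, e]
    · have e1 : l ≫ (w ⁻¹ᵁ d.U a).ι ≫ w = w₀ a := by rw [← Category.assoc, hl, e]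
      rw [← d.splittings.pull_pull l k f e1, hf]
      rw [d.splittings.pull_pull l _ rfl e1 (by rw [Category.assoc, e1])]
      simp only [hl, he]
  have := haff a
  have : IsIso k := ⟨l, hkl, hlk⟩
  exact IsAffine.of_isIso k

/-- The local functions s_i φ_i glue to functions `f i` on `W`, because the transition functions of
s and φ cancel. They sum to 1, and `f i` can be nonzero only over `D i`, so its locus is a principal
open subset of the affine `w ⁻¹ᵁ d.D i`. -/
lemma isAffine_of_splitting {W : Scheme.{u}} (w : W ⟶ X) [IsAffineHom w] (φ : d.splittings.obj w) :
    IsAffine W := by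
  obtain ⟨φ, hφ, hφ'⟩ := φ
  have hcov : (⊤ : W.Opens) ≤ ⨆ a, w ⁻¹ᵁ d.U a := by
    rw [← Scheme.Hom.preimage_iSup, d.iSup_U, Scheme.Hom.preimage_top]
  have hf (i : I) : ∃ f : Γ(W, ⊤), ∀ a, rs le_top f = pb w le_rfl (d.s i a) * φ i a := by
    refine exists_rs_eq (fun a => w ⁻¹ᵁ d.U a) (fun _ => le_top) hcov _ fun a b => ?_
    change rs (w.preimage_mono (inf_le_left : d.U a ⊓ d.U b ≤ _)) _ =
      rs (w.preimage_mono (inf_le_right : d.U a ⊓ d.U b ≤ _)) _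
    have := congr(pb w le_rfl $(d.s_eq i a b))
    rw [map_mul, pb_rs, pb_rs] at this
    rw [map_mul, map_mul, rs_pb, rs_pb, this, hφ i a b]
    ring
  choose f hf using hf
  have hsum : ∑ i, f i = 1 := by
    apply rs_ext (fun a => w ⁻¹ᵁ d.U a) (fun _ => le_top) hcov
    intro a
    rw [map_sum, map_one, ← hφ' a]
    exact Finset.sum_congr rfl fun i _ => hf i a
  have hle (i : I) : W.basicOpen (f i) ≤ w ⁻¹ᵁ d.D i := by
    intro x hx
    obtain ⟨a, ha⟩ := TopologicalSpace.Opens.mem_iSup.mp (hcov (TopologicalSpace.Opens.mem_top x))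
    have h1 : x ∈ W.basicOpen (rs (le_top : w ⁻¹ᵁ d.U a ≤ ⊤) (f i)) := by
      rw [basicOpen_rs]
      exact ⟨ha, hx⟩
    rw [hf, Scheme.basicOpen_mul, basicOpen_pb] at h1
    have h2 : x ∈ w ⁻¹ᵁ (X.basicOpen (d.s i a)) := h1.1.2
    rw [← d.D_inf] at h2
    exact h2.1
  apply isAffine_of_isAffineOpen_basicOpen (Set.range f)
  · rw [Ideal.eq_top_iff_one, ← hsum]
    exact sum_mem fun i _ => Ideal.subset_span ⟨i, rfl⟩
  · rintro _ ⟨i, rfl⟩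
    have := ((d.isAffineOpen_D i).preimage w).basicOpen (rs le_top (f i))
    rwa [basicOpen_rs, inf_eq_right.mpr (hle i)] at this

/-- Over an affine scheme, the evaluation map is split. -/
lemma nonempty_splittings_of_isAffine [Finite A] {Y : Scheme.{u}} [IsAffine Y] (y : Y ⟶ X) :
    Nonempty (d.splittings.obj y) := by
  have hy := d.isAffineHom_of_isAffine y
  -- `J` is the image of the evaluation map. A maximal ideal above `J` would give a point of `Y`,
  -- which lies over some `D i`; from s_i a function outside that ideal is then found in `J`.
  let J : Ideal Γ(Y, ⊤) :=
    { carrier := {r | ∃ φ ∈ d.dual y, ∀ a, d.ev y φ a = rs le_top r}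
      zero_mem' := ⟨0, zero_mem _, fun a => by simp [ev]⟩
      add_mem' := by
        rintro r r' ⟨φ, hφ, h⟩ ⟨φ', hφ', h'⟩
        exact ⟨φ + φ', add_mem hφ hφ', fun a => by rw [ev_add, h, h', map_add]⟩
      smul_mem' := by
        rintro c r ⟨φ, hφ, h⟩
        exact ⟨c • φ, Submodule.smul_mem _ _ hφ, fun a => by
          rw [ev_smul, h, smul_eq_mul, map_mul]⟩ }
  suffices hJ : J = ⊤ by
    obtain ⟨φ, hφ, h⟩ : (1 : Γ(Y, ⊤)) ∈ J := hJ ▸ Submodule.mem_top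
    exact ⟨φ, hφ, fun a => by rw [h, map_one]⟩
  by_contra hJ
  obtain ⟨m, hm, hJm⟩ := Ideal.exists_le_maximal J hJ
  let x₀ : Spec Γ(Y, ⊤) := ⟨m, hm.isPrime⟩
  let x : Y := (isAffineOpen_top Y).fromSpec x₀
  have hx (f : Γ(Y, ⊤)) (hf : x ∈ Y.basicOpen f) : f ∉ m := by
    have : x₀ ∈ (isAffineOpen_top Y).fromSpec ⁻¹ᵁ Y.basicOpen f := hf
    rw [(isAffineOpen_top Y).fromSpec_preimage_basicOpen] at this
    exact this
  obtain ⟨i, hi⟩ := TopologicalSpace.Opens.mem_iSup.mp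
    (d.iSup_D ▸ TopologicalSpace.Opens.mem_top (y x))
  obtain ⟨f, hfx, hf⟩ := (isAffineOpen_top Y).exists_basicOpen_le ⟨x, show x ∈ y ⁻¹ᵁ d.D i from hi⟩
    (TopologicalSpace.Opens.mem_top _)
  have key (a : A) : ∃ (N : ℕ) (c : Γ(Y, y ⁻¹ᵁ d.U a)),
      c * pb y le_rfl (d.s i a) = rs le_top f ^ N := by
    apply exists_mul_eq_pow ((d.isAffineOpen_U a).preimage y)
    rw [basicOpen_rs, basicOpen_pb, ← d.D_inf]
    exact fun z hz => ⟨hz.1, hfx hz.2, hz.1⟩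
  choose N c hc using key
  obtain ⟨M, hM⟩ : ∃ M, ∀ a, N a ≤ M := by
    obtain ⟨M, hM⟩ := (Set.finite_range N).bddAbove
    exact ⟨M, fun a => hM ⟨a, rfl⟩⟩
  let c' (a : A) : Γ(Y, y ⁻¹ᵁ d.U a) := c a * rs le_top f ^ (M - N a)
  have hc' (a : A) : c' a * pb y le_rfl (d.s i a) = rs le_top f ^ M := by
    rw [← Nat.sub_add_cancel (hM a), pow_add, ← hc]
    ring
  clear_value c'
  classical
  -- This is f^(2M) / s_i. The quotients c' = f^M / s_i are chosen separately on each `U a`, and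
  -- only up to elements killed by s_i, so they need not satisfy the transition rule; the extra
  -- factor c' * s_i = f^M corrects this.
  let φ : d.Coord y := fun j a => if h : j = i then c' a ^ 2 * pb y le_rfl (d.s i a) else 0
  have hφ : φ ∈ d.dual y := by
    intro j a b
    by_cases h : j = i
    · subst h
      have h1 := congr(rs (y.preimage_mono (inf_le_left : d.U a ⊓ d.U b ≤ _)) $(hc' a))
      have h2 := congr(rs (y.preimage_mono (inf_le_right : d.U a ⊓ d.U b ≤ _)) $(hc' b))
      have h3 := congr(pb y le_rfl $(d.s_eq j a b))
      simp only [map_mul, map_pow, rs_rs, pb_rs] at h1 h2 h3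
      rw [rs_pb] at h1 h2
      simp only [φ, dite_true, map_mul, map_pow]
      rw [rs_pb, rs_pb]
      generalize rs _ (c' a) = ca at *
      generalize rs _ (c' b) = cb at *
      generalize rs _ f = F at *
      generalize pb y _ (d.g j a b) = g at *
      generalize pb y _ (d.s j a) = sa at *
      generalize pb y _ (d.s j b) = sb at *
      have h4 : ca * sa = cb * sb := h1.trans h2.symm
      linear_combination cb * (-h4) + ca * cb * h3 + ca * g * (-h4)
    · simp [φ, h]
  refine hx _ hf (hm.isPrime.mem_of_pow_mem (M + M) (hJm ⟨φ, hφ, fun a => ?_⟩))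
  rw [ev, Finset.sum_eq_single i]
  · simp only [φ, dite_true, pow_add, map_mul, map_pow, ← hc' a]
    ring
  · intro j _ hj
    simp [φ, hj]
  · simp

/-- The kernel of the evaluation map. -/
def kernel {T : Scheme.{u}} (t : T ⟶ X) : Submodule Γ(T, ⊤) (d.Coord t) where
  carrier := {φ | φ ∈ d.dual t ∧ ∀ a, d.ev t φ a = 0}
  zero_mem' := ⟨zero_mem _, fun a => by simp [ev]⟩
  add_mem' := fun h h' => ⟨add_mem h.1 h'.1, fun a => by rw [ev_add, h.2, h'.2, add_zero]⟩
  smul_mem' := fun r φ h => ⟨Submodule.smul_mem _ _ h.1, fun a => by rw [ev_smul, h.2, mul_zero]⟩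

/-- Pullback of elements of the kernel of the evaluation map. -/
def pullKernel {T T' : Scheme.{u}} (h : T' ⟶ T) {t : T ⟶ X} {t' : T' ⟶ X} (e : h ≫ t = t') :
    d.kernel t →+ d.kernel t' where
  toFun φ := ⟨d.pullCoord h e φ.1, d.pullCoord_mem_dual h e φ.2.1, fun a => by
    rw [ev_pullCoord, φ.2.2, map_zero]⟩
  map_zero' := Subtype.ext (map_zero _)
  map_add' φ ψ := Subtype.ext (map_add _ _ _)

lemma pullKernel_smul {T T' : Scheme.{u}} (h : T' ⟶ T) {t : T ⟶ X} {t' : T' ⟶ X} (e : h ≫ t = t')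
    (r : Γ(T, ⊤)) (φ : d.kernel t) : d.pullKernel h e (r • φ) = h.appTop r • d.pullKernel h e φ :=
  Subtype.ext (d.pullCoord_smul h e r φ.1)

lemma ev_sub {T : Scheme.{u}} (t : T ⟶ X) (φ ψ : d.Coord t) (a : A) :
    d.ev t (φ - ψ) a = d.ev t φ a - d.ev t ψ a := by
  simp [ev, mul_sub, Finset.sum_sub_distrib]

/-- A splitting of the evaluation map identifies the splittings with the kernel. -/
def splittingsEquiv {T : Scheme.{u}} {t : T ⟶ X} (ψ : d.splittings.obj t) :
    d.splittings.obj t ≃ d.kernel t where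
  toFun φ := ⟨φ.1 - ψ.1, sub_mem φ.2.1 ψ.2.1, fun a => by rw [ev_sub, φ.2.2, ψ.2.2, sub_self]⟩
  invFun φ := ⟨φ.1 + ψ.1, add_mem φ.2.1 ψ.2.1, fun a => by rw [ev_add, φ.2.2, ψ.2.2, zero_add]⟩
  left_inv φ := Subtype.ext (sub_add_cancel _ _)
  right_inv φ := Subtype.ext (add_sub_cancel_right _ _)

lemma pullKernel_splittingsEquiv {T T' : Scheme.{u}} (h : T' ⟶ T) {t : T ⟶ X} {t' : T' ⟶ X}
    (e : h ≫ t = t') (ψ φ : d.splittings.obj t) :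
    d.pullKernel h e (d.splittingsEquiv ψ φ) =
      d.splittingsEquiv (d.splittings.pull h e ψ) (d.splittings.pull h e φ) :=
  Subtype.ext (map_sub _ _ _)

omit [Fintype I] in
lemma pullCoord_ofTriv {T T' : Scheme.{u}} (h : T' ⟶ T) {t : T ⟶ X} {t' : T' ⟶ X}
    (e : h ≫ t = t') (a : A) (ht : ⊤ ≤ t ⁻¹ᵁ d.U a) (ht' : ⊤ ≤ t' ⁻¹ᵁ d.U a) (x : I → Γ(T, ⊤)) :
    d.pullCoord h e (d.ofTriv t a ht x) =
      d.ofTriv t' a ht' (fun i => pb h h.preimage_top.ge (x i)) := by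
  funext i b
  rw [pullCoord_apply, ofTriv, ofTriv, map_mul, pb_pb h t e, pb_rs, rs_pb]

lemma mem_kernel_ofTriv {T : Scheme.{u}} {t : T ⟶ X} {a : A} (ht : ⊤ ≤ t ⁻¹ᵁ d.U a)
    {x : I → Γ(T, ⊤)} (hx : ∑ i, pb t ht (d.s i a) * x i = 0) : d.ofTriv t a ht x ∈ d.kernel t :=
  ⟨d.ofTriv_mem_dual _ _ _ _, fun b => by rw [ev_ofTriv, hx, map_zero]⟩

/-- Where one of the sections does not vanish, the kernel of the evaluation map is free. -/
lemma exists_basis_kernel [DecidableEq I] {T : Scheme.{u}} (t : T ⟶ X) (i : I) (a : A)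
    (ht : ⊤ ≤ t ⁻¹ᵁ (d.D i ⊓ d.U a)) : ∃ e : {j // j ≠ i} → d.kernel t,
      ∀ {T' : Scheme.{u}} (h : T' ⟶ T) (t' : T' ⟶ X) (e' : h ≫ t = t'),
        Function.Bijective fun c : {j // j ≠ i} → Γ(T', ⊤) => ∑ j, c j • d.pullKernel h e' (e j) := by
  have hta : ⊤ ≤ t ⁻¹ᵁ d.U a := ht.trans (t.preimage_mono inf_le_right)
  have hunit : IsUnit (pb t hta (d.s i a)) := by
    apply isUnit_of_le_basicOpen
    rw [basicOpen_pb, ← d.D_inf]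
    exact le_inf le_rfl ht
  obtain ⟨u, hu⟩ := hunit.exists_left_inv
  -- With s_i invertible, the kernel has the basis e_j - (s_j / s_i) e_i for j ≠ i; an element is
  -- recovered from its coordinates other than the i-th.
  let x (j : {j // j ≠ i}) (k : I) : Γ(T, ⊤) :=
    if k = j then 1 else if k = i then - (u * pb t hta (d.s j a)) else 0
  have hx (j : {j // j ≠ i}) : ∑ k, pb t hta (d.s k a) * x j k = 0 := by
    rw [← Finset.add_sum_erase _ _ (Finset.mem_univ i),
      ← Finset.add_sum_erase _ _ (Finset.mem_erase.mpr ⟨j.2, Finset.mem_univ j.1⟩),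
      Finset.sum_eq_zero]
    · simp only [x, j.2.symm, if_true, if_false]
      linear_combination - pb t hta (d.s j a) * hu
    · intro k hk
      simp only [Finset.mem_erase] at hk
      simp [x, hk.1, hk.2.1]
  refine ⟨fun j => ⟨d.ofTriv t a hta (x j), d.mem_kernel_ofTriv hta (hx j)⟩, ?_⟩
  intro T' h t' e'
  have hta' : ⊤ ≤ t' ⁻¹ᵁ d.U a := by
    rw [← e', Scheme.Hom.comp_preimage, top_le_iff.mp hta, Scheme.Hom.preimage_top]
  have hcoord (c : {j // j ≠ i} → Γ(T', ⊤)) (k : I) :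
      rs hta' ((∑ j, c j • d.pullKernel h e' ⟨d.ofTriv t a hta (x j),
        d.mem_kernel_ofTriv hta (hx j)⟩ : d.kernel t').1 k a) =
      ∑ j, c j * pb h h.preimage_top.ge (x j k) := by
    simp only [AddSubmonoidClass.coe_finsetSum, Finset.sum_apply, map_sum]
    refine Finset.sum_congr rfl fun j _ => ?_
    change rs hta' ((c j • d.pullCoord h e' _) k a) = _
    rw [d.pullCoord_ofTriv h e' a hta hta', Coord.smul_apply, map_mul, rs_ofTriv, rs_rs, rs_self]
  have hcoord' (c : {j // j ≠ i} → Γ(T', ⊤)) (k : {j // j ≠ i}) :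
      rs hta' ((∑ j, c j • d.pullKernel h e' ⟨d.ofTriv t a hta (x j),
        d.mem_kernel_ofTriv hta (hx j)⟩ : d.kernel t').1 k.1 a) = c k := by
    rw [hcoord, Finset.sum_eq_single k]
    · simp [x]
    · intro j _ hj
      have : k.1 ≠ j.1 := fun h => hj (Subtype.ext h).symm
      simp [x, k.2, this]
    · simp
  constructor
  · intro c c' hcc'
    funext k
    rw [← hcoord' c k, ← hcoord' c' k]
    simp only at hcc'
    rw [hcc']
  · intro φ
    refine ⟨fun j => rs hta' (φ.1 j.1 a), ?_⟩
    simp only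
    have hc := hcoord' fun j => rs hta' (φ.1 j.1 a)
    generalize (∑ j, rs hta' (φ.1 j.1 a) • d.pullKernel h e' ⟨d.ofTriv t a hta (x j),
        d.mem_kernel_ofTriv hta (hx j)⟩ : d.kernel t') = ψ at hc ⊢
    apply Subtype.ext
    rw [← d.ofTriv_rs t' a hta' φ.2.1, ← d.ofTriv_rs t' a hta' ψ.2.1]
    congr 1
    funext k
    by_cases hk : k = i
    · subst hk
      have h1 := congr(rs hta' $(φ.2.2 a))
      have h2 := congr(rs hta' $(ψ.2.2 a))
      have h3 := congr(pb h h.preimage_top.ge $hu)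
      rw [map_mul, pb_pb h t e'] at h3
      simp only [ev, map_sum, map_mul, rs_pb, map_zero] at h1 h2
      rw [← Finset.add_sum_erase _ _ (Finset.mem_univ k)] at h1 h2
      have h5 : ∑ j ∈ Finset.univ.erase k, pb t' hta' (d.s j a) * rs hta' (ψ.1 j a) =
          ∑ j ∈ Finset.univ.erase k, pb t' hta' (d.s j a) * rs hta' (φ.1 j a) :=
        Finset.sum_congr rfl fun j hj =>
          congrArg (pb t' hta' (d.s j a) * ·) (hc ⟨j, Finset.ne_of_mem_erase hj⟩)
      rw [h5] at h2
      rw [map_one] at h3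
      have h4 := h2.trans h1.symm
      rw [add_left_inj] at h4
      linear_combination (rs hta' (φ.1 k a) - rs hta' (ψ.1 k a)) * h3 +
        pb h h.preimage_top.ge u * h4
    · exact hc ⟨k, hk⟩

end AmpleCocycle

/-- A vector bundle structure obtained from an identification of the functor of points with a
functor with values in modules. -/
def VectorBundleStructure.ofEquiv {E U : Scheme.{u}} (π : E ⟶ U)
    (N : ∀ {T : Scheme.{u}} (_ : T ⟶ U), Type*)
    [∀ {T : Scheme.{u}} (t : T ⟶ U), AddCommGroup (N t)]
    [∀ {T : Scheme.{u}} (t : T ⟶ U), Module Γ(T, ⊤) (N t)]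
    (pull : ∀ {T T' : Scheme.{u}} (h : T' ⟶ T) (t : T ⟶ U), N t → N (h ≫ t))
    (pull_add : ∀ {T T' : Scheme.{u}} (h : T' ⟶ T) (t : T ⟶ U) (s s' : N t),
      pull h t (s + s') = pull h t s + pull h t s')
    (pull_smul : ∀ {T T' : Scheme.{u}} (h : T' ⟶ T) (t : T ⟶ U) (a : Γ(T, ⊤)) (s : N t),
      pull h t (a • s) = (h.appTop a) • pull h t s)
    (Φ : ∀ {T : Scheme.{u}} (t : T ⟶ U), Points π t ≃ N t)
    (hΦ : ∀ {T T' : Scheme.{u}} (h : T' ⟶ T) (t : T ⟶ U) (s : Points π t),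
      Φ (h ≫ t) (s.pull h) = pull h t (Φ t s))
    (loc : ∀ x : U, ∃ V : U.Opens, x ∈ V ∧ ∃ (n : ℕ) (e : Fin n → N V.ι),
      ∀ {T : Scheme.{u}} (t : T ⟶ V),
        Function.Bijective fun c : Fin n → Γ(T, ⊤) => ∑ j, c j • pull t V.ι (e j)) :
    VectorBundleStructure π where
  addCommGroup t := (Φ t).addCommGroup
  module t := letI := (Φ t).addCommGroup; (Φ t).module _
  pull_add h t s s' := by
    let _ := (Φ t).addCommGroup
    let _ := (Φ (h ≫ t)).addCommGroup
    apply (Φ (h ≫ t)).injective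
    have h1 : Φ t (s + s') = Φ t s + Φ t s' := map_add (Φ t).addEquiv s s'
    have h2 := map_add (Φ (h ≫ t)).addEquiv (s.pull h) (s'.pull h)
    rw [hΦ, h1, pull_add]
    refine Eq.trans ?_ h2.symm
    rw [← hΦ, ← hΦ]
    rfl
  pull_smul {T T'} h t a s := by
    let _ := (Φ t).addCommGroup
    let _ := (Φ (h ≫ t)).addCommGroup
    let _ := (Φ t).module Γ(T, ⊤)
    let _ := (Φ (h ≫ t)).module Γ(T', ⊤)
    apply (Φ (h ≫ t)).injective
    have h1 : Φ t (a • s) = a • Φ t s := ((Φ t).linearEquiv Γ(T, ⊤)).map_smul a s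
    have h2 := ((Φ (h ≫ t)).linearEquiv Γ(T', ⊤)).map_smul (h.appTop a) (s.pull h)
    rw [hΦ, h1, pull_smul, ← hΦ]
    exact h2.symm
  locally_trivial x := by
    obtain ⟨V, hxV, n, e, he⟩ := loc x
    refine ⟨V, hxV, n, fun j => (Φ V.ι).symm (e j), fun {T} t => ?_⟩
    let _ := (Φ (t ≫ V.ι)).addCommGroup
    let _ := (Φ (t ≫ V.ι)).module Γ(T, ⊤)
    rw [← Function.Bijective.of_comp_iff' (Φ (t ≫ V.ι)).bijective]
    convert! he t using 1
    funext c
    change ((Φ (t ≫ V.ι)).linearEquiv Γ(T, ⊤)) _ = _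
    rw [map_sum]
    refine Finset.sum_congr rfl fun j _ => ?_
    rw [map_smul]
    congr 1
    refine (hΦ _ _ _).trans ?_
    rw [Equiv.apply_symm_apply]

/-- Points of the base change over `t` are splittings over `t ≫ y`. Subtracting the pullback of one
splitting `ψ` over the affine `Y` turns them into elements of the kernel, a functor in modules which
is locally free by `exists_basis_kernel`. -/
lemma AmpleCocycle.nonempty_vectorBundleStructure {X : Scheme.{u}} {A I : Type u}
    (d : AmpleCocycle X A I) [Fintype I] [Finite A] {W : Scheme.{u}} {w : W ⟶ X}
    {univ : d.splittings.obj w} (H : d.splittings.IsUniversal ⊤ w univ) {Y : Scheme.{u}} [IsAffine Y]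
    (y : Y ⟶ X) : Nonempty (VectorBundleStructure (pullback.snd w y)) := by
  classical
  obtain ⟨ψ⟩ := d.nonempty_splittings_of_isAffine y
  let Ψ {T : Scheme.{u}} (t : T ⟶ Y) : Points (pullback.snd w y) t → d.splittings.obj (t ≫ y) :=
    fun s => d.splittings.pull (s.1 ≫ pullback.fst w y) (by
      rw [Category.assoc, pullback.condition, ← Category.assoc, s.2]) univ
  have hΨ {T : Scheme.{u}} (t : T ⟶ Y) : Function.Bijective (Ψ t) := by
    constructor
    · intro s s' hs
      apply Subtype.ext
      apply pullback.hom_ext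
      · exact (H.existsUnique (t ≫ y) (by simp) (Ψ t s')).unique ⟨_, hs⟩ ⟨_, rfl⟩
      · exact s.2.trans s'.2.symm
    · intro p
      obtain ⟨h, ⟨e, he⟩, -⟩ := H.existsUnique (t ≫ y) (by simp) p
      refine ⟨⟨pullback.lift h t e, pullback.lift_snd _ _ _⟩, ?_⟩
      simp only [Ψ, pullback.lift_fst, he]
  let Φ {T : Scheme.{u}} (t : T ⟶ Y) : Points (pullback.snd w y) t ≃ d.kernel (t ≫ y) :=
    (Equiv.ofBijective _ (hΨ t)).trans (d.splittingsEquiv (d.splittings.pull t rfl ψ))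
  refine ⟨VectorBundleStructure.ofEquiv (pullback.snd w y) (fun t => d.kernel (t ≫ y))
    (fun h t => d.pullKernel h (Category.assoc h t y).symm) (fun h t s s' => map_add _ _ _)
    (fun h t a s => d.pullKernel_smul _ _ _ _) Φ ?_ ?_⟩
  · intro T T' h t s
    change d.splittingsEquiv _ (Ψ _ _) = d.pullKernel _ _ (d.splittingsEquiv _ (Ψ _ _))
    rw [pullKernel_splittingsEquiv]
    congr 1
    · rw [d.splittings.pull_pull]
    · simp only [Ψ]
      rw [d.splittings.pull_pull]
      · simp only [Points.pull, Category.assoc]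
      · simp only [Category.assoc, pullback.condition, reassoc_of% s.2]
  · intro x
    obtain ⟨i, hi⟩ := TopologicalSpace.Opens.mem_iSup.mp
      (d.iSup_D ▸ TopologicalSpace.Opens.mem_top (y x))
    obtain ⟨a, ha⟩ := TopologicalSpace.Opens.mem_iSup.mp
      (d.iSup_U ▸ TopologicalSpace.Opens.mem_top (y x))
    obtain ⟨e, he⟩ := d.exists_basis_kernel ((y ⁻¹ᵁ (d.D i ⊓ d.U a)).ι ≫ y) i a (by simp)
    refine ⟨y ⁻¹ᵁ (d.D i ⊓ d.U a), ⟨hi, ha⟩, Fintype.card {j // j ≠ i},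
      fun j => e ((Fintype.equivFin _).symm j), fun {T} t => ?_⟩
    rw [← Function.Bijective.of_comp_iff _
      ((Fintype.equivFin {j // j ≠ i}).symm.arrowCongr (Equiv.refl Γ(T, ⊤))).symm.bijective]
    convert! he t _ (Category.assoc _ _ _).symm using 1
    funext c
    refine Fintype.sum_equiv (Fintype.equivFin {j // j ≠ i}).symm _ _ fun j => ?_
    simp [Equiv.arrowCongr]

end
end EquivariantJouanolou

/-! ### Coinduction of affine morphisms and of vector bundles -/

namespace EquivariantJouanolou
noncomputable section

/-- The fibre product of the base changes of an affine morphism along a finite family of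
morphisms. -/
lemma exists_fiberProduct (J : Type v) [Finite J] {W B X : Scheme.{u}} (w : W ⟶ B) [IsAffineHom w] :
    ∀ r : J → (X ⟶ B), ∃ (P : Scheme.{u}) (p : P ⟶ X) (q : J → (P ⟶ W)), IsAffineHom p ∧
      (∀ j, q j ≫ w = p ≫ r j) ∧ ∀ {T : Scheme.{u}} (t : T ⟶ X) (f : J → (T ⟶ W)),
        (∀ j, f j ≫ w = t ≫ r j) → ∃! h : T ⟶ P, h ≫ p = t ∧ ∀ j, h ≫ q j = f j := by
  induction J using Finite.induction_empty_option with
  | of_equiv e ih =>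
    intro r
    obtain ⟨P, p, q, hp, hq, H⟩ := ih (r ∘ e)
    refine ⟨P, p, q ∘ e.symm, hp, fun j => by simp [hq], fun t f hf => ?_⟩
    obtain ⟨h, ⟨h1, h2⟩, h3⟩ := H t (f ∘ e) fun j => hf _
    exact ⟨h, ⟨h1, fun j => by simp [h2]⟩, fun k hk => h3 k ⟨hk.1, fun j => by simp [← hk.2]⟩⟩
  | h_empty =>
    intro r
    exact ⟨X, 𝟙 X, PEmpty.rec, inferInstance, fun j => j.elim, fun t f hf =>
      ⟨t, ⟨Category.comp_id _, fun j => j.elim⟩, fun h hh => by simpa using hh.1⟩⟩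
  | h_option ih =>
    intro r
    obtain ⟨P, p, q, hp, hq, H⟩ := ih (r ∘ some)
    have : IsAffineHom (pullback.snd w (p ≫ r none)) := 
      MorphismProperty.of_isPullback (P := @IsAffineHom) (IsPullback.of_hasPullback _ _) ‹_›
    refine ⟨pullback w (p ≫ r none), pullback.snd _ _ ≫ p,
      fun j => j.elim (pullback.fst _ _) (fun j => pullback.snd _ _ ≫ q j), inferInstance, ?_, ?_⟩
    · rintro (_ | j)
      · simpa using! pullback.condition
      · simp [hq]
    · intro T t f hf
      obtain ⟨h, ⟨h1, h2⟩, h3⟩ := H t (f ∘ some) fun j => hf _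
      have e : f none ≫ w = h ≫ p ≫ r none := by rw [hf, reassoc_of% h1]
      refine ⟨pullback.lift (f none) h e, ⟨?_, ?_⟩, ?_⟩
      · rw [pullback.lift_snd_assoc, h1]
      · rintro (_ | j)
        · exact pullback.lift_fst _ _ _
        · exact (pullback.lift_snd_assoc _ _ _ _).trans (h2 j)
      · rintro k ⟨k1, k2⟩
        apply pullback.hom_ext
        · rw [pullback.lift_fst]
          exact k2 none
        · rw [pullback.lift_snd]
          exact h3 _ ⟨by simpa using k1, fun j => by simpa using k2 (some j)⟩

/-- Points over equal morphisms. -/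
def Points.cast {E U T : Scheme.{u}} {π : E ⟶ U} {t t' : T ⟶ U} (e : t = t') (s : Points π t) :
    Points π t' := ⟨s.1, s.2.trans e⟩

namespace VectorBundleStructure

section

variable {E U T : Scheme.{u}} {π : E ⟶ U} (β : VectorBundleStructure π) {t t' : T ⟶ U} (e : t = t')

lemma cast_add (s s' : Points π t) :
    letI := fun {T : Scheme.{u}} (t : T ⟶ U) => β.addCommGroup t
    (s + s').cast e = s.cast e + s'.cast e := by
  subst e; rfl

lemma cast_sum {ι : Type*} (S : Finset ι) (s : ι → Points π t) :
    letI := fun {T : Scheme.{u}} (t : T ⟶ U) => β.addCommGroup t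
    (∑ i ∈ S, s i).cast e = ∑ i ∈ S, (s i).cast e := by
  subst e; rfl

lemma pull_zero {T' : Scheme.{u}} (h : T' ⟶ T) :
    letI := fun {T : Scheme.{u}} (t : T ⟶ U) => β.addCommGroup t
    (0 : Points π t).pull h = 0 := by
  let _ := fun {T : Scheme.{u}} (t : T ⟶ U) => β.addCommGroup t
  have := β.pull_add h t 0 0
  rw [add_zero] at this
  exact left_eq_add.mp this

lemma cast_zero :
    letI := fun {T : Scheme.{u}} (t : T ⟶ U) => β.addCommGroup t
    (0 : Points π t).cast e = 0 := by
  subst e; rfl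

lemma cast_smul (a : Γ(T, ⊤)) (s : Points π t) :
    letI := fun {T : Scheme.{u}} (t : T ⟶ U) => β.addCommGroup t
    letI := fun {T : Scheme.{u}} (t : T ⟶ U) => β.module t
    (a • s).cast e = a • s.cast e := by
  subst e; rfl

end

section Pi

variable {J : Type v} {E U : Scheme.{u}} (π : E ⟶ U) {E' U' : J → Scheme.{u}}
  (π' : ∀ j, E' j ⟶ U' j) (y : ∀ j, U ⟶ U' j)

/-- The functor of points of a fibre product of pullbacks of vector bundles. -/
def PiPoints {T : Scheme.{u}} (t : T ⟶ U) : Type max u v := ∀ j, Points (π' j) (t ≫ y j)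

variable {π'} (β : ∀ j, VectorBundleStructure (π' j)) {y}

/-- The additive structure on the points of a fibre product. -/
@[reducible]
def piAddCommGroup {T : Scheme.{u}} (t : T ⟶ U) : AddCommGroup (PiPoints π' y t) :=
  letI := fun (j : J) {T : Scheme.{u}} (t : T ⟶ U' j) => (β j).addCommGroup t
  Pi.addCommGroup

/-- The module structure on the points of a fibre product. -/
@[reducible]
def piModule {T : Scheme.{u}} (t : T ⟶ U) :
    letI := piAddCommGroup (y := y) β t
    Module Γ(T, ⊤) (PiPoints π' y t) :=
  letI := fun (j : J) {T : Scheme.{u}} (t : T ⟶ U' j) => (β j).addCommGroup t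
  letI := fun (j : J) {T : Scheme.{u}} (t : T ⟶ U' j) => (β j).module t
  Pi.module _ _ _

/-- A fibre product of pullbacks of vector bundles is a vector bundle. -/
def pi [Finite J] (Φ : ∀ {T : Scheme.{u}} (t : T ⟶ U), Points π t ≃ PiPoints π' y t)
    (hΦ : ∀ {T T' : Scheme.{u}} (h : T' ⟶ T) (t : T ⟶ U) (s : Points π t) (j : J),
      Φ (h ≫ t) (s.pull h) j = ((Φ t s j).pull h).cast (Category.assoc _ _ _).symm) :
    VectorBundleStructure π :=
  letI := fun (j : J) {T : Scheme.{u}} (t : T ⟶ U' j) => (β j).addCommGroup t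
  letI := fun (j : J) {T : Scheme.{u}} (t : T ⟶ U' j) => (β j).module t
  letI := fun {T : Scheme.{u}} (t : T ⟶ U) => piAddCommGroup (y := y) β t
  letI := fun {T : Scheme.{u}} (t : T ⟶ U) => piModule (y := y) β t
  ofEquiv π (fun t => PiPoints π' y t)
    (fun h t s j => ((s j).pull h).cast (Category.assoc _ _ _).symm)
    (fun h t s s' => by
      funext j
      refine (congrArg _ ((β j).pull_add h _ (s j) (s' j))).trans ?_
      exact (β j).cast_add _ _ _)
    (fun h t a s => by
      funext j
      refine (congrArg _ ((β j).pull_smul h _ a (s j))).trans ?_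
      exact (β j).cast_smul _ _ _)
    Φ (fun h t s => funext (hΦ h t s)) (by
      intro x
      choose V hxV n e he using fun j => (β j).locally_trivial (y j x)
      let V' : U.Opens := ⟨⋂ j, y j ⁻¹ᵁ V j, isOpen_iInter_of_finite fun j => (y j ⁻¹ᵁ V j).2⟩
      have hV' (j : J) : V' ≤ y j ⁻¹ᵁ V j := fun z hz => Set.mem_iInter.mp hz j
      let r (j : J) : (V' : Scheme.{u}) ⟶ V j := IsOpenImmersion.lift (V j).ι (V'.ι ≫ y j) (by
        rintro _ ⟨z, rfl⟩
        simpa using! hV' j z.2)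
      have hr (j : J) : r j ≫ (V j).ι = V'.ι ≫ y j := IsOpenImmersion.lift_fac _ _ _
      classical
      -- A basis of the product: the local bases of all factors, each vector extended by zero in the
      -- other factors.
      let e' (k : Σ j, Fin (n j)) : PiPoints π' y V'.ι := Pi.single k.1 (((e k.1 k.2).pull (r k.1)).cast (hr _))
      refine ⟨V', Set.mem_iInter.mpr hxV, Nat.card (Σ j, Fin (n j)), e' ∘ (Finite.equivFin _).symm, ?_⟩
      intro T t
      have hcast {j : J} {s s' : T ⟶ U' j} (e : s = s') :
          Function.Bijective (Points.cast (π := π' j) e) := by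
        subst e; exact Function.bijective_id
      have e₁ (j : J) : (t ≫ r j) ≫ (V j).ι = (t ≫ V'.ι) ≫ y j := by
        rw [Category.assoc, Category.assoc, hr]
      have hbij := Function.Bijective.piMap fun j => (hcast (e₁ j)).comp (he j (t ≫ r j))
      let ε := (Finite.equivFin (Σ j, Fin (n j))).symm
      let R : (Fin (Nat.card (Σ j, Fin (n j))) → Γ(T, ⊤)) ≃ (∀ j, Fin (n j) → Γ(T, ⊤)) :=
        (ε.arrowCongr (Equiv.refl _)).trans (Equiv.piCurry fun _ _ => Γ(T, ⊤))
      have hR (c) (i) : R c (ε i).1 (ε i).2 = c i := congrArg c (ε.symm_apply_apply i)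
      convert! hbij.comp R.bijective using 1
      funext c j
      simp only [Function.comp_apply, Pi.map_apply]
      rw [(β j).cast_sum]
      simp only [fun a s => (β j).cast_smul (e₁ j) a s]
      refine (Finset.sum_apply j Finset.univ _).trans ?_
      have : Fintype J := Fintype.ofFinite J
      refine (Fintype.sum_equiv ε _ (fun k => R c k.1 k.2 • Points.cast (Category.assoc _ _ _).symm
        ((e' k j).pull t)) fun i => by rw [hR]; rfl).trans ?_
      rw [Fintype.sum_sigma, Finset.sum_eq_single j]
      · refine Finset.sum_congr rfl fun l _ => ?_
        simp only [e', Pi.single_eq_same]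
        rfl
      · intro j' _ hj
        refine Finset.sum_eq_zero fun l _ => ?_
        have : e' ⟨j', l⟩ j = 0 := Pi.single_eq_of_ne hj.symm _
        rw [this, (β j).pull_zero, (β j).cast_zero, smul_zero]
      · simp)

section

variable [Finite J] (Φ : ∀ {T : Scheme.{u}} (t : T ⟶ U), Points π t ≃ PiPoints π' y t)
    (hΦ : ∀ {T T' : Scheme.{u}} (h : T' ⟶ T) (t : T ⟶ U) (s : Points π t) (j : J),
      Φ (h ≫ t) (s.pull h) j = ((Φ t s j).pull h).cast (Category.assoc _ _ _).symm)
    {T : Scheme.{u}} (t : T ⟶ U)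

lemma pi_add_apply (s s' : Points π t) (j : J) :
    Φ t ((pi π β Φ hΦ).addCommGroup t |>.toAdd.add s s') j =
      ((β j).addCommGroup _).toAdd.add (Φ t s j) (Φ t s' j) :=
  congrFun ((Φ t).apply_symm_apply _) j

lemma pi_smul_apply (a : Γ(T, ⊤)) (s : Points π t) (j : J) :
    letI := (pi π β Φ hΦ).addCommGroup t
    letI := (pi π β Φ hΦ).module t
    letI := (β j).addCommGroup (t ≫ y j)
    letI := (β j).module (t ≫ y j)
    Φ t (a • s) j = a • Φ t s j :=
  congrFun ((Φ t).apply_symm_apply _) j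

end

end Pi

end VectorBundleStructure

variable {G : Type v} [Group G] [Finite G]

/-- Coinduction of an affine morphism `w : W ⟶ X`: there is an equivariant morphism `W' ⟶ X` such
that lifts of `t : T ⟶ X` to `W'` are families of lifts of the `t ≫ X.ρ g` to `W`, `g : G`. -/
lemma exists_coinduction (X : Action Scheme.{u} G) {W : Scheme.{u}} (w : W ⟶ X.V) [IsAffineHom w]
    [IsAffine W] : ∃ (W' : Action Scheme.{u} G) (π : W' ⟶ X) (q : G → (W'.V ⟶ W)), IsAffine W'.V ∧
      (∀ h, q h ≫ w = π.hom ≫ X.ρ h) ∧ (∀ g h, W'.ρ g ≫ q h = q (h * g)) ∧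
      ∀ {T : Scheme.{u}} (t : T ⟶ X.V) (f : G → (T ⟶ W)), (∀ h, f h ≫ w = t ≫ X.ρ h) →
        ∃! k : T ⟶ W'.V, k ≫ π.hom = t ∧ ∀ h, k ≫ q h = f h := by
  obtain ⟨P, p, q, hp, hq, H⟩ := exists_fiberProduct G w (X := X.V) fun g => X.ρ g
  have hρ (g h : G) : X.ρ (g * h) = X.ρ h ≫ X.ρ g := map_mul X.ρ g h
  -- The element `g` acts by shifting the index from h to h * g. This covers `X.ρ g`, since `X.ρ (h
  -- * g)` is `X.ρ g` followed by `X.ρ h`.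
  have hact (g : G) := H (p ≫ X.ρ g) (fun h => q (h * g)) fun h => by
    rw [hq, Category.assoc, hρ]
  choose α hα hα' using fun g => (hact g).exists
  let W' : Action Scheme.{u} G := 
    { V := P
      ρ :=
        { toFun := α
          map_one' := (hact 1).unique ⟨hα 1, hα' 1⟩ ⟨by
            rw [show X.ρ 1 = 𝟙 X.V from map_one X.ρ]; exact (Category.id_comp _).trans (Category.comp_id _).symm, fun h => by rw [mul_one]; exact Category.id_comp _⟩
          map_mul' := fun g g' => (hact (g * g')).unique ⟨hα _, hα' _⟩
            ⟨by
              change (α g' ≫ α g) ≫ p = _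
              rw [Category.assoc, hα, reassoc_of% hα g', hρ], fun h => by
              change (α g' ≫ α g) ≫ q h = _
              rw [Category.assoc, hα', hα', mul_assoc]⟩ } }
  refine ⟨W', ⟨p, hα⟩, q, ?_, hq, hα', H⟩
  -- The projection `q 1` to the affine scheme `W` is an affine morphism, because its composite with
  -- the affine `w` is the affine `p`.
  have h1 : X.ρ 1 = 𝟙 X.V := map_one X.ρ
  have h2 : q 1 ≫ w = p := by rw [hq, h1]; exact Category.comp_id _
  have : IsAffineHom (q 1 ≫ w) := h2 ▸ hp
  have : IsAffineHom (q 1) := .of_comp (q 1) w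
  exact isAffine_of_isAffineHom (q 1)

end
end EquivariantJouanolou

namespace EquivariantJouanolou
noncomputable section

variable {G : Type v} [Group G] [Finite G]

/-- The base change of a coinduction is a `G`-vector bundle if the base change of the original
morphism is a vector bundle. -/
lemma isGVectorBundle_of_coinduction {X W' Y : Action Scheme.{u} G} {W : Scheme.{u}} {w : W ⟶ X.V}
    {π : W' ⟶ X} {q : G → (W'.V ⟶ W)} (hq : ∀ h, q h ≫ w = π.hom ≫ X.ρ h)
    (hact : ∀ g h, W'.ρ g ≫ q h = q (h * g))
    (H : ∀ {T : Scheme.{u}} (t : T ⟶ X.V) (f : G → (T ⟶ W)), (∀ h, f h ≫ w = t ≫ X.ρ h) →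
      ∃! k : T ⟶ W'.V, k ≫ π.hom = t ∧ ∀ h, k ≫ q h = f h)
    (f : Y ⟶ X) (β : VectorBundleStructure (pullback.snd w f.hom)) :
    IsGVectorBundle (pullback.snd π f) := by
  have hP := (IsPullback.of_hasPullback π f).map (Action.forget Scheme.{u} G)
  -- The fibre product of `G`-schemes is replaced by any `G`-scheme whose underlying square is
  -- cartesian, so that only the universal property in schemes is used.
  obtain ⟨E, fst, snd, hfst, hsnd⟩ : ∃ (E : Action Scheme.{u} G) (fst : E ⟶ W') (snd : E ⟶ Y), 
    IsPullback fst.hom snd.hom π.hom f.hom ∧ (IsGVectorBundle snd → IsGVectorBundle (pullback.snd π f)) :=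
    ⟨_, _, _, hP, id⟩
  apply hsnd
  clear hsnd hP
  -- A point of the base change over `t` is a family, indexed by h, of points of W ×_X Y over `t ≫
  -- Y.ρ h`; the vector bundle structure is the product of the pullbacks of `β` along the `Y.ρ h`.
  let F {T : Scheme.{u}} (t : T ⟶ Y.V) (s : Points snd.hom t) :
      VectorBundleStructure.PiPoints (fun _ : G => pullback.snd w f.hom) (fun h => Y.ρ h) t :=
    fun h => ⟨pullback.lift (s.1 ≫ fst.hom ≫ q h) (t ≫ Y.ρ h) (by
      rw [Category.assoc, Category.assoc, Category.assoc, hq, reassoc_of% hfst.w, ← f.comm, reassoc_of% s.2]), pullback.lift_snd _ _ _⟩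
  have hF {T : Scheme.{u}} (t : T ⟶ Y.V) : Function.Bijective (F t) := by
    constructor
    · intro s s' h
      have e (s : Points snd.hom t) : s.1 ≫ fst.hom ≫ π.hom = t ≫ f.hom := by
        rw [hfst.w, reassoc_of% s.2]
      apply Subtype.ext
      apply hfst.hom_ext
      · refine (H (t ≫ f.hom) (fun h => s.1 ≫ fst.hom ≫ q h) ?_).unique ⟨?_, ?_⟩ ⟨?_, ?_⟩
        · intro h
          rw [Category.assoc, Category.assoc, hq, reassoc_of% e s, Category.assoc]
        · rw [Category.assoc, e]
        · simp
        · rw [Category.assoc, e]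
        · intro g
          have := congr((Subtype.val ($h g)) ≫ pullback.fst _ _)
          simp only [F] at this
          rw [pullback.lift_fst, pullback.lift_fst] at this
          rw [this, Category.assoc]
      · exact s.2.trans s'.2.symm
    · intro p
      obtain ⟨k, ⟨hk, hk'⟩, -⟩ := H (t ≫ f.hom) (fun h => (p h).1 ≫ pullback.fst _ _) (by
        intro h
        rw [Category.assoc, pullback.condition, reassoc_of% (p h).2, Category.assoc, ← f.comm])
      refine ⟨⟨hfst.lift k t hk, hfst.lift_snd _ _ _⟩, ?_⟩
      funext h
      apply Subtype.ext
      simp only [F]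
      apply pullback.hom_ext
      · rw [pullback.lift_fst, ← Category.assoc, hfst.lift_fst, hk']
      · rw [pullback.lift_snd, (p h).2]
  let Φ {T : Scheme.{u}} (t : T ⟶ Y.V) := Equiv.ofBijective _ (hF t)
  have hΦfst {T : Scheme.{u}} (t : T ⟶ Y.V) (s : Points snd.hom t) (h : G) :
      (Φ t s h).1 ≫ pullback.fst _ _ = s.1 ≫ fst.hom ≫ q h := pullback.lift_fst _ _ _
  have hext {T : Scheme.{u}} {t : T ⟶ Y.V} (p p' : Points (pullback.snd w f.hom) t)
      (h : p.1 ≫ pullback.fst _ _ = p'.1 ≫ pullback.fst _ _) : p = p' :=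
    Subtype.ext (pullback.hom_ext h (p.2.trans p'.2.symm))
  clear_value Φ
  have hΦ {T T' : Scheme.{u}} (h : T' ⟶ T) (t : T ⟶ Y.V) (s : Points snd.hom t) (j : G) :
      Φ (h ≫ t) (s.pull h) j = ((Φ t s j).pull h).cast (Category.assoc _ _ _).symm := by
    refine hext _ _ ((hΦfst _ _ _).trans ?_)
    change (h ≫ s.1) ≫ _ = (h ≫ (Φ t s j).1) ≫ _
    rw [Category.assoc, Category.assoc, hΦfst]
  have hρ (g h : G) : Y.ρ (g * h) = Y.ρ h ≫ Y.ρ g := map_mul Y.ρ g h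
  -- In these coordinates `g` only reindexes the family, whence it acts linearly although `β` is not
  -- equivariant.
  have hΦact (g : G) {T : Scheme.{u}} (t : T ⟶ Y.V) (s : Points snd.hom t) (h : G) :
      Φ (t ≫ Y.ρ g) (s.act g) h = (Φ t s (h * g)).cast (by
        change t ≫ Y.ρ (h * g) = (t ≫ Y.ρ g) ≫ Y.ρ h
        rw [hρ, Category.assoc]) := by
    refine hext _ _ ((hΦfst _ _ _).trans ?_)
    change (s.1 ≫ E.ρ g) ≫ _ = (Φ t s (h * g)).1 ≫ _
    rw [hΦfst, Category.assoc, reassoc_of% fst.comm g, hact]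
  refine ⟨{ VectorBundleStructure.pi snd.hom (fun _ => β) Φ hΦ with act_add := ?_, act_smul := ?_ }⟩
  · intro g T t s s'
    apply (Φ (t ≫ Y.ρ g)).injective
    funext h
    rw [hΦact]
    refine (congrArg _ (VectorBundleStructure.pi_add_apply _ (fun _ => β) Φ hΦ t s s' (h * g))).trans ?_
    refine Eq.trans ?_ (VectorBundleStructure.pi_add_apply _ (fun _ => β) Φ hΦ _ _ _ h).symm
    rw [hΦact, hΦact]
    exact β.cast_add _ _ _
  · intro g T t a s
    apply (Φ (t ≫ Y.ρ g)).injective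
    funext h
    rw [hΦact]
    refine (congrArg _ (VectorBundleStructure.pi_smul_apply _ (fun _ => β) Φ hΦ t a s (h * g))).trans ?_
    refine Eq.trans ?_ (VectorBundleStructure.pi_smul_apply _ (fun _ => β) Φ hΦ _ _ _ h).symm
    rw [hΦact]
    exact β.cast_smul _ _ _

/-- Coinduction of the scheme of splittings associated with an ample family. -/
theorem exists_isGVectorBundle (X : Action Scheme.{u} G) {A I : Type u} [Finite A] [Finite I]
    (d : AmpleCocycle X.V A I) : ∃ (W : Action Scheme.{u} G) (π : W ⟶ X), IsAffine W.V ∧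
      ∀ (Y : Action Scheme.{u} G) (f : Y ⟶ X), IsAffine Y.V → IsGVectorBundle (pullback.snd π f) := by
  have := Fintype.ofFinite I
  obtain ⟨W₀, w, univ, hw, H⟩ := d.exists_isUniversal_top
  have := d.isAffine_of_splitting w univ
  obtain ⟨W, π, q, hW, hq, hact, H'⟩ := exists_coinduction X w
  refine ⟨W, π, hW, fun Y f hY => ?_⟩
  obtain ⟨β⟩ := d.nonempty_vectorBundleStructure H f.hom
  exact isGVectorBundle_of_coinduction hq hact H' f β

end
end EquivariantJouanolou

/-! ### A Nisnevich cover by affine `G`-schemes -/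

namespace EquivariantJouanolou
noncomputable section

lemma etale_of_isLocalIso {X Y : Scheme.{u}} (f : X ⟶ Y) [hf : IsLocalIso f] : Etale f :=
  @IsLocalIso.le_of_isZariskiLocalAtSource @Etale ⟨fun _ => inferInstance⟩
    HasRingHomProperty.instIsZariskiLocalAtSource _ _ f hf

/-- Étale morphisms are open, so an injective local isomorphism is an open embedding with
isomorphisms on stalks, that is, an open immersion. -/
lemma isIso_of_isLocalIso_of_bijective {X Y : Scheme.{u}} (f : X ⟶ Y) [hf : IsLocalIso f]
    (h : Function.Bijective f) : IsIso f := by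
  have : Etale f := etale_of_isLocalIso f
  have : IsOpenImmersion f := by
    rw [IsOpenImmersion.iff_isIso_stalkMap]
    refine ⟨.of_continuous_injective_isOpenMap f.continuous h.1 f.isOpenMap, fun x => ?_⟩
    obtain ⟨U, hxU, hU⟩ := hf.exists_isOpenImmersion x
    obtain ⟨y, rfl⟩ : ∃ y : U.toScheme, U.ι y = x := ⟨⟨x, hxU⟩, rfl⟩
    have : IsIso ((U.ι ≫ f).stalkMap y) := inferInstance
    rw [Scheme.Hom.stalkMap_comp] at this
    exact @IsIso.of_isIso_comp_right _ _ _ _ _ _ (U.ι.stalkMap y) inferInstance this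
  apply isIso_of_isOpenImmersion_of_opensRange_eq_top
  ext y
  simpa using! h.2 y

/-- The reduced induced structure on a closed subset. -/
lemma exists_isReduced_isClosedImmersion (X : Scheme.{u}) {C : Set X} (hC : IsClosed C) :
    ∃ (Z : Scheme.{u}) (z : Z ⟶ X), IsReduced Z ∧ IsClosedImmersion z ∧ Set.range z = C := by
  let I := Scheme.IdealSheafData.vanishingIdeal (X := X) ⟨C, hC⟩
  refine ⟨I.subscheme, I.subschemeι, ?_, inferInstance, ?_⟩
  · have (U : X.affineOpens) : IsReduced (I.subschemeCover.openCover.X U) := by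
      have : _root_.IsReduced (Γ(X, U) ⧸ I.ideal U) := by
        rw [← Ideal.isRadical_iff_quotient_reduced]
        exact PrimeSpectrum.isRadical_vanishingIdeal _
      exact inferInstanceAs (IsReduced (Spec (.of (Γ(X, U) ⧸ I.ideal U))))
    have (U : I.subschemeCover.openCover.I₀) : IsReduced (I.subschemeCover.openCover.X U) := this U
    exact IsReduced.of_openCover _ I.subschemeCover.openCover
  · rw [I.range_subschemeι]
    simp [I]

variable {G : Type v} [Group G]

lemma range_ι_comp_subset {X Y : Scheme.{u}} (f : X ⟶ Y) {U : X.Opens} {V : Y.Opens}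
    (h : f ⁻¹ᵁ V = U) : Set.range (U.ι ≫ f) ⊆ Set.range V.ι := by
  rintro _ ⟨x, rfl⟩
  have : x.1 ∈ f ⁻¹ᵁ V := h.symm ▸ x.2
  simpa using! this

/-- An invariant open subset of a `G`-scheme. -/
def invariantOpen (X : Action Scheme.{u} G) (U : X.V.Opens) (hU : ∀ g, X.ρ g ⁻¹ᵁ U = U) :
    Action Scheme.{u} G where
  V := U
  ρ :=
    { toFun g := IsOpenImmersion.lift U.ι (U.ι ≫ X.ρ g) (range_ι_comp_subset _ (hU g))
      map_one' := by
        apply (cancel_mono U.ι).mp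
        rw [IsOpenImmersion.lift_fac, show X.ρ 1 = 𝟙 X.V from map_one X.ρ]
        exact (Category.comp_id _).trans (Category.id_comp _).symm
      map_mul' g h := by
        apply (cancel_mono U.ι).mp
        rw [IsOpenImmersion.lift_fac, show X.ρ (g * h) = X.ρ h ≫ X.ρ g from map_mul X.ρ g h]
        change _ = (IsOpenImmersion.lift U.ι (U.ι ≫ X.ρ h) _ ≫
          IsOpenImmersion.lift U.ι (U.ι ≫ X.ρ g) _) ≫ U.ι
        rw [Category.assoc, IsOpenImmersion.lift_fac, IsOpenImmersion.lift_fac_assoc,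
          Category.assoc] }

section

variable {X : Action Scheme.{u} G} {U : X.V.Opens} (hU : ∀ g, X.ρ g ⁻¹ᵁ U = U)

/-- The inclusion of an invariant open subset. -/
def invariantOpenι : invariantOpen X U hU ⟶ X where
  hom := U.ι
  comm g := IsOpenImmersion.lift_fac U.ι (U.ι ≫ X.ρ g) (range_ι_comp_subset _ (hU g))

instance : IsOpenImmersion (invariantOpenι hU).hom :=  by
  have h : IsOpenImmersion U.ι := inferInstance
  exact h

/-- Lifting an equivariant morphism to an invariant open subset. -/
def invariantOpenLift {Y : Action Scheme.{u} G} (f : Y ⟶ X) (hf : Set.range f.hom ⊆ U) :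
    Y ⟶ invariantOpen X U hU where
  hom := IsOpenImmersion.lift (invariantOpenι hU).hom f.hom (hf.trans (Scheme.Opens.range_ι U).ge)
  comm g := by
    rw [← cancel_mono (invariantOpenι hU).hom, Category.assoc, Category.assoc,
      IsOpenImmersion.lift_fac, (invariantOpenι hU).comm, IsOpenImmersion.lift_fac_assoc, f.comm]

lemma invariantOpenLift_ι {Y : Action Scheme.{u} G} (f : Y ⟶ X) (hf : Set.range f.hom ⊆ U) :
    invariantOpenLift hU f hf ≫ invariantOpenι hU = f := by
  ext1
  exact IsOpenImmersion.lift_fac _ _ _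

lemma range_invariantOpenι : Set.range (invariantOpenι hU).hom = U := Scheme.Opens.range_ι U

end

section Sigma

variable {X : Action Scheme.{u} G} {τ : Type*} [Finite τ] (U : τ → X.V.Opens)

/-- Morphisms to a coproduct of open subsets which factor through one of these. -/
def toSigma (t : τ) {Z : Scheme.{u}} (f : Z ⟶ X.V) (hf : Set.range f ⊆ Set.range (U t).ι) :
    Z ⟶ ∐ fun t => (U t : Scheme.{u}) :=
  IsOpenImmersion.lift (U t).ι f hf ≫ Sigma.ι (fun t => (U t : Scheme.{u})) t

lemma toSigma_desc (t : τ) {Z : Scheme.{u}} (f : Z ⟶ X.V) (hf : Set.range f ⊆ Set.range (U t).ι) :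
    toSigma U t f hf ≫ Sigma.desc (fun t => (U t).ι) = f := by
  rw [toSigma, Category.assoc, Sigma.ι_desc, IsOpenImmersion.lift_fac]

/-- Identities such as `one_smul` hold only propositionally in the index type, so index and morphism
are replaced together. -/
lemma toSigma_congr {t t' : τ} (h : t = t') {Z : Scheme.{u}} {f f' : Z ⟶ X.V} (e : f = f')
    (hf : Set.range f ⊆ Set.range (U t).ι) (hf' : Set.range f' ⊆ Set.range (U t').ι) :
    toSigma U t f hf = toSigma U t' f' hf' := by
  subst h e; rfl

lemma toSigma_ι (t : τ) : toSigma U t (U t).ι le_rfl = Sigma.ι (fun t => (U t : Scheme.{u})) t := by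
  have : IsOpenImmersion.lift (U t).ι (U t).ι le_rfl = 𝟙 _ := by
    rw [← cancel_mono (U t).ι, IsOpenImmersion.lift_fac, Category.id_comp]
  rw [toSigma, this, Category.id_comp]

lemma ι_desc_toSigma {t : τ} {Z : Scheme.{u}} (f : Z ⟶ X.V) (hf : Set.range f ⊆ Set.range (U t).ι) 
    {Y : Scheme.{u}} (k : ∀ t, (U t : Scheme.{u}) ⟶ Y) :
    toSigma U t f hf ≫ Sigma.desc k = IsOpenImmersion.lift (U t).ι f hf ≫ k t := by
  rw [toSigma, Category.assoc, Sigma.ι_desc]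

lemma lift_toSigma {t s : τ} {Z : Scheme.{u}} (f : Z ⟶ X.V) (hf : Set.range f ⊆ Set.range (U t).ι)
    (r : X.V ⟶ X.V) (hr : Set.range ((U t).ι ≫ r) ⊆ Set.range (U s).ι)
    (hr' : Set.range (f ≫ r) ⊆ Set.range (U s).ι) :
    IsOpenImmersion.lift (U t).ι f hf ≫ toSigma U s ((U t).ι ≫ r) hr = toSigma U s (f ≫ r) hr' := by
  rw [toSigma, toSigma, ← Category.assoc]
  congr 1
  rw [← cancel_mono (U s).ι, Category.assoc, IsOpenImmersion.lift_fac, IsOpenImmersion.lift_fac,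
    IsOpenImmersion.lift_fac_assoc]

variable [MulAction G τ] {U} (hU : ∀ (g : G) (t : τ), X.ρ g ⁻¹ᵁ U (g • t) = U t)

/-- The coproduct of a family of open subsets which is permuted by the group. -/
def sigmaAction : Action Scheme.{u} G where
  V := ∐ fun t => (U t : Scheme.{u})
  ρ :=
    { toFun g := Sigma.desc fun t => toSigma U (g • t) ((U t).ι ≫ X.ρ g)
        (range_ι_comp_subset _ (hU g t))
      map_one' := by
        apply Sigma.hom_ext
        intro t
        rw [Sigma.ι_desc]
        refine (toSigma_congr U (one_smul G t) ?_ _ le_rfl).trans ((toSigma_ι U t).trans ?_)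
        · rw [show X.ρ 1 = 𝟙 X.V from map_one X.ρ]
          exact Category.comp_id _
        · exact (Category.comp_id _).symm
      map_mul' g h := by
        apply Sigma.hom_ext
        intro t
        change _ = _ ≫ (Sigma.desc _ ≫ Sigma.desc _)
        rw [Sigma.ι_desc, Sigma.ι_desc_assoc, ι_desc_toSigma]
        refine Eq.trans ?_ (lift_toSigma U _ _ (X.ρ g) (range_ι_comp_subset _ (hU g _)) ?_).symm
        · apply toSigma_congr _ (mul_smul g h t)
          rw [show X.ρ (g * h) = X.ρ h ≫ X.ρ g from map_mul X.ρ g h, Category.assoc]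
        · rw [Category.assoc, ← show X.ρ (g * h) = X.ρ h ≫ X.ρ g from map_mul X.ρ g h, smul_smul]
          exact range_ι_comp_subset _ (hU _ _) }

/-- The equivariant morphism from the coproduct. -/
def sigmaActionDesc : sigmaAction hU ⟶ X where
  hom := Sigma.desc fun t => (U t).ι
  comm g := by
    apply Sigma.hom_ext
    intro t
    change _ ≫ Sigma.desc (fun t => toSigma U (g • t) ((U t).ι ≫ X.ρ g) _) ≫ _ =
      _ ≫ Sigma.desc (fun t => (U t).ι) ≫ _
    rw [Sigma.ι_desc_assoc, Sigma.ι_desc_assoc]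
    exact toSigma_desc _ _ _ _

lemma sigmaActionDesc_hom : (sigmaActionDesc hU).hom = Sigma.desc fun t => (U t).ι := rfl

lemma isLocalIso_sigmaActionDesc : IsLocalIso (sigmaActionDesc hU).hom := by
  rw [sigmaActionDesc_hom]
  refine IsZariskiLocalAtSource.sigmaDesc (P := @IsLocalIso) fun t => ?_
  exact ⟨fun x => ⟨⊤, trivial, inferInstance⟩⟩

lemma sigmaActionDesc_ι_apply (t : τ) (x : (U t : Scheme.{u})) :
    (sigmaActionDesc hU).hom (Sigma.ι (fun t => (U t : Scheme.{u})) t x) = x.1 := by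
  change (Sigma.desc fun t => (U t).ι) (Sigma.ι (fun t => (U t : Scheme.{u})) t x) = _
  rw [← Scheme.Hom.comp_apply, Sigma.ι_desc]
  rfl

lemma exists_toSigma_apply (y : (sigmaAction hU).V) : ∃ (t : τ) (x : U t),
    Sigma.ι (fun t => (U t : Scheme.{u})) t x = y ∧ (sigmaActionDesc hU).hom y = x.1 := by
  obtain ⟨t, x, rfl⟩ : ∃ (t : τ) (x : (U t : Scheme.{u})),
      Sigma.ι (fun t => (U t : Scheme.{u})) t x = y :=
    (sigmaOpenCover fun t => (U t : Scheme.{u})).exists_eq y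
  exact ⟨t, x, rfl, sigmaActionDesc_ι_apply hU t x⟩

end Sigma

section Strata

open scoped Pointwise

variable {X : Action Scheme.{u} G} {K : Type*} [Finite K] [DecidableEq K] [MulAction G K]
  {V : K → X.V.Opens} (hV : ∀ (g : G) (k : K), X.ρ g ⁻¹ᵁ V (g • k) = V k)

/-- The intersection of some members of a finite family of open subsets. -/
def interOpen (V : K → X.V.Opens) (T : Finset K) : X.V.Opens := T.inf V

omit [Finite K] [DecidableEq K] [MulAction G K] in
lemma mem_interOpen {T : Finset K} {x : X.V} : x ∈ interOpen V T ↔ ∀ k ∈ T, x ∈ V k := by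
  rw [interOpen, ← SetLike.mem_coe, TopologicalSpace.Opens.coe_finset_inf, Finset.inf_eq_iInf]
  simp

/-- The points contained in at least `n` members of a finite family of open subsets. -/
def stratumOpen (V : K → X.V.Opens) (n : ℕ) : X.V.Opens :=
  ⨆ T : {T : Finset K // n ≤ T.card}, interOpen V T.1

omit [Finite K] [DecidableEq K] [MulAction G K] in
lemma mem_stratumOpen {n : ℕ} {x : X.V} :
    x ∈ stratumOpen V n ↔ ∃ T : Finset K, n ≤ T.card ∧ ∀ k ∈ T, x ∈ V k := by
  simp [stratumOpen, mem_interOpen]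

instance (n : ℕ) : MulAction G {T : Finset K // T.card = n} where
  smul g T := ⟨g • T.1, by rw [Finset.card_smul_finset, T.2]⟩
  one_smul T := Subtype.ext (one_smul G T.1)
  mul_smul g h T := Subtype.ext (mul_smul g h T.1)

include hV in
omit [Finite K] in
lemma preimage_interOpen (g : G) (T : Finset K) : X.ρ g ⁻¹ᵁ interOpen V (g • T) = interOpen V T := by
  ext x
  let r : X.V ⟶ X.V := X.ρ g
  change r x ∈ interOpen V (g • T) ↔ x ∈ interOpen V T
  rw [mem_interOpen, mem_interOpen]
  have this (k : K) : r x ∈ V (g • k) ↔ x ∈ V k := by rw [← hV g k]; rfl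
  constructor
  · intro h k hk
    exact (this k).mp (h _ (Finset.smul_mem_smul_finset hk))
  · intro h k hk
    obtain ⟨k, hk', rfl⟩ := Finset.mem_smul_finset.mp hk
    exact (this k).mpr (h k hk')

include hV in
omit [Finite K] in
lemma preimage_stratumOpen (n : ℕ) (g : G) :
    X.ρ g ⁻¹ᵁ stratumOpen V n = stratumOpen V n := by
  rw [stratumOpen, Scheme.Hom.preimage_iSup]
  apply le_antisymm
  · refine iSup_le fun T => ?_
    refine le_iSup_of_le ⟨g⁻¹ • T.1, by rw [Finset.card_smul_finset]; exact T.2⟩ ?_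
    rw [← preimage_interOpen hV g (g⁻¹ • T.1), smul_inv_smul]
  · refine iSup_le fun T => ?_
    refine le_iSup_of_le ⟨g • T.1, by rw [Finset.card_smul_finset]; exact T.2⟩ ?_
    rw [preimage_interOpen hV g]

/-- The open subset of points contained in at least `n` members of the family. -/
abbrev stratum (n : ℕ) : Action Scheme.{u} G :=
  invariantOpen X (stratumOpen V n) (preimage_stratumOpen hV n)

/-- The coproduct of the intersections of `n` members of the family. -/
abbrev stratumCover (n : ℕ) : Action Scheme.{u} G :=
  sigmaAction (U := fun T : {T : Finset K // T.card = n} => interOpen V T.1)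
    fun g T => preimage_interOpen hV g T.1

/-- The morphism to `X` from the coproduct of the intersections of `n` members of the family. -/
abbrev stratumCoverDesc (n : ℕ) : stratumCover hV n ⟶ X :=
  sigmaActionDesc (U := fun T : {T : Finset K // T.card = n} => interOpen V T.1)
    fun g T => preimage_interOpen hV g T.1

lemma range_stratumCoverDesc_subset (n : ℕ) :
    Set.range (stratumCoverDesc hV n).hom ⊆ stratumOpen V n := by
  rintro _ ⟨y, rfl⟩
  obtain ⟨T, x, -, hx⟩ := exists_toSigma_apply (U := fun T : {T : Finset K // T.card = n} =>
    interOpen V T.1) (fun g T => preimage_interOpen hV g T.1) y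
  rw [hx]
  exact mem_stratumOpen.mpr ⟨T.1, T.2.ge, mem_interOpen.mp x.2⟩

variable [IsAffineHom (pullback.diagonal (terminal.from X.V))]

/-- The inclusion of a stratum into the previous one. -/
abbrev stratumι (n : ℕ) : stratum hV (n + 1) ⟶ stratum hV n :=
  invariantOpenLift _ (invariantOpenι (preimage_stratumOpen hV (n + 1))) (by
    rw [range_invariantOpenι]
    intro x hx
    obtain ⟨T, hT, h⟩ := mem_stratumOpen.mp hx
    exact mem_stratumOpen.mpr ⟨T, (Nat.le_succ n).trans hT, h⟩)

/-- The morphism to a stratum from the coproduct of the intersections. -/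
abbrev stratumCoverLift (n : ℕ) : stratumCover hV n ⟶ stratum hV n :=
  invariantOpenLift _ (stratumCoverDesc hV n) (range_stratumCoverDesc_subset hV n)

lemma isAffine_stratumCover (hV' : ∀ k, IsAffineOpen (V k)) {n : ℕ} (hn : n ≠ 0) :
    IsAffine (stratumCover hV n).V := by
  have (T : {T : Finset K // T.card = n}) : IsAffine (interOpen V T.1 : Scheme.{u}) := by
    have hT : T.1.Nonempty := by
      rw [← Finset.card_ne_zero, T.2]; exact hn
    change IsAffineOpen _
    have := IsAffineOpen.biInf (T.1 : Set K) T.1.finite_toSet hT (U := V) fun k _ => hV' k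
    rwa [interOpen, Finset.inf_eq_iInf]
  exact inferInstanceAs (IsAffine (∐ fun T : {T : Finset K // T.card = n} =>
    (interOpen V T.1 : Scheme.{u})))

lemma quasiSeparatedSpace_of_isAffineHom_diagonal (X : Scheme.{u})
    [IsAffineHom (pullback.diagonal (terminal.from X))] : QuasiSeparatedSpace X := by
  have : QuasiSeparated (terminal.from X) := ⟨inferInstance⟩
  exact (quasiSeparatedSpace_iff_quasiSeparated X).mpr this

/-- A point of the n-th stratum outside the next one lies in exactly n members, hence in exactly one
n-fold intersection. Over the reduced complement the cover is thus a bijective local isomorphism,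
hence an isomorphism. For n = 0 the only intersection would be all of `X`, which need not be affine.
-/
lemma isDistinguished_stratum (hV' : ∀ k, IsAffineOpen (V k)) {n : ℕ} (hn : n ≠ 0) :
    IsDistinguished (stratumι hV n) (stratumCoverLift hV n) := by
  have hqs := quasiSeparatedSpace_of_isAffineHom_diagonal X.V
  have haff := isAffine_stratumCover hV hV' hn
  have h1 : (stratumι hV n).hom ≫ (invariantOpenι (preimage_stratumOpen hV n)).hom =
    (invariantOpenι (preimage_stratumOpen hV (n + 1))).hom := congrArg Action.Hom.hom (invariantOpenLift_ι _ _ _)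
  have h2 : (stratumCoverLift hV n).hom ≫ (invariantOpenι (preimage_stratumOpen hV n)).hom =
    (stratumCoverDesc hV n).hom := congrArg Action.Hom.hom (invariantOpenLift_ι _ _ _)
  have hli := isLocalIso_sigmaActionDesc (U := fun T : {T : Finset K // T.card = n} => interOpen V T.1)
    fun g T => preimage_interOpen hV g T.1
  have hoi : IsOpenImmersion (stratumι hV n).hom := by
    have : IsOpenImmersion ((stratumι hV n).hom ≫ (invariantOpenι (preimage_stratumOpen hV n)).hom) := by
      rw [h1]; infer_instance
    exact IsOpenImmersion.of_comp _ (invariantOpenι (preimage_stratumOpen hV n)).hom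
  have hli' : IsLocalIso (stratumCoverLift hV n).hom := by
    refine ⟨fun y => ?_⟩
    obtain ⟨O, hy, hO⟩ := hli.exists_isOpenImmersion y
    refine ⟨O, hy, ?_⟩
    have : IsOpenImmersion ((O.ι ≫ (stratumCoverLift hV n).hom) ≫
        (invariantOpenι (preimage_stratumOpen hV n)).hom) := by
      rw [Category.assoc, h2]; exact hO
    exact IsOpenImmersion.of_comp _ (invariantOpenι (preimage_stratumOpen hV n)).hom
  have hcompact : CompactSpace (stratum hV (n + 1)).V := by
    suffices h : IsCompact (stratumOpen V (n + 1) : Set X.V) from isCompact_iff_compactSpace.mp h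
    rw [stratumOpen, TopologicalSpace.Opens.coe_iSup]
    refine isCompact_iUnion fun T => ?_
    have hT : T.1.Nonempty := by
      rw [← Finset.card_pos]; exact (Nat.succ_pos n).trans_le T.2
    have := IsAffineOpen.biInf (T.1 : Set K) T.1.finite_toSet hT (U := V) fun k _ => hV' k
    rw [interOpen, Finset.inf_eq_iInf]
    exact this.isCompact
  have hrange : Set.range (stratumι hV n).hom =
      (invariantOpenι (preimage_stratumOpen hV n)).hom ⁻¹' (stratumOpen V (n + 1)) := by
    have := range_invariantOpenι (preimage_stratumOpen hV (n + 1))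
    have hc : ⇑((stratumι hV n).hom ≫ (invariantOpenι (preimage_stratumOpen hV n)).hom) =
        (invariantOpenι (preimage_stratumOpen hV n)).hom ∘ (stratumι hV n).hom :=
      funext fun x => Scheme.Hom.comp_apply _ _ x
    rw [← this, ← h1, hc, Set.range_comp, Set.preimage_image_eq]
    exact (Scheme.Hom.isOpenEmbedding _).injective
  refine ⟨hoi, ?_, etale_of_isLocalIso _, ?_, ?_, ?_⟩
  · have : QuasiCompact ((stratumι hV n).hom ≫ (invariantOpenι (preimage_stratumOpen hV n)).hom) := by
      rw [h1]; infer_instance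
    exact QuasiCompact.of_comp _ (invariantOpenι (preimage_stratumOpen hV n)).hom
  · have : IsSeparated ((stratumCoverLift hV n).hom ≫ terminal.from _) := by
      rw [terminal.comp_from]; infer_instance
    exact IsSeparated.of_comp _ (terminal.from _)
  · have : QuasiCompact ((stratumCoverLift hV n).hom ≫ (invariantOpenι (preimage_stratumOpen hV n)).hom) := by
      infer_instance
    exact QuasiCompact.of_comp _ (invariantOpenι (preimage_stratumOpen hV n)).hom
  · obtain ⟨Z, z, hZ, hz, hzr⟩ := exists_isReduced_isClosedImmersion (stratum hV n).V
      (C := (Set.range (stratumι hV n).hom)ᶜ) (Scheme.Hom.isOpenEmbedding _).isOpen_range.isClosed_compl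
    have hfib : Function.Injective fun y : (stratumCoverLift hV n).hom ⁻¹'
        (Set.range (stratumι hV n).hom)ᶜ => (stratumCoverLift hV n).hom y.1 := by
      rintro ⟨y, hy⟩ ⟨y', hy'⟩ (hyy' : (stratumCoverLift hV n).hom y = (stratumCoverLift hV n).hom y')
      apply Subtype.ext
      have hyy2 : (stratumCoverDesc hV n).hom y = (stratumCoverDesc hV n).hom y' := by
        rw [← h2, Scheme.Hom.comp_apply, hyy', ← Scheme.Hom.comp_apply]
      have hy2 : (stratumCoverDesc hV n).hom y ∉ stratumOpen V (n + 1) := by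
        intro h
        apply hy
        rw [hrange, Set.mem_preimage, ← Scheme.Hom.comp_apply, h2]
        exact h
      obtain ⟨T, x, rfl, hx⟩ := exists_toSigma_apply (U := fun T : {T : Finset K // T.card = n} =>
        interOpen V T.1) (fun g T => preimage_interOpen hV g T.1) y
      obtain ⟨T', x', rfl, hx'⟩ := exists_toSigma_apply (U := fun T : {T : Finset K // T.card = n} =>
        interOpen V T.1) (fun g T => preimage_interOpen hV g T.1) y'
      rw [hx] at hyy2 hy2
      rw [hx'] at hyy2
      -- Two different sets with n elements have a union with more than n, which would put the point
      -- into the next stratum.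
      obtain rfl : T = T' := by
        by_contra hne
        apply hy2
        refine mem_stratumOpen.mpr ⟨T.1 ∪ T'.1, ?_, ?_⟩
        · refine T.2.symm.trans_lt (Finset.card_lt_card ?_)
          refine Finset.ssubset_iff_subset_ne.mpr ⟨Finset.subset_union_left, fun h => hne ?_⟩
          apply Subtype.ext
          refine (Finset.eq_of_subset_of_card_le ?_ (T.2.trans T'.2.symm).le).symm
          rw [h]
          exact Finset.subset_union_right
        · intro k hk
          rcases Finset.mem_union.mp hk with hk | hk
          · exact mem_interOpen.mp x.2 k hk
          · rw [hyy2]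
            exact mem_interOpen.mp x'.2 k hk
      obtain rfl : x = x' := Subtype.ext hyy2
      rfl
    have hloc : IsLocalIso (pullback.fst z (stratumCoverLift hV n).hom) :=
      MorphismProperty.of_isPullback (P := @IsLocalIso)
        (IsPullback.of_hasPullback z (stratumCoverLift hV n).hom).flip hli'
    have hcl : IsClosedImmersion (pullback.snd z (stratumCoverLift hV n).hom) :=
      MorphismProperty.of_isPullback (P := @IsClosedImmersion)
        (IsPullback.of_hasPullback z (stratumCoverLift hV n).hom) hz
    have hcond (a : (pullback z (stratumCoverLift hV n).hom :)) :
        (stratumCoverLift hV n).hom (pullback.snd z (stratumCoverLift hV n).hom a) =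
          z (pullback.fst z (stratumCoverLift hV n).hom a) := by
      rw [← Scheme.Hom.comp_apply, ← Scheme.Hom.comp_apply, pullback.condition]
    have hbij : Function.Bijective (pullback.fst z (stratumCoverLift hV n).hom) := by
      constructor
      · intro a a' haa'
        apply hcl.isClosedEmbedding.injective
        have hmem (a : (pullback z (stratumCoverLift hV n).hom :)) :
            pullback.snd z (stratumCoverLift hV n).hom a ∈ (stratumCoverLift hV n).hom ⁻¹'
              (Set.range (stratumι hV n).hom)ᶜ := by
          rw [Set.mem_preimage, ← hzr, hcond]
          exact ⟨_, rfl⟩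
        exact congrArg Subtype.val (@hfib ⟨_, hmem a⟩ ⟨_, hmem a'⟩ (by simp only [hcond, haa']))
      · intro b
        have hb : z b ∉ Set.range (stratumι hV n).hom := by
          have : z b ∈ Set.range z := ⟨b, rfl⟩
          rwa [hzr] at this
        obtain ⟨y, hy⟩ : ∃ y, (stratumCoverLift hV n).hom y = z b := by
          obtain ⟨T, hT, hx⟩ := mem_stratumOpen.mp (z b).2
          obtain ⟨T', hT', hcard⟩ := Finset.exists_subset_card_eq hT
          have hx' : (z b).1 ∈ interOpen V T' := mem_interOpen.mpr fun k hk => hx k (hT' hk)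
          refine ⟨Sigma.ι (fun T : {T : Finset K // T.card = n} => (interOpen V T.1 : Scheme.{u}))
            ⟨T', hcard⟩ ⟨(z b).1, hx'⟩, ?_⟩
          apply (invariantOpenι (preimage_stratumOpen hV n)).hom.isOpenEmbedding.injective
          exact (Scheme.Hom.comp_apply _ _ _).symm.trans
            ((congr($h2 _)).trans (sigmaActionDesc_ι_apply _ _ _))
        obtain ⟨a, ha, -⟩ := Scheme.Pullback.exists_preimage_pullback b y hy.symm
        exact ⟨a, ha⟩
    have := isIso_of_isLocalIso_of_bijective _ hbij
    refine ⟨_, Z, pullback.snd z (stratumCoverLift hV n).hom, z,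
      asIso (pullback.fst z (stratumCoverLift hV n).hom), ?_, hZ, hcl, hz, hzr, ?_, pullback.condition⟩
    · exact isReduced_of_isOpenImmersion (pullback.fst z (stratumCoverLift hV n).hom)
    · apply Set.Subset.antisymm
      · rintro _ ⟨a, rfl⟩
        rw [Set.mem_compl_iff, Set.mem_preimage, hcond, ← Set.mem_compl_iff, ← hzr]
        exact ⟨_, rfl⟩
      · intro y hy
        have : (stratumCoverLift hV n).hom y ∈ Set.range z := hzr ▸ hy
        obtain ⟨b, hb⟩ := this
        obtain ⟨a, -, ha⟩ := Scheme.Pullback.exists_preimage_pullback b y hb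
        exact ⟨a, ha⟩

/-- The coproducts of intersections of members of an affine open cover form a Nisnevich cover. -/
lemma isNisnevichCover_stratumCover (hV' : ∀ k, IsAffineOpen (V k)) (hcov : ⨆ k, V k = ⊤) :
    IsNisnevichCover (fun n : ULift.{u} (Fin (Nat.card K)) => stratumCover hV (n.down + 1))
      fun n => stratumCoverDesc hV (n.down + 1) := by
  have hqs := quasiSeparatedSpace_of_isAffineHom_diagonal X.V
  have haff (n : ℕ) := isAffine_stratumCover hV hV' n.succ_ne_zero
  refine ⟨fun n => ?_, fun n => ?_, fun n => ?_, ?_⟩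
  · have := isLocalIso_sigmaActionDesc (U := fun T : {T : Finset K // T.card = n.down + 1} =>
      interOpen V T.1) fun g T => preimage_interOpen hV g T.1
    exact etale_of_isLocalIso _
  · have := haff n.down
    have : IsSeparated ((stratumCoverDesc hV (n.down + 1)).hom ≫ terminal.from _) := by
      rw [terminal.comp_from]; infer_instance
    exact IsSeparated.of_comp _ (terminal.from _)
  · have := haff n.down
    infer_instance
  · rw [nisnevichTopology, GrothendieckTopology.mem_sInf]
    rintro J ⟨hJ, hJ'⟩
    set S := Sieve.ofArrows (fun n : ULift.{u} (Fin (Nat.card K)) => stratumCover hV (n.down + 1))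
      fun n => stratumCoverDesc hV (n.down + 1)
    -- Descending induction on n. At n = `Nat.card K` + 1 the stratum is empty, since no set of
    -- members is that large. In general the stratum is covered by the next one, where induction
    -- applies, and by a member of the family generating `S`. The family starts at n = 1, and the
    -- first stratum is `X` because the members cover.
    have key (m : ℕ) : ∀ n, n + m = Nat.card K + 1 → 1 ≤ n →
        S.pullback (invariantOpenι (preimage_stratumOpen hV n)) ∈ J (stratum hV n) := by
      induction m with
      | zero =>
        intro n hn _
        refine J.superset_covering bot_le (hJ' _ ⟨fun x => ?_⟩)
        obtain ⟨T, hT, -⟩ := mem_stratumOpen.mp (show x.1 ∈ stratumOpen V n from x.2)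
        have := Fintype.ofFinite K
        have h2 := T.card_le_univ
        rw [← Nat.card_eq_fintype_card] at h2
        omega
      | succ m ih =>
        intro n hn hn1
        refine J.transitive (hJ _ _ (isDistinguished_stratum hV hV' (n := n) (by omega))) _ ?_
        suffices h : Sieve.generate (Presieve.singleton (stratumι hV n) ⊔
            Presieve.singleton (stratumCoverLift hV n)) ≤ J.close
              (S.pullback (invariantOpenι (preimage_stratumOpen hV n))) from fun Y f hf => h _ hf
        rw [Sieve.generate_le_iff]
        rintro Y f (⟨⟨⟩⟩ | ⟨⟨⟩⟩)
        · change Sieve.pullback _ _ ∈ J _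
          rw [← Sieve.pullback_comp, invariantOpenLift_ι]
          exact ih (n + 1) (by omega) (by omega)
        · change Sieve.pullback _ _ ∈ J _
          rw [← Sieve.pullback_comp, invariantOpenLift_ι]
          obtain ⟨k, rfl⟩ : ∃ k, n = k + 1 := ⟨n - 1, by omega⟩
          have hmem : S (stratumCoverDesc hV (k + 1)) :=
            Sieve.ofArrows_mk _ _ (⟨⟨k, by omega⟩⟩ : ULift.{u} (Fin (Nat.card K)))
          rw [(Sieve.mem_iff_pullback_eq_top _).mp hmem]
          exact J.top_mem _
    have h1 := key (Nat.card K) 1 (by omega) le_rfl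
    have htop : stratumOpen V 1 = ⊤ := by
      rw [eq_top_iff, ← hcov]
      refine iSup_le fun k x hx => mem_stratumOpen.mpr ⟨{k}, by simp, by simpa using hx⟩
    have : IsIso (invariantOpenι (preimage_stratumOpen hV 1)).hom := by
      apply isIso_of_isOpenImmersion_of_opensRange_eq_top
      ext1
      rw [Scheme.Hom.coe_opensRange, range_invariantOpenι, htop]
    have : IsIso (invariantOpenι (preimage_stratumOpen hV 1)) := Action.isIso_of_hom_isIso _
    exact J.pullback_mem_iff_of_isIso.mp h1

end Strata

/-- The existence of an affine `N`-affine bundle, given an ample family. -/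
theorem exists_isNAffineBundle [Finite G] (X : Action Scheme.{u} G) {A I : Type u} [Finite A]
    [Finite I] (d : AmpleCocycle X.V A I) :
    ∃ (W : Action Scheme.{u} G) (π : W ⟶ X), IsNAffineBundle π ∧ IsAffine W.V := by
  classical
  obtain ⟨W, π, hW, H⟩ := exists_isGVectorBundle X d
  refine ⟨W, π, ?_, hW⟩
  have := d.isAffineHom_diagonal
  -- The translates of the cover are permuted: with `V (h, a) = X.ρ h ⁻¹ᵁ d.U a`, the action h ↦ h *
  -- g⁻¹ gives `X.ρ g ⁻¹ᵁ V (g • k) = V k`.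
  let _ : MulAction G (G × A) :=
    { smul := fun g k => (k.1 * g⁻¹, k.2)
      one_smul := fun k => Prod.ext (by simp [HSMul.hSMul]) rfl
      mul_smul := fun g h k => Prod.ext (by simp [HSMul.hSMul, mul_assoc]) rfl }
  let V (k : G × A) : X.V.Opens := X.ρ k.1 ⁻¹ᵁ d.U k.2
  have hV (g : G) (k : G × A) : X.ρ g ⁻¹ᵁ V (g • k) = V k := by
    change X.ρ g ⁻¹ᵁ X.ρ (k.1 * g⁻¹) ⁻¹ᵁ d.U k.2 = X.ρ k.1 ⁻¹ᵁ d.U k.2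
    have h : X.ρ (k.1 * g⁻¹ * g) = X.ρ g ≫ X.ρ (k.1 * g⁻¹) := map_mul X.ρ (k.1 * g⁻¹) g
    rw [← Scheme.Hom.comp_preimage, ← h, inv_mul_cancel_right]
  have hV' (k : G × A) : IsAffineOpen (V k) := by
    have : IsIso (X.ρ k.1) := by
      refine ⟨X.ρ k.1⁻¹, ?_, ?_⟩
      · have := map_mul X.ρ k.1⁻¹ k.1
        rw [inv_mul_cancel, map_one] at this
        exact this.symm
      · have := map_mul X.ρ k.1 k.1⁻¹
        rw [mul_inv_cancel, map_one] at this
        exact this.symm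
    exact (d.isAffineOpen_U k.2).preimage (X.ρ k.1)
  have hcov : ⨆ k, V k = ⊤ := by
    rw [eq_top_iff, ← d.iSup_U]
    refine iSup_le fun a => le_iSup_of_le (1, a) ?_
    change _ ≤ X.ρ 1 ⁻¹ᵁ d.U a
    rw [show X.ρ 1 = 𝟙 X.V from map_one X.ρ, Scheme.Hom.id_preimage]
  exact ⟨_, _, _, isNisnevichCover_stratumCover hV hV' hcov, fun n =>
    H _ _ (isAffine_stratumCover hV hV' n.down.1.succ_ne_zero)⟩

end
end EquivariantJouanolou

/-! ### From an ample family to cocycle data -/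

namespace EquivariantJouanolou
noncomputable section

section LineBundle

variable {X : Scheme.{u}} {L : X.Modules}

lemma res_smul {U V : X.Opens} (h : V ≤ U) (a : Γ(X, U)) (e : Γ(L, U)) :
    res h (a • e) = rs h a • res h e := L.map_smul (homOfLE h) a e

lemma res_res {U V W : X.Opens} (h : V ≤ U) (h' : W ≤ V) (e : Γ(L, U)) :
    res h' (res h e) = res (h'.trans h) e := by
  have := L.presheaf.map_comp (homOfLE h).op (homOfLE h').op
  exact congr($(this.symm) e)

lemma res_self {U : X.Opens} (h : U ≤ U) (e : Γ(L, U)) : res h e = e :=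
  congr($(L.presheaf.map_id _) e)

lemma IsFreeGenerator.res {U V : X.Opens} {e : Γ(L, U)} (he : IsFreeGenerator e) (h : V ≤ U) :
    IsFreeGenerator (res h e) := by
  intro W hW
  simp only [res_res]
  exact he W _

lemma IsFreeGenerator.smul {U : X.Opens} {e : Γ(L, U)} (he : IsFreeGenerator e) {a : Γ(X, U)}
    (ha : IsUnit a) : IsFreeGenerator (a • e) := by
  intro W hW
  have hu := ha.map (rs hW)
  simp only [res_smul, smul_smul]
  exact (he W hW).comp (IsUnit.isUnit_iff_mulRight_bijective.mp hu)

lemma IsFreeGenerator.eq_of_smul_eq {U V : X.Opens} {e : Γ(L, U)} (he : IsFreeGenerator e)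
    (h : V ≤ U) {a b : Γ(X, V)} (hab : a • EquivariantJouanolou.res h e = b • EquivariantJouanolou.res h e) : a = b :=
  (he V h).1 hab

lemma IsFreeGenerator.exists_smul_eq {U : X.Opens} {e : Γ(L, U)} (he : IsFreeGenerator e)
    (x : Γ(L, U)) : ∃ a : Γ(X, U), a • e = x := by
  obtain ⟨a, ha⟩ := (he U le_rfl).2 x
  exact ⟨a, by simpa only [res_self] using ha⟩

/-- Two free generators differ by a unit, so `s` generates exactly where its coordinate with respect
to `e` is invertible. -/
lemma nonvanishingLocus_inf {U : X.Opens} {e : Γ(L, U)} (he : IsFreeGenerator e) (s : Γ(L, ⊤))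
    {a : Γ(X, U)} (ha : a • e = res le_top s) : nonvanishingLocus s ⊓ U = X.basicOpen a := by
  apply le_antisymm
  · rintro x ⟨hx, hxU⟩
    obtain ⟨V, hV, hxV⟩ := TopologicalSpace.Opens.mem_sSup.mp hx
    obtain ⟨c, hc⟩ := (hV.res (inf_le_left : V ⊓ U ≤ V)).exists_smul_eq (res inf_le_right e)
    have h1 : c * rs (inf_le_right : V ⊓ U ≤ U) a = 1 := by
      apply he.eq_of_smul_eq (inf_le_right : V ⊓ U ≤ U)
      rw [mul_smul, ← res_smul, ha, one_smul, ← hc, res_res, res_res]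
    have h2 : IsUnit (rs (inf_le_right : V ⊓ U ≤ U) a) := IsUnit.of_mul_eq_one_right c h1
    have h3 := X.basicOpen_of_isUnit h2
    rw [basicOpen_rs] at h3
    exact (h3.ge ⟨hxV, hxU⟩).2
  · refine le_inf (le_sSup ?_) (X.basicOpen_le a)
    have h1 : IsUnit (rs (X.basicOpen_le a) a) := RingedSpace.isUnit_res_basicOpen _ a
    have h2 := (he.res (X.basicOpen_le a)).smul h1
    rwa [← res_smul, ha, res_res] at h2

end LineBundle

/-- An ample family of line bundles yields cocycle data. -/
lemma HasAmpleFamily.exists_ampleCocycle {X : Scheme.{u}} (h : HasAmpleFamily X) :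
    ∃ (A I : Type u) (_ : Finite A) (_ : Finite I), Nonempty (AmpleCocycle X A I) := by
  obtain ⟨hX, ι, L, hL, H⟩ := h
  choose k s hmem haff using H
  have hfin {O : X → X.Opens} (hO : ∀ x, x ∈ O x) : ∃ S : Finset X, ⨆ x : S, O x.1 = ⊤ := by
    obtain ⟨S, hS⟩ := isCompact_univ.elim_finite_subcover (fun x => (O x : Set X))
      (fun x => (O x).isOpen) fun x _ => Set.mem_iUnion.mpr ⟨x, hO x⟩
    refine ⟨S, top_le_iff.mp fun x _ => ?_⟩
    obtain ⟨y, hy, hxy⟩ := Set.mem_iUnion₂.mp (hS (Set.mem_univ x))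
    exact TopologicalSpace.Opens.mem_iSup.mpr ⟨⟨y, hy⟩, hxy⟩
  obtain ⟨I, hI⟩ := hfin hmem
  have hloc (x : X) : ∃ U : X.Opens, x ∈ U ∧ IsAffineOpen U ∧
      ∀ i : I, ∃ e : Γ(L (k i), U), IsFreeGenerator e := by
    choose O hxO e he using fun i : I => hL (k i) x
    obtain ⟨_, ⟨U, hU, rfl⟩, hxU, hUO⟩ := X.isBasis_affineOpens.exists_subset_of_mem_open
      (Set.mem_iInter.mpr hxO) (isOpen_iInter_of_finite fun i => (O i).isOpen)
    exact ⟨U, hxU, hU, fun i => ⟨_, (he i).res fun y hy => Set.mem_iInter.mp (hUO hy) i⟩⟩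
  choose U hxU hU e he using hloc
  obtain ⟨A, hA⟩ := hfin hxU
  choose σ hσ using fun (i : I) (a : A) =>
    (he a i).exists_smul_eq (res (le_top : U a ≤ ⊤) (s i))
  -- `g i a b` expresses the generator over `U b` through the one over `U a`. The cocycle and
  -- section identities then follow by comparing coefficients of one generator.
  choose g hg using fun (i : I) (a b : A) =>
    ((he a i).res (inf_le_left : U a ⊓ U b ≤ _)).exists_smul_eq (res inf_le_right (e b i))
  refine ⟨A, I, inferInstance, inferInstance, ⟨{
    U a := U a
    isAffineOpen_U a := hU a
    iSup_U := hA
    s := σ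
    g := g
    g_self i a := ?_
    g_mul i a b c := ?_
    s_eq i a b := ?_
    D i := nonvanishingLocus (s i)
    isAffineOpen_D i := haff i
    iSup_D := hI
    D_inf i a := nonvanishingLocus_inf (he a i) (s i) (hσ i a) }⟩⟩
  · apply (he a i).eq_of_smul_eq (inf_le_left : U a ⊓ U a ≤ _)
    rw [hg, one_smul]
  · apply (he a i).eq_of_smul_eq (inf_le_left.trans inf_le_left : U a ⊓ U b ⊓ U c ≤ _)
    have h1 := congr(res (inf_le_left : U a ⊓ U b ⊓ U c ≤ U a ⊓ U b) $(hg i a b))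
    have h2 := congr(res (le_inf (inf_le_left.trans inf_le_right) inf_le_right :
      U a ⊓ U b ⊓ U c ≤ U b ⊓ U c) $(hg i b c))
    have h3 := congr(res (le_inf (inf_le_left.trans inf_le_left) inf_le_right :
      U a ⊓ U b ⊓ U c ≤ U a ⊓ U c) $(hg i a c))
    simp only [res_smul, res_res] at h1 h2 h3
    rw [mul_comm, mul_smul, h1, h2, h3]
  · apply (he a i).eq_of_smul_eq (inf_le_left : U a ⊓ U b ≤ _)
    rw [← res_smul, hσ, mul_comm, mul_smul, hg, ← res_smul, hσ, res_res, res_res]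

end
end EquivariantJouanolou

namespace EquivariantJouanolou
noncomputable section

/-! ### Regular local rings are domains -/

section RegularLocal

open IsLocalRing

/-- The class of `x` in the cotangent space is nonzero; lifts of a basis of the quotient by its line
generate together with `x`, by Nakayama. -/
theorem exists_generators_of_notMem_sq {R : Type u} [CommRing R] [IsLocalRing R]
    [IsNoetherianRing R] {x : R} (hx : x ∈ maximalIdeal R) (hx2 : x ∉ maximalIdeal R ^ 2) :
    ∃ (n : ℕ) (t : Fin n → R), n + 1 = (maximalIdeal R).spanFinrank ∧
      maximalIdeal R = Ideal.span (insert x (Set.range t)) := by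
  let V := CotangentSpace R
  let xb : V := (maximalIdeal R).toCotangent ⟨x, hx⟩
  have hxb : xb ≠ 0 := fun h => hx2 ((Ideal.toCotangent_eq_zero _ _).1 h)
  let Q := V ⧸ Submodule.span (ResidueField R) {xb}
  let b := Module.finBasis (ResidueField R) Q
  have hn : Module.finrank (ResidueField R) Q + 1 = (maximalIdeal R).spanFinrank := by
    rw [spanFinrank_maximalIdeal_eq_finrank_cotangentSpace,
      ← finrank_span_singleton (K := ResidueField R) hxb, Submodule.finrank_quotient_add_finrank]
  have ht (i) : ∃ t : maximalIdeal R,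
      Submodule.mkQ (Submodule.span (ResidueField R) {xb}) ((maximalIdeal R).toCotangent t) =
        b i := by
    obtain ⟨v, hv⟩ := Submodule.mkQ_surjective (Submodule.span (ResidueField R) {xb}) (b i)
    obtain ⟨t, ht⟩ := Ideal.toCotangent_surjective _ v
    exact ⟨t, by rw [← hv, ← ht]⟩
  choose t ht using ht
  refine ⟨_, fun i => (t i : R), hn, ?_⟩
  have key : Submodule.span R (insert ⟨x, hx⟩ (Set.range t)) = (⊤ : Submodule R (maximalIdeal R)) := by
    rw [← CotangentSpace.span_image_eq_top_iff, Set.image_insert_eq, Submodule.span_insert,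
      ← Set.range_comp]
    rw [← Submodule.map_mkQ_eq_top (p := Submodule.span (ResidueField R) {xb}), Submodule.map_span,
      ← Set.range_comp]
    have : Submodule.mkQ (Submodule.span (ResidueField R) {xb}) ∘
        ((maximalIdeal R).toCotangent ∘ t) = b := funext ht
    exact (congrArg (Submodule.span (ResidueField R)) (congrArg Set.range this)).trans b.span_eq
  have := congrArg (Submodule.map (Submodule.subtype _)) key
  rw [Submodule.map_span, Submodule.map_top, Submodule.range_subtype, Set.image_insert_eq,
    ← Set.range_comp] at this
  exact this.symm

/-- Modulo `x` the number of generators of the maximal ideal drops by one, while the dimension drops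
by at most one. As the dimension is bounded by the number of generators, both drop by exactly one.
-/
theorem isRegularLocalRing_quotient {R : Type u} [CommRing R] [IsRegularLocalRing R] {x : R}
    (hx : x ∈ maximalIdeal R) (hx2 : x ∉ maximalIdeal R ^ 2) :
    IsRegularLocalRing (R ⧸ Ideal.span {x}) ∧
      ringKrullDim (R ⧸ Ideal.span {x}) + 1 = ringKrullDim R := by
  obtain ⟨n, t, hn, hm⟩ := exists_generators_of_notMem_sq hx hx2
  have hne : Ideal.span {x} ≠ ⊤ :=
    fun h => (maximalIdeal.isMaximal R).ne_top (top_le_iff.1 (h ▸ (Ideal.span_singleton_le_iff_mem _).2 hx))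
  have : Nontrivial (R ⧸ Ideal.span {x}) := Ideal.Quotient.nontrivial_iff.2 hne
  have : IsLocalRing (R ⧸ Ideal.span {x}) :=
    .of_surjective' _ Ideal.Quotient.mk_surjective
  have hd : ringKrullDim R = (n + 1 : ℕ) := by
    rw [hn, IsRegularLocalRing.spanFinrank_maximalIdeal]
  have hmap : maximalIdeal (R ⧸ Ideal.span {x}) =
      Ideal.span (Set.range (Ideal.Quotient.mk (Ideal.span {x}) ∘ t)) := by
    have h1 : maximalIdeal (R ⧸ Ideal.span {x}) =
        (maximalIdeal R).map (Ideal.Quotient.mk (Ideal.span {x})) :=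
      (map_maximalIdeal_of_surjective _ Ideal.Quotient.mk_surjective).symm
    rw [h1, hm, Ideal.map_span, Set.image_insert_eq, ← Set.range_comp]
    have : Ideal.Quotient.mk (Ideal.span {x}) x = 0 :=
      Ideal.Quotient.eq_zero_iff_mem.2 (Ideal.mem_span_singleton_self x)
    rw [this, Ideal.span_insert_zero]
  have hle : (maximalIdeal (R ⧸ Ideal.span {x})).spanFinrank ≤ n := by
    rw [hmap]
    refine (Submodule.spanFinrank_span_le_ncard_of_finite (Set.finite_range _)).trans ?_
    rw [← Set.image_univ]
    refine (Set.ncard_image_le Set.finite_univ).trans ?_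
    simp [Set.ncard_univ]
  have hdim : ringKrullDim R ≤ ringKrullDim (R ⧸ Ideal.span {x}) + 1 := by
    have := ringKrullDim_le_ringKrullDim_quotient_add_encard {x} (R := R)
      (by simpa [ringJacobson_eq_maximalIdeal] using hx)
    simpa using this
  have hdim' : (n : WithBot ℕ∞) ≤ ringKrullDim (R ⧸ Ideal.span {x}) := by
    rw [hd] at hdim
    push_cast at hdim
    exact (ENat.WithBot.add_le_add_one_right_iff).1 hdim
  have hreg : IsRegularLocalRing (R ⧸ Ideal.span {x}) :=
    .of_spanFinrank_maximalIdeal_le _ ((Nat.cast_le.2 hle).trans hdim')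
  refine ⟨hreg, ?_⟩
  rw [hd, ← IsRegularLocalRing.spanFinrank_maximalIdeal,
    le_antisymm hle (by rw [← IsRegularLocalRing.spanFinrank_maximalIdeal] at hdim'; exact_mod_cast hdim')]
  rfl

/-- Prime avoidance, which tolerates the one non-prime ideal m²; m ⊆ m² would force m = 0 by
Nakayama. -/
theorem IsRegularLocalRing.exists_mem_notMem_sq {R : Type u} [CommRing R] [IsRegularLocalRing R]
    (h : ringKrullDim R ≠ 0) (S : Finset (Ideal R)) (hS : ∀ p ∈ S, p.IsPrime)
    (hS' : ∀ p ∈ S, p ≠ maximalIdeal R) :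
    ∃ x ∈ maximalIdeal R, x ∉ maximalIdeal R ^ 2 ∧ ∀ p ∈ S, x ∉ p := by
  classical
  by_contra! H
  have hsub : (maximalIdeal R : Set R) ⊆
      ⋃ p ∈ ((insert (maximalIdeal R ^ 2) S : Finset (Ideal R)) : Set (Ideal R)), (p : Set R) := by
    intro x hx
    simp only [Finset.coe_insert, Set.mem_insert_iff, Set.iUnion_iUnion_eq_or_left,
      Set.mem_union, Set.mem_iUnion, SetLike.mem_coe, exists_prop]
    by_cases h2 : x ∈ maximalIdeal R ^ 2
    · exact .inl h2
    · exact .inr (H x hx h2)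
  obtain ⟨p, hp, hle⟩ := (Ideal.subset_union_prime (f := id) (maximalIdeal R ^ 2)
    (maximalIdeal R ^ 2)
    (fun i hi h1 _ => hS i ((Finset.mem_insert.1 hi).resolve_left h1))).1 hsub
  rcases Finset.mem_insert.1 hp with rfl | hp
  · have : maximalIdeal R = ⊥ := by
      refine Submodule.eq_bot_of_le_smul_of_le_jacobson_bot (maximalIdeal R) _
        (IsNoetherian.noetherian _) ?_ (IsLocalRing.jacobson_eq_maximalIdeal _ bot_ne_top).ge
      rwa [smul_eq_mul, ← pow_two]
    refine h ?_
    rw [← IsRegularLocalRing.spanFinrank_maximalIdeal, this]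
    simp
  · have := hS p hp
    exact hS' p hp ((le_maximalIdeal this.ne_top).antisymm hle)

/-- Choose x in m outside m² and all minimal primes. By induction (x) is prime, so it contains a
minimal prime p. As x ∉ p, every element of p is x times an element of p, and Nakayama gives p = 0.
-/
theorem IsRegularLocalRing.isDomain_of_ringKrullDim_eq (n : ℕ) : ∀ {R : Type u} [CommRing R]
    [IsRegularLocalRing R], ringKrullDim R = n → IsDomain R := by
  induction n with
  | zero =>
    intro R _ _ h
    have hm : maximalIdeal R = ⊥ := by
      rw [← IsRegularLocalRing.spanFinrank_maximalIdeal] at h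
      have h0 : (maximalIdeal R).spanFinrank = 0 := by exact_mod_cast h
      exact (Submodule.spanFinrank_eq_zero_iff_eq_bot (IsNoetherian.noetherian _)).1 h0
    have : (⊥ : Ideal R).IsMaximal := hm ▸ maximalIdeal.isMaximal R
    have := this.isPrime
    exact IsDomain.of_bot_isPrime R
  | succ n ih =>
    intro R _ _ h
    have hne : ringKrullDim R ≠ 0 := by rw [h]; exact_mod_cast n.succ_ne_zero
    have hfin := minimalPrimes.finite_of_isNoetherianRing R
    obtain ⟨x, hx, hx2, hxp⟩ := IsRegularLocalRing.exists_mem_notMem_sq hne hfin.toFinset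
      (fun p hp => (hfin.mem_toFinset.1 hp).1.1) (fun p hp hpm => hne (by
        have := (hfin.mem_toFinset.1 hp).1.1
        rw [← maximalIdeal_height_eq_ringKrullDim, ← hpm,
          Ideal.height_eq_zero_iff.2 (hfin.mem_toFinset.1 hp)]
        rfl))
    obtain ⟨hreg, hdim⟩ := isRegularLocalRing_quotient hx hx2
    have hdim' : ringKrullDim (R ⧸ Ideal.span {x}) = n :=
      ENat.WithBot.add_one_cancel.1 (hdim.trans (h.trans (by push_cast; rfl)))
    have := ih hdim'
    have hprime : (Ideal.span {x}).IsPrime := (Ideal.Quotient.isDomain_iff_prime _).1 this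
    obtain ⟨p, hp, hpx⟩ := Ideal.exists_minimalPrimes_le (bot_le : ⊥ ≤ Ideal.span {x})
    have hxp' : x ∉ p := hxp p (hfin.mem_toFinset.2 hp)
    have hpp : p.IsPrime := hp.1.1
    have : p = ⊥ := by
      refine Submodule.eq_bot_of_le_smul_of_le_jacobson_bot (Ideal.span {x}) _
        (IsNoetherian.noetherian _) ?_ ?_
      · intro y hy
        obtain ⟨z, rfl⟩ := Ideal.mem_span_singleton'.1 (hpx hy)
        rw [mul_comm]
        exact Submodule.smul_mem_smul (Ideal.mem_span_singleton_self x)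
          ((hpp.mem_or_mem hy).resolve_right hxp')
      · rw [IsLocalRing.jacobson_eq_maximalIdeal _ bot_ne_top]
        exact (Ideal.span_singleton_le_iff_mem _).2 hx
    subst this
    exact IsDomain.of_bot_isPrime R

theorem IsRegularLocalRing.isDomain (R : Type u) [CommRing R] [IsRegularLocalRing R] :
    IsDomain R :=
  IsRegularLocalRing.isDomain_of_ringKrullDim_eq _
    (IsRegularLocalRing.spanFinrank_maximalIdeal (R := R)).symm

end RegularLocal

/-! ### Finite free resolutions over regular local rings -/

section Resolution

open IsLocalRing Pointwise

/-- Every chain of `n` syzygies of `M` (with respect to finite free covers) ends in a free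
module. -/
def HasFreeSyzygy (R : Type u) [CommRing R] :
    ℕ → ∀ (M : Type u) [AddCommGroup M] [Module R M], Prop
  | 0, M, _, _ => Module.Free R M
  | n + 1, M, _, _ => ∀ (F : Type u) [AddCommGroup F] [Module R F] [Module.Free R F]
      [Module.Finite R F] (f : F →ₗ[R] M), Function.Surjective f →
        HasFreeSyzygy R n (LinearMap.ker f)

theorem HasFreeSyzygy.of_equiv {R : Type u} [CommRing R] {n : ℕ} {M N : Type u} [AddCommGroup M]
    [Module R M] [AddCommGroup N] [Module R N] (e : M ≃ₗ[R] N) (h : HasFreeSyzygy R n M) :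
    HasFreeSyzygy R n N := by
  cases n with
  | zero =>
    have : Module.Free R M := h
    exact Module.Free.of_equiv e
  | succ n =>
    intro F _ _ _ _ f hf
    have := h F (e.symm.toLinearMap ∘ₗ f) (e.symm.surjective.comp hf)
    rwa [LinearMap.ker_comp, LinearEquiv.ker, Submodule.comap_bot] at this

/-- As `x` is regular on `M`, a sequence 0 → K → F → M → 0 stays exact modulo `x`, so syzygies over
R reduce to syzygies over R/x. The kernel sits in a free module over a domain, so `x` is regular on
it too, and at the end a module on which `x` is regular is free if it is free modulo `x`. -/
theorem HasFreeSyzygy.of_quotSMulTop {R : Type u} [CommRing R] [IsLocalRing R]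
    [IsNoetherianRing R] [IsDomain R] {x : R} (hx : x ∈ maximalIdeal R) (hx0 : x ≠ 0) (n : ℕ) :
    ∀ (M : Type u) [AddCommGroup M] [Module R M] [Module.Finite R M], IsSMulRegular M x →
      HasFreeSyzygy (R ⧸ Ideal.span {x}) n (QuotSMulTop x M) → HasFreeSyzygy R n M := by
  induction n with
  | zero =>
    intro M _ _ _ hreg h
    have := Module.finitePresentation_of_finite R M
    refine (Module.free_quotSMulTop_iff_free R M ?_ hreg).1 h
    rwa [IsLocalRing.jacobson_eq_maximalIdeal (⊥ : Ideal R) bot_ne_top]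
  | succ n ih =>
    intro M _ _ _ hreg h F _ _ _ _ f hf
    have hregF : IsSMulRegular F x :=
      Module.Flat.isSMulRegular_of_nonZeroDivisors (mem_nonZeroDivisors_of_ne_zero hx0)
    refine ih (LinearMap.ker f) (hregF.submodule _ _) ?_
    have hs : Function.Surjective (algebraMap R (R ⧸ Ideal.span {x})) := Ideal.Quotient.mk_surjective
    let f' := (QuotSMulTop.map x f).extendScalarsOfSurjective hs
    let g' := (QuotSMulTop.map x (LinearMap.ker f).subtype).extendScalarsOfSurjective hs
    have : Module.Finite (R ⧸ Ideal.span {x}) (QuotSMulTop x F) :=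
      Module.Finite.of_restrictScalars_finite R _ _
    have hker := h (QuotSMulTop x F) f' (QuotSMulTop.map_surjective x hf)
    have hex : Function.Exact (LinearMap.ker f).subtype f := LinearMap.exact_subtype_ker_map f
    have hg' : Function.Injective g' := by
      have h0 : Function.Exact (0 : PUnit.{u+1} →ₗ[R] LinearMap.ker f) (LinearMap.ker f).subtype :=
        (LinearMap.exact_zero_iff_injective _ _).2 (Submodule.injective_subtype _)
      have := QuotSMulTop.map_first_exact_on_four_term_exact_of_isSMulRegular_last h0 hex hreg
      rw [map_zero] at this
      exact (LinearMap.exact_zero_iff_injective _ _).1 this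
    have hex' : LinearMap.ker f' = LinearMap.range g' :=
      LinearMap.exact_iff.1 (QuotSMulTop.map_exact x hex hf : Function.Exact g' f')
    exact hker.of_equiv ((LinearEquiv.ofInjective g' hg').trans (LinearEquiv.ofEq _ _ hex'.symm)).symm

/-- The step in n spends one syzygy: `M` may have torsion, but the kernel lies in a free module, so
`x` is regular on it and induction over the regular ring R/x applies. -/
theorem IsRegularLocalRing.hasFreeSyzygy (n : ℕ) : ∀ {R : Type u} [CommRing R]
    [IsRegularLocalRing R], ringKrullDim R = n → ∀ (M : Type u) [AddCommGroup M] [Module R M]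
    [Module.Finite R M], HasFreeSyzygy R n M := by
  induction n with
  | zero =>
    intro R _ _ h M _ _ _
    have hm : maximalIdeal R = ⊥ := by
      rw [← IsRegularLocalRing.spanFinrank_maximalIdeal] at h
      have h0 : (maximalIdeal R).spanFinrank = 0 := by exact_mod_cast h
      exact (Submodule.spanFinrank_eq_zero_iff_eq_bot (IsNoetherian.noetherian _)).1 h0
    let _ : Field R := ((isField_iff_maximalIdeal_eq).2 hm).toField
    exact Module.Free.of_divisionRing R M
  | succ n ih =>
    intro R _ _ h M _ _ _ F _ _ _ _ f hf
    have := IsRegularLocalRing.isDomain R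
    have hne : ringKrullDim R ≠ 0 := by rw [h]; exact_mod_cast n.succ_ne_zero
    obtain ⟨x, hx, hx2, -⟩ := IsRegularLocalRing.exists_mem_notMem_sq hne ∅ (by simp) (by simp)
    obtain ⟨hreg, hdim⟩ := isRegularLocalRing_quotient hx hx2
    have hdim' : ringKrullDim (R ⧸ Ideal.span {x}) = n :=
      ENat.WithBot.add_one_cancel.1 (hdim.trans (h.trans (by push_cast; rfl)))
    have hx0 : x ≠ 0 := by
      rintro rfl
      exact hx2 (zero_mem _)
    have hregF : IsSMulRegular F x :=
      Module.Flat.isSMulRegular_of_nonZeroDivisors (mem_nonZeroDivisors_of_ne_zero hx0)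
    have : Module.Finite (R ⧸ Ideal.span {x}) (QuotSMulTop x (LinearMap.ker f)) :=
      Module.Finite.of_restrictScalars_finite R _ _
    exact HasFreeSyzygy.of_quotSMulTop hx hx0 n _ (hregF.submodule _ _) (ih hdim' _)

end Resolution
end
end EquivariantJouanolou

namespace EquivariantJouanolou
noncomputable section

/-! ### Regular local rings are factorial -/

section Factorial

open IsLocalRing

instance isRegularRing_localization {R : Type u} [CommRing R] [IsRegularRing R] (S : Submonoid R) :
    IsRegularRing (Localization S) := by
  have : IsNoetherianRing (Localization S) := IsLocalization.isNoetherianRing S _ inferInstance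
  refine isRegularRing_iff.2 fun p _ => ?_
  have := IsLocalization.isLocalization_isLocalization_atPrime_isLocalization S
    (Localization.AtPrime p) p
  exact IsRegularLocalRing.of_ringEquiv (IsLocalization.algEquiv
    (p.comap (algebraMap R (Localization S))).primeCompl
    (Localization.AtPrime (p.comap (algebraMap R (Localization S))))
    (Localization.AtPrime p)).toRingEquiv

/-- Once the localization of `M` is projective, the localized sequence of the first syzygy splits.
The syzygy becomes projective as well, is stably free by induction, and is a complement of the
localized `M` in a free module. -/
theorem HasFreeSyzygy.isStablyFree_localizedModule {R : Type u} [CommRing R] [IsNoetherianRing R]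
    (S : Submonoid R) (n : ℕ) : ∀ (M : Type u) [AddCommGroup M] [Module R M] [Module.Finite R M],
      HasFreeSyzygy R n M → Module.Projective (Localization S) (LocalizedModule S M) →
        Module.IsStablyFree (Localization S) (LocalizedModule S M) := by
  induction n with
  | zero =>
    intro M _ _ _ h _
    have : Module.Free R M := h
    have := Module.free_of_isLocalizedModule (Rₛ := Localization S) S
      (LocalizedModule.mkLinearMap S M)
    infer_instance
  | succ n ih =>
    intro M _ _ _ h hproj
    obtain ⟨m, f, hf⟩ := Module.Finite.exists_fin' R M
    have hK := h (Fin m → R) f hf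
    let K := LinearMap.ker f
    let g' := IsLocalizedModule.mapExtendScalars S (LocalizedModule.mkLinearMap S K)
      (LocalizedModule.mkLinearMap S (Fin m → R)) (Localization S) K.subtype
    let f' := IsLocalizedModule.mapExtendScalars S (LocalizedModule.mkLinearMap S (Fin m → R))
      (LocalizedModule.mkLinearMap S M) (Localization S) f
    have hg' : Function.Injective g' := IsLocalizedModule.map_injective S
      (LocalizedModule.mkLinearMap S K) (LocalizedModule.mkLinearMap S (Fin m → R)) _
      (Submodule.injective_subtype _)
    have hf' : Function.Surjective f' := IsLocalizedModule.map_surjective S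
      (LocalizedModule.mkLinearMap S (Fin m → R)) (LocalizedModule.mkLinearMap S M) _ hf
    have hex : Function.Exact g' f' := IsLocalizedModule.map_exact S
      (LocalizedModule.mkLinearMap S K) (LocalizedModule.mkLinearMap S (Fin m → R))
      (LocalizedModule.mkLinearMap S M) _ _ (LinearMap.exact_subtype_ker_map f)
    obtain ⟨l, hl⟩ := Module.projective_lifting_property f' LinearMap.id hf'
    obtain ⟨e, -⟩ := Function.Exact.splitSurjectiveEquiv (R := Localization S)
      (M := LocalizedModule S K) (N := LocalizedModule S (Fin m → R)) (P := LocalizedModule S M)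
      (f := g') (g := f') hex hg' ⟨l, hl⟩
    have hfree : Module.Free (Localization S) (LocalizedModule S (Fin m → R)) :=
      Module.free_of_isLocalizedModule (Rₛ := Localization S) S
        (LocalizedModule.mkLinearMap S (Fin m → R))
    have hKfin : Module.Finite (Localization S) (LocalizedModule S K) :=
      Module.Finite.of_isLocalizedModule S (LocalizedModule.mkLinearMap S K)
    have hKproj : Module.Projective (Localization S) (LocalizedModule S K) :=
      .of_split (e.symm.toLinearMap ∘ₗ LinearMap.inl _ _ _) (LinearMap.fst _ _ _ ∘ₗ e.toLinearMap)
        (by ext; simp)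
    have := ih K hK hKproj
    obtain ⟨N, _, _, _, _, _⟩ := Module.IsStablyFree.exist_free_prod (Localization S)
      (LocalizedModule S K)
    -- Here K × N and N are free. Regrouping (K × M) × N, which is free, shows that M has the free
    -- complement K × N.
    have : Module.Free (Localization S) ((LocalizedModule S K × N) × LocalizedModule S M) :=
      .of_equiv ((e.prodCongr (LinearEquiv.refl _ N)).trans
        ((LinearEquiv.prodAssoc _ _ _ _).trans
          (((LinearEquiv.refl _ _).prodCongr (LinearEquiv.prodComm _ _ _)).trans
            (LinearEquiv.prodAssoc _ _ _ _).symm)))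
    exact Module.IsStablyFree.of_free_prod' _ _ (LocalizedModule S K × N)

/-- The hypothesis says that `J` is principal at every maximal ideal m, generated by `a`. Then s / a
lies in J⁻¹, so s = a · (s / a) is an element of J J⁻¹ outside m; hence J J⁻¹ = 1. -/
theorem invertible_of_locally_dvd {A : Type u} [CommRing A] [IsDomain A]
    (K : Type u) [Field K] [Algebra A K] [IsFractionRing A K] {J : Ideal A}
    (hJ : J ≠ ⊥) (h : ∀ m : Ideal A, m.IsMaximal → ∃ a ∈ J, ∃ s ∉ m, ∀ b ∈ J, a ∣ s * b) :
    Module.Invertible A J := by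
  let I : Submodule A K := Submodule.map (Algebra.linearMap A K) J
  have hinj : Function.Injective (Algebra.linearMap A K) := IsFractionRing.injective A K
  have hI : I * (1 / I) = 1 := by
    refine Submodule.mul_one_div_le_one.antisymm ?_
    by_contra hne
    let c : Ideal A := (I * (1 / I)).comap (Algebra.linearMap A K)
    have hc : c ≠ ⊤ := fun hc => hne (Submodule.one_le.2 (by
      have : (1 : A) ∈ c := hc ▸ trivial
      simpa [c] using this))
    obtain ⟨m, hm, hcm⟩ := Ideal.exists_le_maximal c hc
    obtain ⟨a, ha, s, hs, hdvd⟩ := h m hm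
    have ha0 : algebraMap A K a ≠ 0 := by
      rw [Ne, FaithfulSMul.algebraMap_eq_zero_iff]
      rintro rfl
      obtain ⟨b, hb, hb0⟩ := Submodule.exists_mem_ne_zero_of_ne_bot hJ
      have := zero_dvd_iff.1 (hdvd b hb)
      exact hs ((mul_eq_zero.1 this).resolve_right hb0 ▸ zero_mem m)
    refine hs (hcm ?_)
    change algebraMap A K s ∈ I * (1 / I)
    have : algebraMap A K s = algebraMap A K a * (algebraMap A K s / algebraMap A K a) := (mul_div_cancel₀ _ ha0).symm
    rw [this]
    refine Submodule.mul_mem_mul (Submodule.mem_map_of_mem ha) ?_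
    rw [Submodule.mem_div_iff_forall_mul_mem]
    rintro _ ⟨b, hb, rfl⟩
    obtain ⟨c, hc⟩ := hdvd b hb
    refine Submodule.mem_one.2 ⟨c, ?_⟩
    have := congrArg (algebraMap A K) hc
    simp only [map_mul] at this
    simp only [Algebra.linearMap_apply]
    field_simp
    rw [this, mul_comm]
  have : FaithfulSMul A K := (faithfulSMul_iff_algebraMap_injective A K).2 hinj
  let Iu : (Submodule A K)ˣ := ⟨I, 1 / I, hI, mul_comm I _ ▸ hI⟩
  have : Module.Invertible A (Iu : Submodule A K) := .left (Submodule.tensorInvEquiv Iu)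
  exact Module.Invertible.congr (R := A) (M := I) (Submodule.equivMapOfInjective _ hinj J).symm

/-- In the factorial ring R_q some prime factor π of `c` lies in the extension of `P`, and by
minimality `P` is the contraction of (π). The conclusion is principality of P_q with denominators
cleared; if P ⊄ q, any element of `P` outside `q` will do. -/
theorem exists_forall_dvd_of_mem_minimalPrimes {R : Type u} [CommRing R] [IsDomain R]
    [IsNoetherianRing R] {P : Ideal R} {c : R} (hc : c ≠ 0)
    (hP : P ∈ (Ideal.span {c}).minimalPrimes) (q : Ideal R) [q.IsPrime]
    [UniqueFactorizationMonoid (Localization.AtPrime q)] :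
    ∃ a ∈ P, ∃ s ∉ q, ∀ b ∈ P, a ∣ s * b := by
  by_cases hPq : P ≤ q
  swap
  · obtain ⟨a, ha, haq⟩ := SetLike.not_le_iff_exists.1 hPq
    exact ⟨a, ha, a, haq, fun b _ => dvd_mul_right a b⟩
  let A := Localization.AtPrime q
  have hPp : P.IsPrime := hP.1.1
  have hcP : c ∈ P := hP.1.2 (Ideal.mem_span_singleton_self c)
  have hinj : Function.Injective (algebraMap R A) :=
    IsLocalization.injective A q.primeCompl_le_nonZeroDivisors
  have hdisj : Disjoint (q.primeCompl : Set R) (P : Set R) :=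
    Set.disjoint_left.2 fun z hz hzP => hz (hPq hzP)
  have hPA : (P.map (algebraMap R A)).IsPrime :=
    IsLocalization.isPrime_of_isPrime_disjoint q.primeCompl A P hPp hdisj
  have hcomap : (P.map (algebraMap R A)).comap (algebraMap R A) = P :=
    IsLocalization.under_map_of_isPrime_disjoint q.primeCompl A hPp hdisj
  have hc' : algebraMap R A c ≠ 0 := (map_ne_zero_iff _ hinj).2 hc
  obtain ⟨F, hF, hprod⟩ := UniqueFactorizationMonoid.exists_prime_factors _ hc'
  have hmem : F.prod ∈ P.map (algebraMap R A) :=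
    (Ideal.mem_iff_of_associated hprod).2 (Ideal.mem_map_of_mem _ hcP)
  obtain ⟨π, hπF, hπ⟩ := (hPA.multiset_prod_mem_iff_exists_mem F).1 hmem
  have hπc : π ∣ algebraMap R A c := (Multiset.dvd_prod hπF).trans hprod.dvd
  have hπp : (Ideal.span {π}).IsPrime :=
    (Ideal.span_singleton_prime (hF π hπF).ne_zero).2 (hF π hπF)
  -- The contraction of (π) is a prime that contains `c` and lies in `P`.
  have hle : P ≤ (Ideal.span {π}).comap (algebraMap R A) := by
    refine hP.2 ⟨hπp.comap _, ?_⟩ ?_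
    · rw [Ideal.span_singleton_le_iff_mem]
      exact Ideal.mem_span_singleton.2 hπc
    · rw [← hcomap]
      exact Ideal.comap_mono ((Ideal.span_singleton_le_iff_mem _).2 hπ)
  obtain ⟨⟨a, t⟩, hat⟩ := IsLocalization.surj q.primeCompl π
  have ht : IsUnit (algebraMap R A t) := IsLocalization.map_units A t
  have haP : a ∈ P := by
    rw [← hcomap]
    change algebraMap R A a ∈ P.map (algebraMap R A)
    rw [← hat]
    exact Ideal.mul_mem_right _ _ hπ
  have hdvd (b : R) (hb : b ∈ P) : ∃ s ∉ q, a ∣ s * b := by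
    have h1 : π ∣ algebraMap R A b := Ideal.mem_span_singleton.1 (hle hb)
    have h2 : algebraMap R A a ∣ algebraMap R A b := by
      rw [← hat]
      exact ht.mul_right_dvd.2 h1
    obtain ⟨d, hd⟩ := h2
    obtain ⟨⟨d', s⟩, hds⟩ := IsLocalization.surj q.primeCompl d
    refine ⟨s, s.2, d', hinj ?_⟩
    rw [map_mul, map_mul, hd, ← hds]
    ring
  choose! s hs hsd using hdvd
  obtain ⟨T, hT⟩ : P.FG := IsNoetherian.noetherian P
  refine ⟨a, haP, ∏ b ∈ T, s b, ?_, fun b hb => ?_⟩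
  · rw [Ideal.IsPrime.prod_mem_iff]
    rintro ⟨b, hb, hbq⟩
    exact hs b (hT ▸ Ideal.subset_span hb) hbq
  · rw [← hT] at hb
    induction hb using Submodule.span_induction with
    | mem b hb =>
      exact (hsd b (hT ▸ Ideal.subset_span hb)).trans
        (mul_dvd_mul_right (Finset.dvd_prod_of_mem s hb) b)
    | zero => simp
    | add b b' _ _ h h' => rw [mul_add]; exact dvd_add h h'
    | smul r b _ h => rw [smul_eq_mul, mul_left_comm]; exact h.mul_left r

/-- Nagata's descent. After inverting `x` the ideal becomes invertible; a finite free resolution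
over R makes it stably free, hence free of rank one, hence principal. A generator in `P` not
divisible by the prime `x` already generates `P` over R. -/
theorem isPrincipal_of_locally_dvd {R : Type u} [CommRing R] [IsRegularLocalRing R] [IsDomain R]
    {P : Ideal R} [P.IsPrime] (hP : P ≠ ⊥) {x : R} (hx : Prime x) (hxP : x ∉ P)
    (h : ∀ q : Ideal R, q.IsPrime → x ∉ q → ∃ a ∈ P, ∃ s ∉ q, ∀ b ∈ P, a ∣ s * b) :
    ∃ b, P = Ideal.span {b} := by
  let S := Submonoid.powers x
  let A := Localization S
  have hS : S ≤ nonZeroDivisors R := powers_le_nonZeroDivisors_of_noZeroDivisors hx.ne_zero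
  have hinj : Function.Injective (algebraMap R A) := IsLocalization.injective A hS
  have hdom : IsDomain A := IsLocalization.isDomain_of_le_nonZeroDivisors A hS
  have hxu (n : ℕ) : IsUnit (algebraMap R A (x ^ n)) :=
    IsLocalization.map_units A (⟨x ^ n, n, rfl⟩ : S)
  let J := P.map (algebraMap R A)
  have hJ : J ≠ ⊥ := by
    rw [Ne, Ideal.map_eq_bot_iff_of_injective hinj]
    exact hP
  have hsurj (y : A) (hy : y ∈ J) : ∃ b ∈ P, ∃ n : ℕ, y * algebraMap R A (x ^ n) = algebraMap R A b := by
    obtain ⟨⟨b, ⟨_, n, rfl⟩⟩, hb⟩ := (IsLocalization.mem_map_algebraMap_iff S A).1 hy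
    exact ⟨b, b.2, n, hb⟩
  have hinv : Module.Invertible A J := by
    refine invertible_of_locally_dvd (FractionRing A) hJ fun m hm => ?_
    have hxm : x ∉ m.comap (algebraMap R A) := fun hxm =>
      hm.ne_top (Ideal.eq_top_of_isUnit_mem _ hxm (by simpa using hxu 1))
    obtain ⟨a, ha, s, hs, hd⟩ := h (m.comap (algebraMap R A)) (hm.isPrime.comap _) hxm
    refine ⟨algebraMap R A a, Ideal.mem_map_of_mem _ ha, algebraMap R A s, hs, fun y hy => ?_⟩
    obtain ⟨b, hb, n, hy⟩ := hsurj y hy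
    rw [← (hxu n).dvd_mul_right, mul_assoc, hy, ← map_mul]
    exact map_dvd _ (hd b hb)
  let e : LocalizedModule S P ≃ₗ[A] J :=
    (IsLocalizedModule.iso S (Algebra.idealMap A P)).extendScalarsOfIsLocalization S A
  have hinv' : Module.Invertible A (LocalizedModule S P) := .congr e.symm
  have := HasFreeSyzygy.isStablyFree_localizedModule S _ P
    (IsRegularLocalRing.hasFreeSyzygy _ (IsRegularLocalRing.spanFinrank_maximalIdeal (R := R)).symm P)
    inferInstance
  have hfree := Module.free_of_isStablyFree_of_invertible A (LocalizedModule S P)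
  obtain ⟨e'⟩ := Module.Invertible.free_iff_linearEquiv.1 hfree
  let y : J := e (e'.symm 1)
  have hy (z : A) (hz : z ∈ J) : (y : A) ∣ z := by
    refine ⟨e' (e.symm ⟨z, hz⟩), ?_⟩
    have : (⟨z, hz⟩ : J) = e' (e.symm ⟨z, hz⟩) • y := by
      rw [← map_smul, ← map_smul, smul_eq_mul, mul_one, LinearEquiv.symm_apply_apply,
        LinearEquiv.apply_symm_apply]
    rw [mul_comm]
    exact congrArg Subtype.val this
  obtain ⟨b₀, hb₀, n₀, hyb⟩ := hsurj y y.2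
  have hb₀0 : b₀ ≠ 0 := by
    rintro rfl
    rw [map_zero, (hxu n₀).mul_left_eq_zero] at hyb
    refine hJ ((Submodule.eq_bot_iff _).2 fun z hz => ?_)
    exact zero_dvd_iff.1 (hyb ▸ hy z hz)
  -- Removing the powers of `x` keeps the element in `P`, since `x ∉ P`, and changes it only by a
  -- unit of `A`.
  obtain ⟨b, hb, hxb⟩ := (FiniteMultiplicity.of_prime_left hx hb₀0).exists_eq_pow_mul_and_not_dvd
  have hbP : b ∈ P := by
    rw [hb] at hb₀
    exact (‹P.IsPrime›.mem_or_mem hb₀).resolve_left fun h' => hxP (‹P.IsPrime›.mem_of_pow_mem _ h')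
  refine ⟨b, le_antisymm (fun p hp => ?_) ((Ideal.span_singleton_le_iff_mem _).2 hbP)⟩
  have h1 : algebraMap R A b ∣ algebraMap R A p := by
    refine dvd_trans ?_ (hy _ (Ideal.mem_map_of_mem _ hp))
    rw [← (hxu n₀).dvd_mul_right, hyb, hb, map_mul]
    exact dvd_mul_left _ _
  obtain ⟨d, hd⟩ := h1
  obtain ⟨⟨d', ⟨_, n, rfl⟩⟩, hds⟩ := IsLocalization.surj S d
  have h2 : x ^ n * p = b * d' := hinj (by
    rw [map_mul, map_mul, hd, ← hds]
    ring)
  obtain ⟨d'', rfl⟩ := hx.pow_dvd_of_dvd_mul_left n hxb (Dvd.intro _ h2)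
  refine Ideal.mem_span_singleton.2 ⟨d'', mul_left_cancel₀ (pow_ne_zero n hx.ne_zero) ?_⟩
  rw [h2]
  ring

-- By Kaplansky's criterion every nonzero prime Q has to contain a prime element. An x in m outside
-- m² is prime, because R/x is a regular local ring and so a domain. If x ∉ Q, a prime P ⊆ Q minimal
-- over a nonzero element is principal: a prime q without x is strictly smaller than m, so R_q has
-- smaller dimension and is factorial by induction.
set_option linter.overlappingInstances false in
theorem IsRegularRing.uniqueFactorizationMonoid_of_ringKrullDim_eq (n : ℕ) : ∀ {R : Type u}
    [CommRing R] [IsLocalRing R] [IsRegularRing R] [IsDomain R], ringKrullDim R = n →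
      UniqueFactorizationMonoid R := by
  induction n using Nat.strong_induction_on with
  | _ n ih =>
    intro R _ _ _ _ hn
    have hreg := IsRegularLocalRing.of_isRegularRing_of_isLocalRing R
    by_cases h0 : ringKrullDim R = 0
    · have : Ring.KrullDimLE 0 R := by
        rw [Ring.krullDimLE_iff, h0]; rfl
      have : IsField R := Ring.KrullDimLE.isField_of_isDomain
      let _ := this.toField
      infer_instance
    obtain ⟨x, hx, hx2, -⟩ := IsRegularLocalRing.exists_mem_notMem_sq h0 ∅ (by simp) (by simp)
    have hx0 : x ≠ 0 := by
      rintro rfl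
      exact hx2 (zero_mem _)
    have hxp : Prime x := by
      obtain ⟨hreg', -⟩ := isRegularLocalRing_quotient hx hx2
      have := IsRegularLocalRing.isDomain (R ⧸ Ideal.span {x})
      exact (Ideal.span_singleton_prime hx0).1 ((Ideal.Quotient.isDomain_iff_prime _).1 this)
    rw [UniqueFactorizationMonoid.iff_exists_prime_mem_of_isPrime]
    intro Q hQ hQp
    by_cases hxQ : x ∈ Q
    · exact ⟨x, hxQ, hxp⟩
    obtain ⟨c, hcQ, hc0⟩ := Submodule.exists_mem_ne_zero_of_ne_bot hQ
    obtain ⟨P, hP, hPQ⟩ := Ideal.exists_minimalPrimes_le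
      ((Ideal.span_singleton_le_iff_mem _).2 hcQ : Ideal.span {c} ≤ Q)
    have hPp : P.IsPrime := hP.1.1
    have hcP : c ∈ P := hP.1.2 (Ideal.mem_span_singleton_self c)
    have hP0 : P ≠ ⊥ := fun h => hc0 (by simpa [h] using hcP)
    obtain ⟨b, hb⟩ := isPrincipal_of_locally_dvd hP0 hxp (fun h => hxQ (hPQ h)) fun q hq hxq => by
      have hlt : q < maximalIdeal R :=
        lt_of_le_of_ne (le_maximalIdeal hq.ne_top) fun h => hxq (h ▸ hx)
      have h1 : q.height < n := by
        have := Ideal.height_strict_mono_of_isPrime_of_isPrime hlt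
        have h2 : ((maximalIdeal R).height : WithBot ℕ∞) = n := by
          rw [maximalIdeal_height_eq_ringKrullDim, hn]
        have h3 : (maximalIdeal R).height = n := by exact_mod_cast h2
        rwa [h3] at this
      obtain ⟨k, hk⟩ := ENat.ne_top_iff_exists.1 (ne_top_of_lt h1)
      rw [← hk] at h1
      have h4 : ringKrullDim (Localization.AtPrime q) = k := by
        rw [IsLocalization.AtPrime.ringKrullDim_eq_height q, ← hk]
        rfl
      have : IsDomain (Localization.AtPrime q) :=
        IsLocalization.isDomain_of_le_nonZeroDivisors _ q.primeCompl_le_nonZeroDivisors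
      have := ih k (by exact_mod_cast h1) h4
      exact exists_forall_dvd_of_mem_minimalPrimes hc0 hP q
    refine ⟨b, hPQ (hb ▸ Ideal.mem_span_singleton_self b), ?_⟩
    have hb0 : b ≠ 0 := by
      rintro rfl
      exact hP0 (by simpa using hb)
    exact (Ideal.span_singleton_prime hb0).1 (hb ▸ hPp)

/-- The Auslander–Buchsbaum theorem, for local rings all of whose localizations are regular. -/
theorem IsRegularRing.uniqueFactorizationMonoid (R : Type u) [CommRing R] [IsLocalRing R]
    [IsRegularRing R] [IsDomain R] : UniqueFactorizationMonoid R :=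
  have := IsRegularLocalRing.of_isRegularRing_of_isLocalRing R
  IsRegularRing.uniqueFactorizationMonoid_of_ringKrullDim_eq _
    (IsRegularLocalRing.spanFinrank_maximalIdeal (R := R)).symm

end Factorial
end
end EquivariantJouanolou

namespace EquivariantJouanolou
noncomputable section

/-! ### Smooth schemes over regular schemes are regular -/

section Smooth

open IsLocalRing

/-- Going down for flat algebras lifts a chain of primes ending in `q.under A` to a chain ending in
`q`. -/
theorem height_under_le_height {A B : Type u} [CommRing A] [IsNoetherianRing A] [CommRing B]
    [Algebra A B] [Module.Flat A B] (q : Ideal B) [q.IsPrime] :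
    (q.under A).height ≤ q.height := by
  obtain ⟨l, hl, hlen⟩ := (q.under A).exists_ltSeries_length_eq_height
  have : q.LiesOver l.last.asIdeal := ⟨by rw [hl]⟩
  obtain ⟨L, hL, hLq, -⟩ := Ideal.exists_ltSeries_of_hasGoingDown l q
  rw [← hlen, ← hL]
  have key (n : ℕ) (hn : n < L.length + 1) : (n : ℕ∞) ≤ (L ⟨n, hn⟩).asIdeal.height := by
    induction n with
    | zero => simp
    | succ n ih =>
      have hlt : (L ⟨n, by omega⟩).asIdeal < (L ⟨n + 1, hn⟩).asIdeal :=
        L.strictMono (Fin.mk_lt_mk.2 n.lt_succ_self)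
      push_cast
      exact (add_le_add_left (ih (by omega)) 1).trans (Ideal.height_add_one_le_of_lt_of_isPrime hlt)
  have := key L.length (Nat.lt_succ_self _)
  rwa [show L ⟨L.length, Nat.lt_succ_self _⟩ = ⟨q, inferInstance⟩ from hLq] at this

/-- Unramifiedness makes the maximal ideal at p generate the one at q. So the latter needs at most
ht p generators, and ht p ≤ ht q by flatness. -/
theorem isRegularRing_of_etale (A B : Type u) [CommRing A] [IsRegularRing A] [CommRing B]
    [Algebra A B] [Algebra.Etale A B] : IsRegularRing B := by
  have : IsNoetherianRing B := Algebra.FiniteType.isNoetherianRing A B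
  refine isRegularRing_iff.2 fun q _ => ?_
  let p := q.under A
  let _ := Localization.AtPrime.algebraOfLiesOver p q
  have hmax := ((Algebra.isUnramifiedAt_iff_map_eq A p q).1 inferInstance).2
  have hmap : (maximalIdeal (Localization.AtPrime p)).map (algebraMap _ (Localization.AtPrime q)) =
      maximalIdeal (Localization.AtPrime q) := by
    rw [← hmax, ← Localization.AtPrime.map_eq_maximalIdeal, Ideal.map_map,
      ← IsScalarTower.algebraMap_eq]
  refine .of_spanFinrank_maximalIdeal_le _ ?_
  rw [← hmap]
  have h1 := Ideal.spanFinrank_map_le_of_fg (algebraMap _ (Localization.AtPrime q))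
    (IsNoetherian.noetherian (maximalIdeal (Localization.AtPrime p)))
  refine (Nat.cast_le.2 h1).trans ?_
  rw [IsRegularLocalRing.spanFinrank_maximalIdeal,
    IsLocalization.AtPrime.ringKrullDim_eq_height p, IsLocalization.AtPrime.ringKrullDim_eq_height q]
  exact WithBot.coe_le_coe.2 (height_under_le_height q)

theorem isRegularRing_of_isStandardSmooth {A B : Type u} [CommRing A] [IsRegularRing A]
    [CommRing B] (f : A →+* B) (hf : f.IsStandardSmooth) : IsRegularRing B := by
  obtain ⟨n, g, -, hg⟩ := hf.exists_etale_mvPolynomial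
  let _ := g.toAlgebra
  have : Algebra.Etale (MvPolynomial (Fin n) A) B := hg
  exact isRegularRing_of_etale (MvPolynomial (Fin n) A) B

theorem isRegularRing_of_isAffineOpen {S : Scheme.{u}} [IsRegular S] {U : S.Opens}
    (hU : IsAffineOpen U) : IsRegularRing Γ(S, U) := by
  have : IsNoetherianRing Γ(S, U) := IsLocallyNoetherian.component_noetherian ⟨U, hU⟩
  refine isRegularRing_iff.2 fun p hp => ?_
  let y : PrimeSpectrum Γ(S, U) := ⟨p, hp⟩
  let x := hU.fromSpec y
  have hx : x ∈ U := (hU.isoSpec.inv y).2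
  let _ : Algebra Γ(S, U) (S.presheaf.stalk x) :=
    TopCat.Presheaf.algebra_section_stalk S.presheaf ⟨x, hx⟩
  have : IsLocalization p.primeCompl (S.presheaf.stalk x) := hU.isLocalization_stalk' y hx
  have := IsRegular.stalk x
  exact IsRegularLocalRing.of_ringEquiv (IsLocalization.algEquiv p.primeCompl
    (S.presheaf.stalk x) (Localization.AtPrime p)).toRingEquiv

/-- The induction for factoriality needs all localizations of the stalk to be regular; they are, as
the stalk is a localization of a regular ring of functions on an affine chart. -/
theorem isRegularRing_stalk_of_smooth {X S : Scheme.{u}} [IsRegular S] (f : X ⟶ S) [Smooth f]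
    (x : X) : IsRegularRing (X.presheaf.stalk x) := by
  obtain ⟨U, hU, V, hV, hx, e, hf⟩ := Smooth.exists_isStandardSmooth f x
  have := isRegularRing_of_isAffineOpen hU
  have := isRegularRing_of_isStandardSmooth _ hf
  let _ := X.presheaf.algebra_section_stalk (⟨x, hx⟩ : V)
  have := hV.isLocalization_stalk ⟨x, hx⟩
  exact IsRegularRing.of_ringEquiv (IsLocalization.algEquiv
    (hV.primeIdealOf ⟨x, hx⟩).asIdeal.primeCompl
    (Localization.AtPrime (hV.primeIdealOf ⟨x, hx⟩).asIdeal) (X.presheaf.stalk x)).toRingEquiv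

end Smooth
end
end EquivariantJouanolou

namespace EquivariantJouanolou
noncomputable section

/-! ### Complements of affine open subsets of regular schemes -/

section Complement

/-- Think of b_ij / a_j^n as functions t_i, independent of j, with ∑ t_i a_i = 1 off the zero set of
the a_i. Let g be the gcd and a_i = g β_i. As the β_k^n have no common factor, β_j^n divides b_ij,
so t_i has denominator g^n only, and g^n lies in the ideal. This is the algebra behind the
complement of an affine open being a divisor. -/
theorem exists_dvd_pow_mem_span {R : Type u} [CommRing R] [IsDomain R]
    [UniqueFactorizationMonoid R] {ι : Type*} [Fintype ι] (a : ι → R) (n : ℕ) (b : ι → ι → R)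
    (h₁ : ∀ i j k, a j ^ n * b i k = a k ^ n * b i j) (h₂ : ∀ j, ∑ i, a i * b i j = a j ^ n)
    {j : ι} (hj : a j ≠ 0) :
    ∃ g, (∀ i, g ∣ a i) ∧ g ^ n ∈ Ideal.span (Set.range a) := by
  classical
  let _ : StrongNormalizationMonoid R := UniqueFactorizationMonoid.strongNormalizationMonoid
  let _ : StrongNormalizedGCDMonoid R := UniqueFactorizationMonoid.toStrongNormalizedGCDMonoid R
  obtain ⟨β, hβ, hgcd⟩ := Finset.univ.extract_gcd a ⟨j, Finset.mem_univ j⟩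
  set g := Finset.univ.gcd a
  have hβ (i) : a i = g * β i := hβ i (Finset.mem_univ i)
  have hg0 : g ≠ 0 := fun h => hj (by rw [hβ, h, zero_mul])
  have hβj : β j ≠ 0 := fun h => hj (by rw [hβ, h, mul_zero])
  have hunit : IsUnit (Finset.univ.gcd fun k => β k ^ n) := by
    by_contra hu
    have hne : (Finset.univ.gcd fun k => β k ^ n) ≠ 0 := fun h =>
      pow_ne_zero n hβj (Finset.gcd_eq_zero_iff.1 h j (Finset.mem_univ j))
    obtain ⟨π, hπ, hdvd⟩ := WfDvdMonoid.exists_irreducible_factor hu hne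
    refine hπ.not_isUnit (isUnit_of_dvd_one ?_)
    rw [← hgcd]
    exact Finset.dvd_gcd fun k hk =>
      hπ.prime.dvd_of_dvd_pow (hdvd.trans (Finset.gcd_dvd hk))
  have hdvd (i) : β j ^ n ∣ b i j := by
    have : β j ^ n ∣ Finset.univ.gcd fun k => β k ^ n * b i j := by
      refine Finset.dvd_gcd fun k _ => ⟨b i k, ?_⟩
      have := h₁ i j k
      rw [hβ j, hβ k, mul_pow, mul_pow, mul_assoc, mul_assoc] at this
      exact (mul_left_cancel₀ (pow_ne_zero n hg0) this).symm
    rw [Finset.gcd_mul_right] at this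
    exact (dvd_normalize_iff.1 (hunit.dvd_mul_left.1 this))
  choose c hc using hdvd
  refine ⟨g, fun i => ⟨β i, hβ i⟩, ?_⟩
  have : g ^ n = ∑ i, c i * a i := by
    refine mul_right_cancel₀ (pow_ne_zero n hβj) ?_
    rw [← mul_pow, ← hβ, ← h₂ j, Finset.sum_mul]
    refine Finset.sum_congr rfl fun i _ => ?_
    rw [hc i]
    ring
  rw [this]
  exact Ideal.sum_mem _ fun i _ => Ideal.mul_mem_left _ _ (Ideal.subset_span ⟨i, rfl⟩)

/-- The preceding gcd, taken in the local ring at `p`, divides all of `I` and has a power in the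
extension of `I`. As `I` is radical, it generates `I` locally at `p`; denominators are then cleared.
-/
theorem exists_forall_dvd_of_isRadical {B : Type u} [CommRing B] [IsDomain B] (p : Ideal B)
    [p.IsPrime] (R : Type u) [CommRing R] [IsDomain R] [Algebra B R] [IsLocalization.AtPrime R p]
    [UniqueFactorizationMonoid R] {I : Ideal B} (hI : I.IsRadical) {ι : Type*} [Fintype ι]
    (a : ι → B) (ha : Ideal.span (Set.range a) = I) (n : ℕ) (b : ι → ι → B)
    (h₁ : ∀ i j k, a j ^ n * b i k = a k ^ n * b i j) (h₂ : ∀ j, ∑ i, a i * b i j = a j ^ n)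
    (hI0 : I ≠ ⊥) : ∃ f ∈ I, ∃ s ∉ p, ∀ b ∈ I, f ∣ s * b := by
  have hinj : Function.Injective (algebraMap B R) :=
    IsLocalization.injective R p.primeCompl_le_nonZeroDivisors
  obtain ⟨j, hj⟩ : ∃ j, a j ≠ 0 := by
    by_contra! h
    exact hI0 (by rw [← ha, Ideal.span_eq_bot]; rintro _ ⟨j, rfl⟩; exact h j)
  obtain ⟨g, hg, hgn⟩ := exists_dvd_pow_mem_span (fun i => algebraMap B R (a i)) n
    (fun i k => algebraMap B R (b i k)) (fun i j k => by simp only [← map_pow, ← map_mul, h₁ i j k])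
    (fun j => by simp only [← map_pow, ← map_mul, ← map_sum, h₂ j]) (j := j)
    ((map_ne_zero_iff _ hinj).2 hj)
  obtain ⟨⟨f, t⟩, hft⟩ := IsLocalization.surj p.primeCompl g
  have ht : IsUnit (algebraMap B R t) := IsLocalization.map_units R t
  have hfdvd (i) : algebraMap B R f ∣ algebraMap B R (a i) := by
    rw [← hft]
    exact ht.mul_right_dvd.2 (hg i)
  have hfn : algebraMap B R (f ^ n) ∈ I.map (algebraMap B R) := by
    rw [map_pow, ← hft, mul_pow, ← ha, Ideal.map_span, ← Set.range_comp]
    exact Ideal.mul_mem_right _ _ hgn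
  obtain ⟨s, hs, hsf⟩ := (IsLocalization.algebraMap_mem_map_algebraMap_iff p.primeCompl R _ _).1 hfn
  have hsfI : s * f ∈ I := by
    rcases Nat.eq_zero_or_pos n with rfl | hn
    · rw [pow_zero, mul_one] at hsf
      exact Ideal.mul_mem_right _ _ hsf
    · refine hI ⟨n, ?_⟩
      rw [mul_pow, ← Nat.sub_add_cancel hn, pow_succ s, mul_assoc, Nat.sub_add_cancel hn]
      exact Ideal.mul_mem_left _ _ hsf
  have hd (i) : ∃ r ∉ p, s * f ∣ r * a i := by
    obtain ⟨d, hd⟩ := hfdvd i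
    obtain ⟨⟨d', r⟩, hdr⟩ := IsLocalization.surj p.primeCompl d
    refine ⟨s * r, p.primeCompl.mul_mem hs r.2, d', hinj ?_⟩
    simp only [map_mul, hd, ← hdr]
    ring
  choose r hr hrd using hd
  refine ⟨s * f, hsfI, ∏ i, r i, ?_, fun b hb => ?_⟩
  · rw [Ideal.IsPrime.prod_mem_iff]
    rintro ⟨i, -, hi⟩
    exact hr i hi
  · rw [← ha] at hb
    induction hb using Submodule.span_induction with
    | mem b hb =>
      obtain ⟨i, rfl⟩ := hb
      exact (hrd i).trans (mul_dvd_mul_right (Finset.dvd_prod_of_mem r (Finset.mem_univ i)) _)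
    | zero => simp
    | add b b' _ _ h h' => rw [mul_add]; exact dvd_add h h'
    | smul r b _ h => rw [smul_eq_mul, mul_left_comm]; exact h.mul_left r

end Complement
end
end EquivariantJouanolou

/-! ### Local equations for the complement of a dense affine open -/

namespace EquivariantJouanolou
noncomputable section

section LocalEquation

variable {X : Scheme.{u}}

/-- The reduced ideal sheaf of the complement of an open subset. -/
def complIdeal (U : X.Opens) : X.IdealSheafData := .vanishingIdeal U.compl

theorem mem_complIdeal_iff (U : X.Opens) (V : X.affineOpens) (f : Γ(X, V)) :
    f ∈ (complIdeal U).ideal V ↔ X.basicOpen f ≤ U := by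
  have h : f ∈ (complIdeal U).ideal V ↔ V.2.fromSpec ⁻¹ᵁ (X.basicOpen f) ≤ V.2.fromSpec ⁻¹ᵁ U := by
    rw [V.2.fromSpec_preimage_basicOpen]
    change f ∈ PrimeSpectrum.vanishingIdeal _ ↔ _
    rw [PrimeSpectrum.mem_vanishingIdeal]
    constructor
    · intro h x hx
      by_contra hxU
      exact hx (h x hxU)
    · intro h x hx
      by_contra hxf
      exact hx (h hxf)
  rw [h]
  constructor
  · intro h x hx
    have hxV : x ∈ V.1 := X.basicOpen_le f hx
    obtain ⟨y, rfl⟩ : ∃ y, V.2.fromSpec y = x := ⟨_, V.2.fromSpec_primeIdealOf ⟨x, hxV⟩⟩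
    exact h hx
  · exact fun h => V.2.fromSpec.preimage_mono h

theorem isRadical_complIdeal (U : X.Opens) (V : X.affineOpens) :
    ((complIdeal U).ideal V).IsRadical := by
  rintro f ⟨n, hn⟩
  rcases Nat.eq_zero_or_pos n with rfl | h
  · rw [pow_zero] at hn
    rw [(Ideal.eq_top_iff_one _).2 hn]
    trivial
  · rw [mem_complIdeal_iff, X.basicOpen_pow _ h] at hn
    exact (mem_complIdeal_iff U V f).2 hn

theorem map_rs_complIdeal (U : X.Opens) {V W : X.Opens} (hV : IsAffineOpen V) (hW : IsAffineOpen W)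
    (h : W ≤ V) :
    ((complIdeal U).ideal ⟨V, hV⟩).map (rs h) = (complIdeal U).ideal ⟨W, hW⟩ :=
  (complIdeal U).map_ideal (U := ⟨W, hW⟩) (V := ⟨V, hV⟩) h

theorem germ_ne_zero {V : X.Opens} (hV : IsAffineOpen V) [IsDomain Γ(X, V)] {f : Γ(X, V)}
    (hf : f ≠ 0) {x : X} (hx : x ∈ V) : X.presheaf.germ V x hx f ≠ 0 := by
  let _ := X.presheaf.algebra_section_stalk (⟨x, hx⟩ : V)
  have := hV.isLocalization_stalk ⟨x, hx⟩
  exact (map_ne_zero_iff _ (IsLocalization.injective (X.presheaf.stalk x)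
    (hV.primeIdealOf ⟨x, hx⟩).asIdeal.primeCompl_le_nonZeroDivisors)).2 hf

theorem isDomain_stalk {V : X.Opens} (hV : IsAffineOpen V) [IsDomain Γ(X, V)] {x : X}
    (hx : x ∈ V) : IsDomain (X.presheaf.stalk x) := by
  let _ := X.presheaf.algebra_section_stalk (⟨x, hx⟩ : V)
  have := hV.isLocalization_stalk ⟨x, hx⟩
  exact IsLocalization.isDomain_of_le_nonZeroDivisors _
    (hV.primeIdealOf ⟨x, hx⟩).asIdeal.primeCompl_le_nonZeroDivisors

/-- All stalks on `V` are localizations of the domain Γ(X, V), and `f` is nonzero in each. `W` may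
be arbitrary, even disconnected or empty. -/
theorem eq_zero_of_rs_mul_eq_zero {V : X.Opens} (hV : IsAffineOpen V) [IsDomain Γ(X, V)]
    {f : Γ(X, V)} (hf : f ≠ 0) {W : X.Opens} (h : W ≤ V) {t : Γ(X, W)} (ht : rs h f * t = 0) :
    t = 0 := by
  refine TopCat.Presheaf.section_ext X.sheaf W t 0 fun x hx => ?_
  have := isDomain_stalk hV (h hx)
  have hmul := congrArg (X.presheaf.germ W x hx) ht
  rw [map_mul, map_zero] at hmul
  refine ((mul_eq_zero.1 hmul).resolve_left ?_).trans (map_zero _).symm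
  have : X.presheaf.germ W x hx (rs h f) = X.presheaf.germ V x (h hx) f :=
    TopCat.Presheaf.germ_res_apply _ _ _ _ _
  rw [this]
  exact germ_ne_zero hV hf (h hx)

/-- The kernel of Γ(X, V) → stalk is finitely generated, so one function invertible at `x` kills it.
On the principal open set of that function, sections inject into the stalk. -/
theorem exists_isAffineOpen_isDomain [IsLocallyNoetherian X] (x : X)
    [IsDomain (X.presheaf.stalk x)] :
    ∃ V : X.Opens, IsAffineOpen V ∧ x ∈ V ∧ IsDomain Γ(X, V) := by
  obtain ⟨_, ⟨V, hV, rfl⟩, hx, -⟩ :=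
    X.isBasis_affineOpens.exists_subset_of_mem_open (Set.mem_univ x) isOpen_univ
  have : IsNoetherianRing Γ(X, V) := IsLocallyNoetherian.component_noetherian ⟨V, hV⟩
  let _ := X.presheaf.algebra_section_stalk (⟨x, hx⟩ : V)
  have hloc := hV.isLocalization_stalk ⟨x, hx⟩
  let p := (hV.primeIdealOf ⟨x, hx⟩).asIdeal
  let R := X.presheaf.stalk x
  obtain ⟨T, hT⟩ : (RingHom.ker (algebraMap Γ(X, V) R)).FG := IsNoetherian.noetherian _
  have hs (t : Γ(X, V)) (ht : t ∈ RingHom.ker (algebraMap Γ(X, V) R)) :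
      ∃ s ∉ p, s * t = 0 := by
    obtain ⟨s, hs⟩ := (IsLocalization.map_eq_zero_iff p.primeCompl R t).1 ht
    exact ⟨s, s.2, hs⟩
  choose! s hsp hs using hs
  let r := ∏ t ∈ T, s t
  have hr : r ∉ p := by
    rw [Ideal.IsPrime.prod_mem_iff]
    rintro ⟨t, ht, htp⟩
    exact hsp t (hT ▸ Ideal.subset_span ht) htp
  have hrt (t : Γ(X, V)) (ht : algebraMap Γ(X, V) R t = 0) : r * t = 0 := by
    have ht' : t ∈ RingHom.ker (algebraMap Γ(X, V) R) := ht
    rw [← hT] at ht'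
    clear ht
    induction ht' using Submodule.span_induction with
    | mem t ht =>
      have := mul_dvd_mul_right (Finset.dvd_prod_of_mem s ht) t
      rw [hs t (hT ▸ Ideal.subset_span ht)] at this
      exact zero_dvd_iff.1 this
    | zero => simp
    | add b b' _ _ h h' => rw [mul_add, h, h', add_zero]
    | smul c b _ h => rw [smul_eq_mul, mul_left_comm, h, mul_zero]
  have hxr : x ∈ X.basicOpen r :=
    (X.mem_basicOpen r x hx).2 (IsLocalization.map_units R (⟨r, hr⟩ : p.primeCompl))
  refine ⟨X.basicOpen r, hV.basicOpen r, hxr, ?_⟩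
  have hloc' := hV.isLocalization_basicOpen r
  have hinj : Function.Injective (X.presheaf.germ (X.basicOpen r) x hxr) := by
    rw [injective_iff_map_eq_zero]
    intro t ht
    obtain ⟨⟨b, c⟩, hbc⟩ := IsLocalization.surj (Submonoid.powers r) t
    have hb : algebraMap Γ(X, V) R b = 0 := by
      have := congrArg (X.presheaf.germ (X.basicOpen r) x hxr) hbc
      rw [map_mul, ht, zero_mul] at this
      exact ((TopCat.Presheaf.germ_res_apply X.presheaf (homOfLE (X.basicOpen_le r)) x hxr b).symm.trans
        this.symm)
    have hb' := congrArg (algebraMap Γ(X, V) Γ(X, X.basicOpen r)) (hrt b hb)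
    rw [map_mul, map_zero] at hb'
    have hru : IsUnit (algebraMap Γ(X, V) Γ(X, X.basicOpen r) r) :=
      IsLocalization.map_units _ (⟨r, Submonoid.mem_powers r⟩ : Submonoid.powers r)
    rw [hru.mul_right_eq_zero.1 hb'] at hbc
    exact (IsLocalization.map_units _ c).mul_left_eq_zero.1 hbc
  exact hinj.isDomain (X.presheaf.germ (X.basicOpen r) x hxr).hom

/-- One power of `a` extends `t` from its restriction to the locus of `a`; a further power makes the
extension agree with it on `W`. All large exponents work, so that one can serve finitely many
sections. -/
theorem exists_rs_eq_pow_mul {V W : X.Opens} (hV : IsAffineOpen V) (hW : IsAffineOpen W)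
    (h : W ≤ V) (a : Γ(X, V)) (ha : X.basicOpen a ≤ W) (t : Γ(X, W)) :
    ∃ n : ℕ, ∀ m ≥ n, ∃ b : Γ(X, V), rs h b = rs h a ^ m * t := by
  have hle : X.basicOpen (rs h a) = X.basicOpen a := by
    rw [basicOpen_rs]
    exact inf_eq_right.2 ha
  obtain ⟨k, y, hy⟩ := exists_eq_pow_mul_of_isAffineOpen X V hV a (rs ha t)
  have hy' : rs ha (rs h y) = rs ha (rs h a ^ k * t) := by
    rw [map_mul, map_pow, rs_rs, rs_rs]
    exact hy
  obtain ⟨l, hl⟩ : ∃ l, rs h a ^ l * rs h y = rs h a ^ l * (rs h a ^ k * t) := by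
    refine exists_of_res_eq_of_qcqs hW.isCompact hW.isQuasiSeparated ?_
    have h₂ (z : Γ(X, W)) : rs hle.le (rs ha z) = rs (X.basicOpen_le (rs h a)) z := rs_rs _ _ z
    have := congrArg (rs hle.le) hy'
    rw [h₂, h₂] at this
    exact this
  refine ⟨l + k, fun m hm => ⟨a ^ (m - k) * y, ?_⟩⟩
  rw [map_mul, map_pow, show m - k = (m - k - l) + l by omega, pow_add, mul_assoc, hl,
    ← mul_assoc, ← mul_assoc, ← pow_add, ← pow_add]
  congr 2
  omega

/-- Generators `a j` of the ideal of the complement generate the unit ideal on the intersection of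
`U` with an affine chart, which is affine since `X` is separated. Extending the coefficients of ∑
t_i a_i = 1 to the chart supplies the data for the gcd argument. Density of `U` makes the ideal
nonzero and restriction to `U` injective. -/
theorem exists_complIdeal_eq_span [IsLocallyNoetherian X] [X.IsSeparated] {U : X.Opens}
    (hU : IsAffineOpen U) (hdense : ∀ V : X.Opens, V ≠ ⊥ → U ⊓ V ≠ ⊥) (x : X)
    [IsDomain (X.presheaf.stalk x)] [UniqueFactorizationMonoid (X.presheaf.stalk x)] :
    ∃ (V : X.Opens) (hV : IsAffineOpen V), x ∈ V ∧ IsDomain Γ(X, V) ∧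
      ∃ f : Γ(X, V), f ≠ 0 ∧ (complIdeal U).ideal ⟨V, hV⟩ = Ideal.span {f} := by
  obtain ⟨V, hV, hx, hdom⟩ := exists_isAffineOpen_isDomain x
  have : IsNoetherianRing Γ(X, V) := IsLocallyNoetherian.component_noetherian ⟨V, hV⟩
  let I := (complIdeal U).ideal ⟨V, hV⟩
  have hmem (f : Γ(X, V)) : f ∈ I ↔ X.basicOpen f ≤ U := mem_complIdeal_iff U ⟨V, hV⟩ f
  have hC : IsAffineOpen (U ⊓ V) := hU.inf hV
  let h : U ⊓ V ≤ V := inf_le_right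
  obtain ⟨y, hyU, hyV⟩ : ∃ y, y ∈ U ∧ y ∈ V := by
    by_contra! hc
    refine hdense V (fun h => ?_) (eq_bot_iff.2 fun y hy => hc y hy.1 hy.2)
    rw [h] at hx
    exact hx
  have hinj : Function.Injective (rs h) := by
    rw [injective_iff_map_eq_zero]
    intro b hb
    by_contra hb0
    refine germ_ne_zero hV hb0 hyV ?_
    have : X.presheaf.germ (U ⊓ V) y ⟨hyU, hyV⟩ (rs h b) = X.presheaf.germ V y hyV b :=
      TopCat.Presheaf.germ_res_apply _ _ _ _ _
    rw [← this, hb, map_zero]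
  have hI0 : I ≠ ⊥ := by
    obtain ⟨f, hf, hyf⟩ := hV.exists_basicOpen_le ⟨y, hyU⟩ hyV
    intro hI
    have : f ∈ I := (hmem f).2 hf
    rw [hI, Ideal.mem_bot] at this
    rw [this, Scheme.basicOpen_zero] at hyf
    exact hyf
  obtain ⟨m, a, ha⟩ := Submodule.fg_iff_exists_fin_generating_family.1 (IsNoetherian.noetherian I)
  have haI (j) : a j ∈ I := ha ▸ Submodule.subset_span ⟨j, rfl⟩
  -- Every point of the affine `U ⊓ V` has a neighbourhood `X.basicOpen f` inside `U`, and such `f`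
  -- lie in `I`.
  have htop : I.map (rs h) = ⊤ := by
    refine (hC.self_le_iSup_basicOpen_iff).1 ?_
    rintro z ⟨hzU, hzV⟩
    obtain ⟨f, hf, hzf⟩ := hV.exists_basicOpen_le ⟨z, hzU⟩ hzV
    refine TopologicalSpace.Opens.mem_iSup.2 ⟨⟨rs h f, f, (hmem f).2 hf, rfl⟩, ?_⟩
    rw [basicOpen_rs]
    exact ⟨⟨hzU, hzV⟩, hzf⟩
  obtain ⟨t, ht⟩ : ∃ t : Fin m → Γ(X, U ⊓ V), ∑ i, t i * rs h (a i) = 1 := by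
    refine Ideal.mem_span_range_iff_exists_fun.1 ?_
    have : Ideal.span (Set.range fun i => rs h (a i)) = I.map (rs h) := by
      rw [← ha]
      change _ = Ideal.map (rs h) (Ideal.span (Set.range a))
      rw [Ideal.map_span, ← Set.range_comp]
      rfl
    rw [this, htop]
    trivial
  -- The locus of `a j` lies in `U`, so a_j^N t_i extends to `V`; this extension is `b i j`, with
  -- one `N` for all pairs.
  have hn (i j) := exists_rs_eq_pow_mul hV hC h (a j) (le_inf ((hmem _).1 (haI j)) (X.basicOpen_le _)) (t i)
  choose n hn using hn
  let N := ∑ i, ∑ j, n i j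
  have hN (i j) : n i j ≤ N :=
    (Finset.single_le_sum (f := fun j => n i j) (fun _ _ => Nat.zero_le _) (Finset.mem_univ j)).trans
      (Finset.single_le_sum (f := fun i => ∑ j, n i j) (fun _ _ => Nat.zero_le _) (Finset.mem_univ i))
  choose b hb using fun i j => hn i j N (hN i j)
  let _ := X.presheaf.algebra_section_stalk (⟨x, hx⟩ : V)
  have hloc := hV.isLocalization_stalk ⟨x, hx⟩
  obtain ⟨f, hfI, s, hs, hfs⟩ := exists_forall_dvd_of_isRadical
    (hV.primeIdealOf ⟨x, hx⟩).asIdeal (X.presheaf.stalk x) (isRadical_complIdeal U ⟨V, hV⟩) a ha N b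
    (fun i j k => hinj (by
      simp only [map_mul, map_pow, hb]
      ring))
    (fun j => hinj (by
      simp only [map_sum, map_mul, map_pow, hb]
      refine Eq.trans ?_ ((congrArg (rs h (a j) ^ N * ·) ht).trans (mul_one _))
      rw [Finset.mul_sum]
      exact Finset.sum_congr rfl fun i _ => by ring)) hI0
  have hxs : x ∈ X.basicOpen s := (X.mem_basicOpen s x hx).2 (IsLocalization.map_units
    (X.presheaf.stalk x) (⟨s, hs⟩ : (hV.primeIdealOf ⟨x, hx⟩).asIdeal.primeCompl))
  have hs0 : s ≠ 0 := fun h => hs (h ▸ zero_mem _)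
  have hf0 : f ≠ 0 := by
    rintro rfl
    obtain ⟨c, hc, hc0⟩ := Submodule.exists_mem_ne_zero_of_ne_bot hI0
    exact mul_ne_zero hs0 hc0 (zero_dvd_iff.1 (hfs c hc))
  have hsV := X.basicOpen_le s
  have hsu : IsUnit (rs hsV s) := RingedSpace.isUnit_res_basicOpen _ s
  have : IsLocalization.Away s Γ(X, X.basicOpen s) := hV.isLocalization_basicOpen s
  refine ⟨X.basicOpen s, hV.basicOpen s, hxs, IsLocalization.isDomain_of_le_nonZeroDivisors _
    (powers_le_nonZeroDivisors_of_noZeroDivisors hs0), rs hsV f, fun h0 => ?_, ?_⟩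
  · have : (1 : Γ(X, X.basicOpen s)) = 0 := eq_zero_of_rs_mul_eq_zero hV hf0 hsV (by rw [h0, zero_mul])
    have : X.presheaf.germ (X.basicOpen s) x hxs 1 = 0 := by rw [this, map_zero]
    rw [map_one] at this
    exact one_ne_zero this
  · rw [← map_rs_complIdeal U hV (hV.basicOpen s) hsV]
    refine le_antisymm (Ideal.map_le_iff_le_comap.2 fun c hc => ?_)
      ((Ideal.span_singleton_le_iff_mem _).2 (Ideal.mem_map_of_mem _ hfI))
    have := map_dvd (rs hsV) (hfs c hc)
    rw [map_mul] at this
    exact Ideal.mem_span_singleton.2 (hsu.dvd_mul_left.1 this)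

end LocalEquation
end
end EquivariantJouanolou

/-! ### Line bundles with sections on separated Noetherian schemes with factorial stalks -/

namespace EquivariantJouanolou
noncomputable section

section Regular

variable {X : Scheme.{u}}

/-- A maximal affine open neighbourhood of `x` is dense: otherwise a disjoint nonempty affine open
could be added, and the disjoint union would still be affine. -/
theorem exists_isAffineOpen_dense [IsNoetherian X] (x : X) :
    ∃ U : X.Opens, IsAffineOpen U ∧ x ∈ U ∧ ∀ V : X.Opens, V ≠ ⊥ → U ⊓ V ≠ ⊥ := by
  have hwf : WellFoundedGT X.Opens :=
    (inferInstance : TopologicalSpace.NoetherianSpace X)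
  obtain ⟨_, ⟨U₀, hU₀, rfl⟩, hx, -⟩ :=
    X.isBasis_affineOpens.exists_subset_of_mem_open (Set.mem_univ x) isOpen_univ
  obtain ⟨U, ⟨hU, hxU⟩, hmax⟩ := hwf.wf.has_min {U : X.Opens | IsAffineOpen U ∧ x ∈ U}
    ⟨U₀, hU₀, hx⟩
  refine ⟨U, hU, hxU, fun V hV hUV => ?_⟩
  obtain ⟨y, hy⟩ : ∃ y, y ∈ V := by
    by_contra! h
    exact hV (eq_bot_iff.2 fun y hy => (h y hy).elim)
  obtain ⟨_, ⟨W, hW, rfl⟩, hyW, hWV⟩ :=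
    X.isBasis_affineOpens.exists_subset_of_mem_open (SetLike.mem_coe.2 hy) V.isOpen
  have hdisj : Disjoint U W := (disjoint_iff.2 hUV).mono_right hWV
  refine hmax (U ⊔ W) ⟨hU.sup_of_disjoint hW hdisj, Or.inl hxU⟩ (left_lt_sup.2 fun hWU => ?_)
  exact (disjoint_iff.1 hdisj).le ⟨hWU hyW, hyW⟩

theorem inf_eq_basicOpen_of_complIdeal_eq_span {U V : X.Opens} (hV : IsAffineOpen V) {f : Γ(X, V)}
    (h : (complIdeal U).ideal ⟨V, hV⟩ = Ideal.span {f}) : U ⊓ V = X.basicOpen f := by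
  have hmem (t : Γ(X, V)) : t ∈ (complIdeal U).ideal ⟨V, hV⟩ ↔ X.basicOpen t ≤ U :=
    mem_complIdeal_iff U ⟨V, hV⟩ t
  refine le_antisymm ?_ (le_inf ((hmem f).1 (h ▸ Ideal.mem_span_singleton_self f)) (X.basicOpen_le f))
  rintro x ⟨hxU, hxV⟩
  obtain ⟨t, ht, hxt⟩ := hV.exists_basicOpen_le ⟨x, hxU⟩ hxV
  have htf := (hmem t).2 ht
  rw [h] at htf
  obtain ⟨c, rfl⟩ := Ideal.mem_span_singleton.1 htf
  rw [X.basicOpen_mul] at hxt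
  exact hxt.1

/-- The line bundle for `D i` is the one of the divisor complementary to `D i`, with its canonical
section. Local equations are the coordinates of the section, and their quotients, unique as the
equations are nonzerodivisors, are the transition functions. -/
theorem exists_ampleCocycle_of_uniqueFactorizationMonoid [IsNoetherian X] [X.IsSeparated]
    (hdom : ∀ x : X, IsDomain (X.presheaf.stalk x))
    (hufd : ∀ x : X, UniqueFactorizationMonoid (X.presheaf.stalk x)) :
    ∃ (A I : Type u) (_ : Finite A) (_ : Finite I), Nonempty (AmpleCocycle X A I) := by
  have hfin {O : X → X.Opens} (hO : ∀ x, x ∈ O x) : ∃ S : Finset X, ⨆ x : S, O x.1 = ⊤ := by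
    obtain ⟨S, hS⟩ := isCompact_univ.elim_finite_subcover (fun x => (O x : Set X))
      (fun x => (O x).isOpen) fun x _ => Set.mem_iUnion.mpr ⟨x, hO x⟩
    refine ⟨S, top_le_iff.mp fun x _ => ?_⟩
    obtain ⟨y, hy, hxy⟩ := Set.mem_iUnion₂.mp (hS (Set.mem_univ x))
    exact TopologicalSpace.Opens.mem_iSup.mpr ⟨⟨y, hy⟩, hxy⟩
  choose D hD hxD hdense using exists_isAffineOpen_dense (X := X)
  obtain ⟨I, hI⟩ := hfin hxD
  choose V hV hxV hVdom f hf0 hf using fun (i : I) (x : X) =>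
    exists_complIdeal_eq_span (hD i) (hdense i) x
  have hloc (x : X) : ∃ U : X.Opens, x ∈ U ∧ IsAffineOpen U ∧ ∀ i : I, U ≤ V i x := by
    obtain ⟨_, ⟨U, hU, rfl⟩, hxU, hUO⟩ := X.isBasis_affineOpens.exists_subset_of_mem_open
      (Set.mem_iInter.mpr (fun i => hxV i x)) (isOpen_iInter_of_finite fun i => (V i x).isOpen)
    exact ⟨U, hxU, hU, fun i y hy => Set.mem_iInter.mp (hUO hy) i⟩
  choose U hxU hU hUV using hloc
  obtain ⟨A, hA⟩ := hfin hxU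
  have hspan (i : I) (x : X) {W : X.Opens} (hW : IsAffineOpen W) (h : W ≤ V i x) :
      (complIdeal (D i)).ideal ⟨W, hW⟩ = Ideal.span {rs h (f i x)} := by
    rw [← map_rs_complIdeal (D i) (hV i x) hW h, hf, Ideal.map_span, Set.image_singleton]
  have hcancel (i : I) (x : X) {W : X.Opens} (h : W ≤ V i x) {t t' : Γ(X, W)}
      (ht : t * rs h (f i x) = t' * rs h (f i x)) : t = t' := by
    have := hVdom i x
    refine sub_eq_zero.1 (eq_zero_of_rs_mul_eq_zero (hV i x) (hf0 i x) h ?_)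
    rw [mul_comm, sub_mul, ht, sub_self]
  have hg (i : I) (a b : X) : ∃ g : Γ(X, U a ⊓ U b),
      rs (inf_le_left.trans (hUV a i)) (f i a) = g * rs (inf_le_right.trans (hUV b i)) (f i b) := by
    have hab := (hU a).inf (hU b)
    have : rs (inf_le_left.trans (hUV a i)) (f i a) ∈ (complIdeal (D i)).ideal ⟨_, hab⟩ := by
      rw [hspan i a hab (inf_le_left.trans (hUV a i))]
      exact Ideal.mem_span_singleton_self _
    rw [hspan i b hab (inf_le_right.trans (hUV b i))] at this
    obtain ⟨g, hg⟩ := Ideal.mem_span_singleton'.1 this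
    exact ⟨g, hg.symm⟩
  choose g hg using hg
  refine ⟨A, I, inferInstance, inferInstance, ⟨{
    U a := U a
    isAffineOpen_U a := hU a
    iSup_U := hA
    s i a := rs (hUV a i) (f i a)
    g i a b := g i a b
    g_self i a := hcancel i a (inf_le_left.trans (hUV a i)) (by rw [← hg, one_mul])
    g_mul i a b c := ?_
    s_eq i a b := by rw [rs_rs, rs_rs, hg]
    D i := D i
    isAffineOpen_D i := hD i
    iSup_D := hI
    D_inf i a := inf_eq_basicOpen_of_complIdeal_eq_span (hU a) (hspan i a (hU a) (hUV a i)) }⟩⟩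
  refine hcancel i c (inf_le_right.trans (hUV c i)) ?_
  have h₁ := congrArg (rs (inf_le_left : U a ⊓ U b ⊓ U c ≤ U a ⊓ U b)) (hg i a b)
  have h₂ := congrArg (rs (le_inf (inf_le_left.trans inf_le_right) inf_le_right :
    U a ⊓ U b ⊓ U c ≤ U b ⊓ U c)) (hg i b c)
  have h₃ := congrArg (rs (le_inf (inf_le_left.trans inf_le_left) inf_le_right :
    U a ⊓ U b ⊓ U c ≤ U a ⊓ U c)) (hg i a c)
  simp only [map_mul, rs_rs] at h₁ h₂ h₃
  rw [mul_assoc, ← h₂, ← h₁, h₃]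

theorem exists_ampleCocycle_of_smooth {S : Scheme.{u}} [IsNoetherian S] [S.IsSeparated]
    [IsRegular S] (p : X ⟶ S) [IsSeparated p] [LocallyOfFiniteType p] [QuasiCompact p] [Smooth p] :
    ∃ (A I : Type u) (_ : Finite A) (_ : Finite I), Nonempty (AmpleCocycle X A I) := by
  have : IsLocallyNoetherian X := LocallyOfFiniteType.isLocallyNoetherian p
  have : CompactSpace X := QuasiCompact.compactSpace_of_compactSpace p
  have : IsNoetherian X := {}
  have : X.IsSeparated := by
    constructor
    rw [← terminal.comp_from p]
    infer_instance
  have hreg (x : X) := isRegularRing_stalk_of_smooth p x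
  have hdom (x : X) : IsDomain (X.presheaf.stalk x) :=
    have := hreg x
    have := IsRegularLocalRing.of_isRegularRing_of_isLocalRing (X.presheaf.stalk x)
    IsRegularLocalRing.isDomain _
  exact exists_ampleCocycle_of_uniqueFactorizationMonoid hdom fun x =>
    have := hreg x
    have := hdom x
    IsRegularRing.uniqueFactorizationMonoid _

end Regular
end
end EquivariantJouanolou

/-! ### Both statements, from cocycle data -/

theorem mainTheorem6 (G : Type v) [Group G] [Finite G] :
    (∀ X : Action Scheme.{u} G,
      EquivariantJouanolou.HasAmpleFamily X.V →
      IsUnit (Nat.card G : Γ(X.V, ⊤)) →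
      ∃ (W : Action Scheme.{u} G) (π : W ⟶ X),
        EquivariantJouanolou.IsNAffineBundle π ∧ IsAffine W.V) ∧
    (∀ (S : Scheme.{u}) [IsNoetherian S] [S.IsSeparated] [EquivariantJouanolou.IsRegular S],
      IsUnit (Nat.card G : Γ(S, ⊤)) →
      ∀ (X : Action Scheme.{u} G) (p : X ⟶ Action.trivial G S)
        [IsSeparated p.hom] [LocallyOfFiniteType p.hom] [QuasiCompact p.hom] [Smooth p.hom],
      ∃ (W : Action Scheme.{u} G) (π : W ⟶ X),
        EquivariantJouanolou.IsNAffineBundle π ∧ IsAffine W.V) := by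
  constructor
  · intro X hX _
    obtain ⟨A, I, _, _, ⟨d⟩⟩ := hX.exists_ampleCocycle
    exact EquivariantJouanolou.exists_isNAffineBundle X d
  · intro S _ _ _ _ X p _ _ _ _
    let q : X.V ⟶ S := p.hom
    have : IsSeparated q := ‹IsSeparated p.hom›
    have : LocallyOfFiniteType q := ‹LocallyOfFiniteType p.hom›
    have : QuasiCompact q := ‹QuasiCompact p.hom›
    have : Smooth q := ‹Smooth p.hom›
    obtain ⟨A, I, _, _, ⟨d⟩⟩ := EquivariantJouanolou.exists_ampleCocycle_of_smooth q
    exact EquivariantJouanolou.exists_isNAffineBundle X d
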